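/- Let $n>2$ be an integer, $B=\{x\in\mathbb R^n:|x|<1\}$, and let $\sigma$ be the normalized surface measure on the unit sphere $\partial B$. The Moebius group of $B$ is the group of bijections of $B$ generated under composition by the (restrictions to $B$ of the) orthogonal transformations of $\mathbb R^n$ and the maps $$\varphi_a(x)=\frac{a|x-a|^2+(1-|a|^2)(a-x)}{1-2\langle x,a\rangle+|x|^2|a|^2},\qquad a\in B.$$ A complex-valued $C^2$ function $f$ on $B$ is called $H$-harmonic if $(1-|x|^2)\big[(1-|x|^2)\Delta f(x)+2(n-2)\langle x,\nabla f(x)\rangle\big]=0$ on $B$. For $m=0,1,2,\dots$ let $\mathbf H^m$ be the space of continuous functions on $\overline B$ that are $H$-harmonic on $B$ and whose restriction to $\partial B$ is the restriction of a (complex) harmonic polynomial homogeneous of degree $m$; for $f,g\in\mathbf H^m$ put $\langle f,g\rangle_{\partial B}=\int_{\partial B}f\overline g\,d\sigma$ and $\|f\|_{\partial B}^2=\langle f,f\rangle_{\partial B}$. With $(x)_m=x(x+1)\cdots(x+m-1)$ let $$S_m(t)=\frac{(n-1)_m}{(n/2)_m}\,{}_2F_1\!\Big(m,1-\tfrac n2;m+\tfrac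 n2;t\Big),\qquad I_m(s)=\frac{\Gamma(\frac n2+s+1)}{\Gamma(\frac n2)\Gamma(s+1)}\int_0^1 t^{m+\frac n2-1}(1-t)^sS_m(t)^2\,dt\quad(\operatorname{Re}s>-1)$$ (for $s>-1$, $I_m(s)\|f\|_{\partial B}^2$ is the squared norm of $f\in\mathbf H^m$ in the weighted Bergman space $L^2(B,d\rho_s)$, $d\rho_s(x)=\frac{\Gamma(\frac n2+s+1)}{\pi^{n/2}\Gamma(s+1)}(1-|x|^2)^s\,dx$). Then, for every $m\ge0$, $I_m$ has a meromorphic continuation to the half-plane $\operatorname{Re}s>-n-1$ for which the limit $I_m^\circ:=\lim_{s\to-n}(s+n)I_m(s)$ exists and is real. Let the $H$-harmonic Dirichlet space $\mathcal H_\circ$ consist of all functions on $B$ of the form $f=\sum_m f_m$ (pointwise convergence on $B$) with $f_m\in\mathbf H^m$ and $\sum_m I_m^\circ\|f_m\|_{\partial B}^2<\infty$, with the semi-inner product $$\langle f,g\rangle_\circ=\sum_{m}I_m^\circ\,\langle f_m,g_m\rangle_{\partial B}.$$ This semi-inner product is Moebius invariant: for all $f,g\in\mathcal H_\circ$ and all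 $\varphi$ in the Moebius group of $B$, the functions $f\circ\varphi$ and $g\circ\varphi$ belong to $\mathcal H_\circ$ and $$\langle f\circ\varphi,g\circ\varphi\rangle_\circ=\langle f,g\rangle_\circ .$$ -/

import Mathlib

open MeasureTheory Filter Topology Metric

noncomputable section

namespace HHarm

/-- Euclidean space `ℝⁿ`. -/
abbrev E (n : ℕ) := EuclideanSpace ℝ (Fin n)

/-- The open unit ball of `ℝⁿ`, as a type. -/
abbrev Ball (n : ℕ) := ball (0 : E n) 1

/-! ### The Moebius group of the ball -/

/-- `[x,a] = √(1 - 2⟨x,a⟩ + |x|²|a|²)`. -/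
def bracket {n : ℕ} (x a : E n) : ℝ :=
  Real.sqrt (1 - 2 * inner ℝ x a + ‖x‖ ^ 2 * ‖a‖ ^ 2)

/-- `φ_a(x) = (a |x-a|² + (1-|a|²)(a-x)) / [x,a]²`. -/
def moebiusMap {n : ℕ} (a x : E n) : E n :=
  (bracket x a ^ 2)⁻¹ • (‖x - a‖ ^ 2 • a + (1 - ‖a‖ ^ 2) • (a - x))

theorem bracket_arg_pos {n : ℕ} {a x : E n} (ha : ‖a‖ < 1) (hx : ‖x‖ < 1) :
    0 < 1 - 2 * inner ℝ x a + ‖x‖ ^ 2 * ‖a‖ ^ 2 := by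
  have h1 : inner ℝ x a ≤ ‖x‖ * ‖a‖ := real_inner_le_norm x a
  have h2 : ‖x‖ * ‖a‖ < 1 :=
    mul_lt_one_of_nonneg_of_lt_one_left (norm_nonneg _) hx ha.le
  nlinarith [mul_pos (sub_pos.2 h2) (sub_pos.2 h2)]

theorem bracket_sq {n : ℕ} {a x : E n} (ha : ‖a‖ < 1) (hx : ‖x‖ < 1) :
    bracket x a ^ 2 = 1 - 2 * inner ℝ x a + ‖x‖ ^ 2 * ‖a‖ ^ 2 :=
  Real.sq_sqrt (bracket_arg_pos ha hx).le

/-- `1 - |φ_a(x)|² = (1-|a|²)(1-|x|²)/[x,a]²`. -/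
theorem one_sub_norm_moebiusMap_sq {n : ℕ} {a x : E n} (ha : ‖a‖ < 1) (hx : ‖x‖ < 1) :
    1 - ‖moebiusMap a x‖ ^ 2 =
      (1 - ‖a‖ ^ 2) * (1 - ‖x‖ ^ 2) / (1 - 2 * inner ℝ x a + ‖x‖ ^ 2 * ‖a‖ ^ 2) := by
  have hD := bracket_arg_pos ha hx
  have h1 : ‖‖x - a‖ ^ 2 • a + (1 - ‖a‖ ^ 2) • (a - x)‖ ^ 2 =
      (1 - 2 * inner ℝ x a + ‖x‖ ^ 2 * ‖a‖ ^ 2) * ‖x - a‖ ^ 2 := by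
    rw [norm_add_sq_real, norm_smul, norm_smul, mul_pow, mul_pow, inner_smul_left,
      inner_smul_right, inner_sub_right, real_inner_self_eq_norm_sq, real_inner_comm,
      Real.norm_eq_abs, Real.norm_eq_abs, sq_abs, sq_abs, norm_sub_sq_real, norm_sub_sq_real,
      real_inner_comm x a]
    simp only [conj_trivial]
    ring
  rw [moebiusMap, bracket_sq ha hx, norm_smul, mul_pow, h1, norm_sub_sq_real, Real.norm_eq_abs,
    sq_abs]
  field_simp
  ring

theorem norm_moebiusMap_lt_one {n : ℕ} {a x : E n} (ha : ‖a‖ < 1) (hx : ‖x‖ < 1) :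
    ‖moebiusMap a x‖ < 1 := by
  have h := one_sub_norm_moebiusMap_sq ha hx
  have hpos : 0 < (1 - ‖a‖ ^ 2) * (1 - ‖x‖ ^ 2) /
      (1 - 2 * inner ℝ x a + ‖x‖ ^ 2 * ‖a‖ ^ 2) := by
    apply div_pos (mul_pos _ _) (bracket_arg_pos ha hx)
    · nlinarith [norm_nonneg a]
    · nlinarith [norm_nonneg x]
  nlinarith [norm_nonneg (moebiusMap a x)]

theorem moebiusMap_moebiusMap {n : ℕ} {a x : E n} (ha : ‖a‖ < 1) (hx : ‖x‖ < 1) :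
    moebiusMap a (moebiusMap a x) = x := by
  have hy := norm_moebiusMap_lt_one ha hx
  have hD := bracket_arg_pos ha hx
  have hb : 0 < 1 - ‖a‖ ^ 2 := by nlinarith [norm_nonneg a]
  have hy2 := one_sub_norm_moebiusMap_sq ha hx
  have hyv : moebiusMap a x = (1 - 2 * inner ℝ x a + ‖x‖ ^ 2 * ‖a‖ ^ 2)⁻¹ •
      (‖x - a‖ ^ 2 • a + (1 - ‖a‖ ^ 2) • (a - x)) := by rw [moebiusMap, bracket_sq ha hx]
  have hya : inner ℝ (moebiusMap a x) a = (1 - 2 * inner ℝ x a + ‖x‖ ^ 2 * ‖a‖ ^ 2)⁻¹ *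
      ((‖x‖ ^ 2 - 2 * inner ℝ x a + ‖a‖ ^ 2) * ‖a‖ ^ 2 +
        (1 - ‖a‖ ^ 2) * (‖a‖ ^ 2 - inner ℝ x a)) := by
    rw [hyv, inner_smul_left, inner_add_left, inner_smul_left, inner_smul_left, inner_sub_left,
      real_inner_self_eq_norm_sq, norm_sub_sq_real]
    simp only [conj_trivial]
  rw [moebiusMap, bracket_sq ha hy, norm_sub_sq_real]
  have hs : ‖moebiusMap a x‖ ^ 2 = 1 - (1 - ‖a‖ ^ 2) * (1 - ‖x‖ ^ 2) /
      (1 - 2 * inner ℝ x a + ‖x‖ ^ 2 * ‖a‖ ^ 2) := by linarith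
  rw [hya, hs, hyv, norm_sub_sq_real]
  clear hya hs hyv hy2
  generalize inner ℝ x a = c at *
  generalize ‖x‖ ^ 2 = p at *
  generalize ‖a‖ ^ 2 = q at *
  obtain ⟨D, hDdef⟩ : ∃ D, D = 1 - 2 * c + p * q := ⟨_, rfl⟩
  rw [← hDdef] at hD ⊢
  obtain rfl : c = (1 + p * q - D) / 2 := by linarith
  have hD' := hD.ne'
  have hb' := hb.ne'
  have e1 : 1 - 2 * (D⁻¹ * ((p - 2 * ((1 + p * q - D) / 2) + q) * q +
      (1 - q) * (q - (1 + p * q - D) / 2))) +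
      (1 - (1 - q) * (1 - p) / D) * q = (1 - q) ^ 2 / D := by
    field_simp
    ring
  rw [e1]
  match_scalars
  · field_simp
    ring
  · field_simp

/-- The involution `φ_a` of the ball. -/
def moebius {n : ℕ} (a : Ball n) : Equiv.Perm (Ball n) where
  toFun x := ⟨moebiusMap a x, mem_ball_zero_iff.2
    (norm_moebiusMap_lt_one (mem_ball_zero_iff.1 a.2) (mem_ball_zero_iff.1 x.2))⟩
  invFun x := ⟨moebiusMap a x, mem_ball_zero_iff.2
    (norm_moebiusMap_lt_one (mem_ball_zero_iff.1 a.2) (mem_ball_zero_iff.1 x.2))⟩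
  left_inv x := Subtype.ext
    (moebiusMap_moebiusMap (mem_ball_zero_iff.1 a.2) (mem_ball_zero_iff.1 x.2))
  right_inv x := Subtype.ext
    (moebiusMap_moebiusMap (mem_ball_zero_iff.1 a.2) (mem_ball_zero_iff.1 x.2))

/-- An orthogonal transformation `U ∈ O(n)`, restricted to the ball. -/
def orthogonal {n : ℕ} (U : E n ≃ₗᵢ[ℝ] E n) : Equiv.Perm (Ball n) where
  toFun x := ⟨U x, mem_ball_zero_iff.2 (by
    rw [U.norm_map]; exact mem_ball_zero_iff.1 x.2)⟩
  invFun x := ⟨U.symm x, mem_ball_zero_iff.2 (by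
    rw [U.symm.norm_map]; exact mem_ball_zero_iff.1 x.2)⟩
  left_inv x := Subtype.ext (U.symm_apply_apply _)
  right_inv x := Subtype.ext (U.apply_symm_apply _)

/-- The Moebius group of the ball: the group, under composition, generated by all `φ_a` (`a` in the
ball) and all orthogonal transformations. -/
def moebiusGroup (n : ℕ) : Subgroup (Equiv.Perm (Ball n)) :=
  Subgroup.closure (Set.range moebius ∪ Set.range orthogonal)

/-! ### `H`-harmonic functions and solid harmonics -/

/-- The hyperbolic Laplacian
`Δ_h f(x) = (1-|x|²) [(1-|x|²) Δf(x) + 2(n-2) ⟨x, ∇f(x)⟩]`;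
the term `⟨x, ∇f(x)⟩` is the derivative of `f` at `x` in the direction `x`. -/
def hypLaplacian (n : ℕ) (f : E n → ℂ) (x : E n) : ℂ :=
  ((1 - ‖x‖ ^ 2 : ℝ) : ℂ) * (((1 - ‖x‖ ^ 2 : ℝ) : ℂ) * Laplacian.laplacian f x +
    2 * ((n : ℂ) - 2) * fderiv ℝ f x x)

/-- `f` is `H`-harmonic on the open unit ball. -/
def IsHHarmonic (n : ℕ) (f : E n → ℂ) : Prop :=
  ContDiffOn ℝ 2 f (ball 0 1) ∧ ∀ x ∈ ball (0 : E n) 1, hypLaplacian n f x = 0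

/-- The harmonic polynomials on `ℝⁿ`, homogeneous of degree `m`, with complex coefficients. -/
def IsHarmonicPoly (n m : ℕ) (P : MvPolynomial (Fin n) ℂ) : Prop :=
  P.IsHomogeneous m ∧ ∑ i, MvPolynomial.pderiv i (MvPolynomial.pderiv i P) = 0

/-- The space `𝐇^m` of solid harmonics: continuous on the closed ball, `H`-harmonic inside, with
boundary values on the sphere given by a harmonic homogeneous polynomial of degree `m`. (Values
outside the closed ball are irrelevant.) -/
def IsSolidHarmonic (n m : ℕ) (f : E n → ℂ) : Prop :=
  ContinuousOn f (closedBall 0 1) ∧ IsHHarmonic n f ∧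
    ∃ P : MvPolynomial (Fin n) ℂ, IsHarmonicPoly n m P ∧
      ∀ ζ ∈ sphere (0 : E n) 1, f ζ = MvPolynomial.eval (fun i => (ζ i : ℂ)) P

/-- The normalized surface measure on the unit sphere. -/
def sphereMeasure (n : ℕ) : Measure (sphere (0 : E n) 1) :=
  ((volume : Measure (E n)).toSphere Set.univ)⁻¹ • (volume : Measure (E n)).toSphere

/-- The `L²` inner product `⟨f,g⟩` of boundary values on the unit sphere. -/
def sphereInner (n : ℕ) (f g : E n → ℂ) : ℂ :=
  ∫ ζ : sphere (0 : E n) 1, f ζ * (starRingEnd ℂ) (g ζ) ∂(sphereMeasure n)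

/-- The squared `L²` norm of boundary values on the unit sphere. -/
def sphereNormSq (n : ℕ) (f : E n → ℂ) : ℝ :=
  ∫ ζ : sphere (0 : E n) 1, ‖f ζ‖ ^ 2 ∂(sphereMeasure n)

/-! ### The coefficients of the weighted Bergman norms and their residues at `s = -n` -/

/-- `S_m(t) = (n-1)_m / (n/2)_m · ₂F₁(m, 1 - n/2; m + n/2; t)`. -/
def S (n m : ℕ) (t : ℝ) : ℝ :=
  (ascPochhammer ℝ m).eval ((n : ℝ) - 1) / (ascPochhammer ℝ m).eval ((n : ℝ) / 2) *
    ordinaryHypergeometric (m : ℝ) (1 - (n : ℝ) / 2) ((m : ℝ) + (n : ℝ) / 2) t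

/-- `I_m(s) = Γ(n/2+s+1) / (Γ(n/2) Γ(s+1)) ∫₀¹ t^(m+n/2-1) (1-t)^s S_m(t)² dt`,
used for `Re s > -1`: on `𝐇^m` the squared norm in the weighted Bergman space with (probability)
weight proportional to `(1-|x|²)^s` is `I_m(s)` times the squared norm on the sphere. -/
def bergmanCoeff (n m : ℕ) (s : ℂ) : ℂ :=
  Complex.Gamma ((n : ℂ) / 2 + s + 1) / (Complex.Gamma ((n : ℂ) / 2) * Complex.Gamma (s + 1)) *
    ∫ t in (0 : ℝ)..1, ((t ^ ((m : ℝ) + (n : ℝ) / 2 - 1) : ℝ) : ℂ) *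
      ((1 - t : ℝ) : ℂ) ^ s * ((S n m t : ℝ) : ℂ) ^ 2

/-- `J` is the analytic continuation of `I_m`, as a meromorphic function, from the half-plane
`Re s > -1` to the half-plane `Re s > -n-1`, which contains `s = -n`. -/
def IsContinuation (n m : ℕ) (J : ℂ → ℂ) : Prop :=
  MeromorphicOn J {s : ℂ | -(n : ℝ) - 1 < s.re} ∧
    ∀ s : ℂ, -1 < s.re → J s = bergmanCoeff n m s

/-- `c = lim_{s → -n} (s+n) I_m(s)`, for the analytic continuation of `I_m`. -/
def IsResidueCoeff (n m : ℕ) (c : ℝ) : Prop :=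
  ∃ J : ℂ → ℂ, IsContinuation n m J ∧
    Tendsto (fun s : ℂ => (s + n) * J s) (𝓝[≠] (-(n : ℂ))) (𝓝 (c : ℂ))

open Classical in
/-- `I_m° = lim_{s → -n} (s+n) I_m(s)`. -/
def Icirc (n m : ℕ) : ℝ :=
  if h : ∃ c : ℝ, IsResidueCoeff n m c then h.choose else 0

/-! ### The `H`-harmonic Dirichlet space -/

/-- `f = ∑ f_m` on the ball, with `f_m ∈ 𝐇^m` and `∑ I_m° ‖f_m‖² < ∞`. -/
def IsDirichletExpansion (n : ℕ) (f : Ball n → ℂ) (F : ℕ → E n → ℂ) : Prop :=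
  (∀ m, IsSolidHarmonic n m (F m)) ∧
    (∀ x : Ball n, HasSum (fun m => F m x) (f x)) ∧
    Summable (fun m => Icirc n m * sphereNormSq n (F m))

/-- The `H`-harmonic Dirichlet space `ℋ_∘`. -/
def dirichletSpace (n : ℕ) : Set (Ball n → ℂ) :=
  {f | ∃ F : ℕ → E n → ℂ, IsDirichletExpansion n f F}

open Classical in
/-- The components `f_m ∈ 𝐇^m` of `f ∈ ℋ_∘` (unique on the closed ball). -/
def component (n : ℕ) (f : Ball n → ℂ) : ℕ → E n → ℂ :=
  if h : ∃ F : ℕ → E n → ℂ, IsDirichletExpansion n f F then h.choose else 0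

/-- The semi-inner product `⟨f,g⟩_∘ = ∑ I_m° ⟨f_m,g_m⟩` of `ℋ_∘`. -/
def dirichletInner (n : ℕ) (f g : Ball n → ℂ) : ℂ :=
  ∑' m, (Icirc n m : ℂ) * sphereInner n (component n f m) (component n g m)

end HHarm

end

open MeasureTheory Filter Topology Metric

noncomputable section

namespace HHarm

/-! Write `(m)_(n-1) = m(m+1)⋯(m+n-2)`. The residues turn out to be `K (m)_(n-1)` with a constant `K
≠ 0` that does not depend on `m` (`exists_Icirc_eq`). Up to `K`, the semi-norm is therefore the norm
`∑ (m)_(n-1) ‖u_m‖²` of the boundary values `u`, where `u_m` is the component of `u` in the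
spherical harmonics of degree `m`, and invariance becomes a statement about the sphere.

Residues. In `τ = 1 - t`, the function `t^(m+n/2-1) S_m(t)²` is a polynomial plus `b_m τ^(n-1) log
τ` plus an error `O(τ^δ)` for every `δ < n`. Its integral against `τ^s` thus continues to `Re s >
-n-1`; at `s = -n` the logarithm produces a double pole and the coefficient of `τ^(n-1)` a simple
one, while `1/Γ(s+1)` has a simple zero. For odd `n` the factor `Γ(n/2+s+1)` is regular there and
the limit is a multiple of `b_m`. For even `n` the function `S_m` is a polynomial, there is no
logarithm, and the pole of `Γ(n/2+s+1)` cancels the zero, so that the coefficient of `τ^(n-1)`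
survives. In both cases contiguous relations in `m` give `x_0 = 0` and `m x_(m+1) = (m+n-1) x_m`,
whose solutions are the multiples of `(m)_(n-1)`.

Invariance. The dual norm is accessible: for `μ` of mean zero, `∑ ‖μ_m‖² / (m)_(n-1)` is the
logarithmic energy of `μ` divided by `(n-2)!` (`hasSum_logEnergy`). A Moebius map acts on the sphere
with `|φζ - φη|² = j(ζ) j(η) |ζ - η|²` and Jacobian `j^(n-1)`. When a density is transported, the
energy changes only by integrals containing `log j` of a single variable, and these vanish because
the mean is zero (`BoundaryMap.logEnergy_density`). Composition with `φ` is adjoint to this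
transport, so it preserves the dual norm, which is the Dirichlet norm (`BoundaryMap.tsum_pullback`).

Functions on the ball and boundary values are linked by the hyperbolic Poisson kernel
`((1-|x|²)/|x-ζ|²)^(n-1)`, which transforms with the same Jacobian; its integral determines the
boundary values in `L²` (`eq_zero_of_inner_hypKernel`). The inner product follows from the norm by
polarization. -/

/-! ### Logarithmic expansions at the origin -/

/-- `f(τ) = p(τ) + β τ^N log τ + O(τ^δ)` on `(0,1)`, for every `δ < N + 1`. -/
def LogExpansion (N : ℕ) (f : ℝ → ℝ) (p : Polynomial ℝ) (β : ℝ) : Prop :=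
  ∀ δ : ℝ, δ < N + 1 → ∃ C : ℝ, ∀ τ ∈ Set.Ioo (0 : ℝ) 1,
    |f τ - p.eval τ - β * (τ ^ N * Real.log τ)| ≤ C * τ ^ δ

theorem abs_polynomial_eval_le (p : Polynomial ℝ) :
    ∃ C : ℝ, 0 ≤ C ∧ ∀ τ ∈ Set.Ioo (0 : ℝ) 1, |p.eval τ| ≤ C := by
  obtain ⟨C, hC⟩ := (isCompact_Icc (a := (0 : ℝ)) (b := 1)).exists_bound_of_continuousOn
    p.continuous.continuousOn
  exact ⟨C, (norm_nonneg _).trans (hC 0 (by simp)), fun τ hτ => hC τ ⟨hτ.1.le, hτ.2.le⟩⟩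

theorem exists_abs_polynomial_eval_sub_le (p : Polynomial ℝ) :
    ∃ C : ℝ, 0 ≤ C ∧ ∀ τ ∈ Set.Ioo (0 : ℝ) 1, |p.eval τ - p.eval 0| ≤ C * τ := by
  obtain ⟨C, hC0, hC⟩ := abs_polynomial_eval_le p.divX
  refine ⟨C, hC0, fun τ hτ => ?_⟩
  have h : p.eval τ - p.eval 0 = p.divX.eval τ * τ := by
    conv_lhs => rw [← Polynomial.divX_mul_X_add p]
    simp
  rw [h, abs_mul, abs_of_pos hτ.1]
  exact mul_le_mul_of_nonneg_right (hC τ hτ) hτ.1.le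

/-- `τ^a |log τ| = O(τ^δ)` for `δ < a`. -/
theorem exists_pow_mul_log_le (N : ℕ) {δ : ℝ} (hδ : δ < N) :
    ∃ C : ℝ, 0 ≤ C ∧ ∀ τ ∈ Set.Ioo (0 : ℝ) 1, |τ ^ N * Real.log τ| ≤ C * τ ^ δ := by
  refine ⟨1 / (N - δ), by positivity [sub_pos.2 hδ], fun τ hτ => ?_⟩
  have h := Real.abs_log_mul_self_rpow_lt τ (N - δ) hτ.1 hτ.2.le (sub_pos.2 hδ)
  have e : τ ^ N = τ ^ (N - δ) * τ ^ δ := by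
    rw [← Real.rpow_add hτ.1, sub_add_cancel, Real.rpow_natCast]
  rw [e, mul_right_comm, abs_mul, abs_of_pos (Real.rpow_pos_of_pos hτ.1 δ), mul_comm (τ ^ _ : ℝ)]
  exact mul_le_mul_of_nonneg_right h.le (Real.rpow_pos_of_pos hτ.1 δ).le

theorem rpow_le_rpow_of_mem_Ioo {τ a b : ℝ} (hτ : τ ∈ Set.Ioo (0 : ℝ) 1) (h : a ≤ b) :
    τ ^ b ≤ τ ^ a :=
  Real.rpow_le_rpow_of_exponent_ge hτ.1 hτ.2.le h

theorem LogExpansion.of_polynomial (N : ℕ) (p : Polynomial ℝ) :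
    LogExpansion N (fun τ => p.eval τ) p 0 :=
  fun δ _ => ⟨0, fun τ _ => by simp⟩

/-- A logarithm costs less than half a power, so `f - p` itself is `O(τ^(N-1/2))`. This crude bound
controls the product of two remainders. -/
theorem LogExpansion.exists_bound {N : ℕ} {f : ℝ → ℝ} {p : Polynomial ℝ} {β : ℝ}
    (hf : LogExpansion N f p β) :
    ∃ C : ℝ, 0 ≤ C ∧ ∀ τ ∈ Set.Ioo (0 : ℝ) 1, |f τ - p.eval τ| ≤ C * τ ^ ((N : ℝ) - 1 / 2) ∧
      |f τ - p.eval τ - β * (τ ^ N * Real.log τ)| ≤ C * τ ^ ((N : ℝ) - 1 / 2) := by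
  obtain ⟨C, hC⟩ := hf (N - 1 / 2) (by linarith)
  obtain ⟨D, hD0, hD⟩ := exists_pow_mul_log_le N (δ := N - 1 / 2) (by linarith)
  have key : ∀ τ ∈ Set.Ioo (0 : ℝ) 1, |β * (τ ^ N * Real.log τ)| ≤
      |β| * D * τ ^ ((N : ℝ) - 1 / 2) := fun τ hτ => by
    rw [abs_mul, mul_assoc]
    exact mul_le_mul_of_nonneg_left (hD τ hτ) (abs_nonneg _)
  refine ⟨|C| + |β| * D, by positivity, fun τ hτ => ?_⟩
  have hp := (Real.rpow_pos_of_pos hτ.1 ((N : ℝ) - 1 / 2)).le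
  have h1 := hC τ hτ
  have h2 := key τ hτ
  have h3 : C * τ ^ ((N : ℝ) - 1 / 2) ≤ |C| * τ ^ ((N : ℝ) - 1 / 2) :=
    mul_le_mul_of_nonneg_right (le_abs_self C) hp
  have h4 : 0 ≤ |β| * D * τ ^ ((N : ℝ) - 1 / 2) := by positivity
  rw [add_mul]
  refine ⟨?_, by linarith⟩
  calc |f τ - p.eval τ| = |(f τ - p.eval τ - β * (τ ^ N * Real.log τ)) +
        β * (τ ^ N * Real.log τ)| := by ring_nf
    _ ≤ _ := (abs_add_le _ _).trans (by linarith)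

/-- Only the constant terms of `p` and `q` meet the logarithms, since `τ^(N+1) log τ` already counts
as an error. The product of the two remainders is `O(τ^(2N-1))`, which is an error exactly because
`2N - 1 ≥ N + 1`; hence `2 ≤ N`. -/
theorem LogExpansion.mul {N : ℕ} (hN : 2 ≤ N) {f g : ℝ → ℝ} {p q : Polynomial ℝ} {β γ : ℝ}
    (hf : LogExpansion N f p β) (hg : LogExpansion N g q γ) :
    LogExpansion N (fun τ => f τ * g τ) (p * q) (β * q.eval 0 + p.eval 0 * γ) := by
  intro δ hδ
  obtain ⟨C, hC⟩ := hf δ hδ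
  obtain ⟨D, hD⟩ := hg δ hδ
  obtain ⟨C1, hC10, hC1⟩ := hf.exists_bound
  obtain ⟨D1, hD10, hD1⟩ := hg.exists_bound
  obtain ⟨P, hP0, hP⟩ := abs_polynomial_eval_le p
  obtain ⟨Q, hQ0, hQ⟩ := abs_polynomial_eval_le q
  obtain ⟨P1, hP10, hP1⟩ := exists_abs_polynomial_eval_sub_le p
  obtain ⟨Q1, hQ10, hQ1⟩ := exists_abs_polynomial_eval_sub_le q
  obtain ⟨A, hA0, hA⟩ := exists_pow_mul_log_le (N + 1) (δ := δ) (by push_cast; exact hδ)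
  refine ⟨|C| * Q + P * |D| + |β| * Q1 * A + |γ| * P1 * A + C1 * D1, fun τ hτ => ?_⟩
  have hτδ := (Real.rpow_pos_of_pos hτ.1 δ).le
  set L := τ ^ N * Real.log τ with hL
  have hLτ : |L * τ| ≤ A * τ ^ δ := by
    have := hA τ hτ
    rwa [pow_succ, mul_right_comm] at this
  have e : f τ * g τ - (p * q).eval τ - (β * q.eval 0 + p.eval 0 * γ) * L =
      (f τ - p.eval τ - β * L) * q.eval τ + p.eval τ * (g τ - q.eval τ - γ * L) +
      β * ((q.eval τ - q.eval 0) * L) + γ * ((p.eval τ - p.eval 0) * L) +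
      (f τ - p.eval τ) * (g τ - q.eval τ) := by
    rw [Polynomial.eval_mul]; ring
  rw [e]
  have b1 : |(f τ - p.eval τ - β * L) * q.eval τ| ≤ |C| * Q * τ ^ δ := by
    rw [abs_mul, mul_right_comm]
    exact mul_le_mul ((hC τ hτ).trans (mul_le_mul_of_nonneg_right (le_abs_self C) hτδ))
      (hQ τ hτ) (abs_nonneg _) (by positivity)
  have b2 : |p.eval τ * (g τ - q.eval τ - γ * L)| ≤ P * |D| * τ ^ δ := by
    rw [abs_mul, mul_assoc]
    exact mul_le_mul (hP τ hτ) ((hD τ hτ).trans (mul_le_mul_of_nonneg_right (le_abs_self D) hτδ))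
      (abs_nonneg _) hP0
  have b3 : ∀ (r : Polynomial ℝ) (c R : ℝ), 0 ≤ R → |r.eval τ - r.eval 0| ≤ R * τ →
      |c * ((r.eval τ - r.eval 0) * L)| ≤ |c| * R * A * τ ^ δ := by
    intro r c R hR0 hR
    rw [abs_mul, mul_assoc, mul_assoc, abs_mul]
    refine mul_le_mul_of_nonneg_left ?_ (abs_nonneg c)
    calc |r.eval τ - r.eval 0| * |L| ≤ R * τ * |L| :=
          mul_le_mul_of_nonneg_right hR (abs_nonneg _)
      _ = R * |L * τ| := by rw [abs_mul L, abs_of_pos hτ.1]; ring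
      _ ≤ R * (A * τ ^ δ) := mul_le_mul_of_nonneg_left hLτ hR0
  have b4 : |(f τ - p.eval τ) * (g τ - q.eval τ)| ≤ C1 * D1 * τ ^ δ := by
    have hN' : (2 : ℝ) ≤ N := by exact_mod_cast hN
    have h0 := (Real.rpow_pos_of_pos hτ.1 ((N : ℝ) - 1 / 2)).le
    rw [abs_mul]
    calc _ ≤ (C1 * τ ^ ((N : ℝ) - 1 / 2)) * (D1 * τ ^ ((N : ℝ) - 1 / 2)) :=
          mul_le_mul (hC1 τ hτ).1 (hD1 τ hτ).1 (abs_nonneg _) (by positivity)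
      _ = C1 * D1 * τ ^ ((N : ℝ) - 1 / 2 + ((N : ℝ) - 1 / 2)) := by
          rw [Real.rpow_add hτ.1]; ring
      _ ≤ C1 * D1 * τ ^ δ := mul_le_mul_of_nonneg_left
          (rpow_le_rpow_of_mem_Ioo hτ (by linarith)) (by positivity)
  have b3q := b3 q β Q1 hQ10 (hQ1 τ hτ)
  have b3p := b3 p γ P1 hP10 (hP1 τ hτ)
  have t1 := abs_add_le ((f τ - p.eval τ - β * L) * q.eval τ + p.eval τ * (g τ - q.eval τ - γ * L) +
      β * ((q.eval τ - q.eval 0) * L) + γ * ((p.eval τ - p.eval 0) * L))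
      ((f τ - p.eval τ) * (g τ - q.eval τ))
  have t2 := abs_add_le ((f τ - p.eval τ - β * L) * q.eval τ + p.eval τ * (g τ - q.eval τ - γ * L) +
      β * ((q.eval τ - q.eval 0) * L)) (γ * ((p.eval τ - p.eval 0) * L))
  have t3 := abs_add_le ((f τ - p.eval τ - β * L) * q.eval τ + p.eval τ * (g τ - q.eval τ - γ * L))
      (β * ((q.eval τ - q.eval 0) * L))
  have t4 := abs_add_le ((f τ - p.eval τ - β * L) * q.eval τ) (p.eval τ * (g τ - q.eval τ - γ * L))
  simp only [add_mul]
  linarith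

/-! ### Power series with an expansion at `t = 1` -/

/-- Remainder of the binomial expansion of `(1-τ)^k`. -/
def binomRemainder (N k : ℕ) (τ : ℝ) : ℝ :=
  (1 - τ) ^ k - ∑ j ∈ Finset.range N, (k.choose j : ℝ) * (-τ) ^ j

/-- The relation `(1-τ)^(i+1) - (1-τ)^i = -τ (1-τ)^i`, summed over `i < k` and combined with the
hockey-stick identity for binomial coefficients. Each use gains a factor `kτ` in the next bound. -/
theorem binomRemainder_succ (N k : ℕ) (τ : ℝ) :
    binomRemainder (N + 1) k τ = -τ * ∑ i ∈ Finset.range k, binomRemainder N i τ := by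
  induction k with
  | zero =>
    simp [binomRemainder, Finset.sum_range_succ']
  | succ k ih =>
    rw [Finset.sum_range_succ, mul_add, ← ih]
    simp only [binomRemainder]
    rw [Finset.sum_range_succ', Finset.sum_range_succ' (fun j => ((k.choose j : ℕ) : ℝ) * (-τ) ^ j)]
    simp only [Nat.choose_succ_succ, Nat.cast_add, add_mul, Finset.sum_add_distrib, mul_sub,
      Finset.mul_sum, pow_succ, Nat.choose_zero_right, pow_zero]
    have : ∀ j, -τ * ((k.choose j : ℝ) * (-τ) ^ j) = (k.choose j : ℝ) * ((-τ) ^ j * (-τ)) :=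
      fun j => by ring
    simp only [this]
    ring

theorem abs_binomRemainder_le (N k : ℕ) {τ : ℝ} (hτ : τ ∈ Set.Ioo (0 : ℝ) 1) :
    |binomRemainder N k τ| ≤ (k * τ) ^ N := by
  induction N generalizing k with
  | zero =>
    have : |1 - τ| ≤ 1 := by rw [abs_le]; constructor <;> linarith [hτ.1, hτ.2]
    simpa [binomRemainder] using pow_le_one₀ (abs_nonneg _) this
  | succ N ih =>
    rw [binomRemainder_succ, abs_mul, abs_neg, abs_of_pos hτ.1, pow_succ']
    have : |∑ i ∈ Finset.range k, binomRemainder N i τ| ≤ k * (k * τ) ^ N := by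
      refine (Finset.abs_sum_le_sum_abs _ _).trans ?_
      refine (Finset.sum_le_card_nsmul _ _ ((k * τ) ^ N) fun i hi => (ih i).trans ?_).trans
        (by simp)
      have hi' : (i : ℝ) ≤ k := by exact_mod_cast (Finset.mem_range.1 hi).le
      exact pow_le_pow_left₀ (mul_nonneg (Nat.cast_nonneg _) hτ.1.le)
        (mul_le_mul_of_nonneg_right hi' hτ.1.le) _
    calc τ * _ ≤ τ * (k * (k * τ) ^ N) := mul_le_mul_of_nonneg_left this hτ.1.le
      _ = _ := by ring

/-- Interpolation between the remainders of orders `N` and `N+1`: the second is better for `kτ ≤ 1`,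
the first for `kτ ≥ 1`. A fractional exponent is needed because `∑ k^(N+1) |d_k|` may just fail to
converge when `d_k = O(k^(-N-2))`. -/
theorem abs_binomRemainder_le_rpow (N k : ℕ) {τ δ : ℝ} (hτ : τ ∈ Set.Ioo (0 : ℝ) 1)
    (h1 : N ≤ δ) (h2 : δ ≤ N + 1) (hδ : 0 < δ) :
    |binomRemainder (N + 1) k τ| ≤ 2 * (k * τ) ^ δ := by
  have hx : 0 ≤ (k : ℝ) * τ := mul_nonneg (Nat.cast_nonneg _) hτ.1.le
  rcases le_total ((k : ℝ) * τ) 1 with h | h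
  · have hb := abs_binomRemainder_le (N + 1) k hτ
    rcases hx.eq_or_lt with h0 | h0
    · rw [← h0] at hb ⊢
      rw [Real.zero_rpow hδ.ne']
      simpa using hb
    · have : ((k : ℝ) * τ) ^ (N + 1) ≤ (k * τ) ^ δ := by
        rw [← Real.rpow_natCast]
        exact Real.rpow_le_rpow_of_exponent_ge h0 h (by push_cast; exact h2)
      have := Real.rpow_nonneg hx δ
      linarith
  · have hb := abs_binomRemainder_le N k hτ
    have e : binomRemainder (N + 1) k τ = binomRemainder N k τ - (k.choose N : ℝ) * (-τ) ^ N := by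
      simp only [binomRemainder, Finset.sum_range_succ]; ring
    have hc : |(k.choose N : ℝ) * (-τ) ^ N| ≤ (k * τ) ^ N := by
      rw [abs_mul, abs_pow, abs_neg, abs_of_pos hτ.1, Nat.abs_cast, mul_pow]
      refine mul_le_mul_of_nonneg_right ?_ (pow_nonneg hτ.1.le _)
      exact_mod_cast Nat.choose_le_pow k N
    have : ((k : ℝ) * τ) ^ N ≤ (k * τ) ^ δ := by
      rw [← Real.rpow_natCast]
      exact Real.rpow_le_rpow_of_exponent_le h h1
    rw [e]
    have := abs_sub (binomRemainder N k τ) ((k.choose N : ℝ) * (-τ) ^ N)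
    linarith

/-- Each `(1-τ)^k` is expanded up to order `N`. The decay of `d` makes `∑ d_k C(k,j)` converge for
`j ≤ N` and `∑ |d_k| (k+1)^δ` converge for `δ < N+1`, so no logarithm appears at order `N`. -/
theorem logExpansion_tsum {N : ℕ} (hN : 1 ≤ N) {d : ℕ → ℝ} {C : ℝ}
    (hd : ∀ k, |d k| ≤ C / ((k : ℝ) + 1) ^ (N + 2)) :
    ∃ p : Polynomial ℝ, LogExpansion N (fun τ => ∑' k, d k * (1 - τ) ^ k) p 0 := by
  have hN' : (1 : ℝ) ≤ N := by exact_mod_cast hN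
  have hC : 0 ≤ C := by simpa using (abs_nonneg _).trans (hd 0)
  have hsum : ∀ δ : ℝ, 0 ≤ δ → δ < N + 1 → Summable fun k : ℕ => |d k| * ((k : ℝ) + 1) ^ δ := by
    intro δ hδ0 hδ
    have hs : Summable fun k : ℕ => C * (((k + 1 : ℕ) : ℝ) ^ ((N : ℝ) + 2 - δ))⁻¹ :=
      ((summable_nat_add_iff 1).2 (Real.summable_nat_rpow_inv.2 (by linarith))).mul_left C
    refine hs.of_nonneg_of_le (fun k => mul_nonneg (abs_nonneg _) (by positivity)) fun k => ?_
    have hk : (0 : ℝ) < (k : ℝ) + 1 := by positivity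
    calc |d k| * ((k : ℝ) + 1) ^ δ ≤ C / ((k : ℝ) + 1) ^ (N + 2) * ((k : ℝ) + 1) ^ δ :=
          mul_le_mul_of_nonneg_right (hd k) (by positivity)
      _ = _ := by
          push_cast
          rw [← Real.rpow_neg hk.le, show -((N : ℝ) + 2 - δ) = δ - (N + 2 : ℕ) by push_cast; ring,
            Real.rpow_sub hk, Real.rpow_natCast]
          ring
  have hchoose : ∀ j ≤ N, Summable fun k : ℕ => d k * (k.choose j : ℝ) := by
    intro j hj
    refine Summable.of_norm_bounded (hsum j (by positivity)
      (by have : (j : ℝ) ≤ N := by exact_mod_cast hj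
          linarith)) fun k => ?_
    rw [norm_mul, Real.norm_eq_abs, Real.norm_eq_abs, Nat.abs_cast, Real.rpow_natCast]
    refine mul_le_mul_of_nonneg_left ?_ (abs_nonneg _)
    calc ((k.choose j : ℕ) : ℝ) ≤ (k : ℝ) ^ j := by exact_mod_cast Nat.choose_le_pow k j
      _ ≤ _ := pow_le_pow_left₀ (by positivity) (by linarith) _
  refine ⟨∑ j ∈ Finset.range (N + 1), Polynomial.C (∑' k, d k * (k.choose j : ℝ)) *
    (-Polynomial.X) ^ j, ?_⟩
  intro δ' hδ'
  -- A larger exponent gives a stronger bound on `(0,1)`, so it may be assumed to lie in `[N, N+1)`,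
  -- where the interpolated estimate is available.
  obtain ⟨δ, hδ1, hδ2, hδ3⟩ : ∃ δ : ℝ, N ≤ δ ∧ δ < N + 1 ∧ δ' ≤ δ :=
    ⟨max N δ', le_max_left _ _, max_lt (by linarith) hδ', le_max_right _ _⟩
  have hδ0 : 0 < δ := by linarith
  refine ⟨∑' k, 2 * (|d k| * ((k : ℝ) + 1) ^ δ), fun τ hτ => ?_⟩
  have hsd : Summable fun k => d k * (1 - τ) ^ k := by
    refine Summable.of_norm_bounded (hsum 0 le_rfl (by linarith)) fun k => ?_
    rw [norm_mul, Real.norm_eq_abs, Real.rpow_zero]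
    refine mul_le_mul_of_nonneg_left ?_ (abs_nonneg _)
    rw [norm_pow]
    refine pow_le_one₀ (norm_nonneg _) ?_
    rw [Real.norm_eq_abs, abs_le]; constructor <;> linarith [hτ.1, hτ.2]
  have e : ∑' k, d k * (1 - τ) ^ k - Polynomial.eval τ (∑ j ∈ Finset.range (N + 1),
      Polynomial.C (∑' k, d k * (k.choose j : ℝ)) * (-Polynomial.X) ^ j) =
      ∑' k, d k * binomRemainder (N + 1) k τ := by
    simp only [binomRemainder, mul_sub, Finset.mul_sum, ← mul_assoc]
    have hs2 : ∀ j ∈ Finset.range (N + 1), Summable fun k => d k * (k.choose j : ℝ) * (-τ) ^ j :=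
      fun j hj => (hchoose j (by have := Finset.mem_range.1 hj; omega)).mul_right _
    rw [hsd.tsum_sub (summable_sum hs2), Summable.tsum_finsetSum hs2]
    simp only [tsum_mul_right, Polynomial.eval_finsetSum, Polynomial.eval_mul, Polynomial.eval_C,
      Polynomial.eval_pow, Polynomial.eval_neg, Polynomial.eval_X]
  rw [zero_mul, sub_zero, e, ← tsum_mul_right]
  have hmaj : ∀ k, ‖d k * binomRemainder (N + 1) k τ‖ ≤ 2 * (|d k| * ((k : ℝ) + 1) ^ δ) * τ ^ δ' := by
    intro k
    rw [norm_mul, Real.norm_eq_abs, Real.norm_eq_abs]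
    calc |d k| * |binomRemainder (N + 1) k τ| ≤ |d k| * (2 * (k * τ) ^ δ) :=
          mul_le_mul_of_nonneg_left (abs_binomRemainder_le_rpow N k hτ hδ1 hδ2.le hδ0)
            (abs_nonneg _)
      _ ≤ |d k| * (2 * (((k : ℝ) + 1) ^ δ * τ ^ δ')) := by
          refine mul_le_mul_of_nonneg_left (mul_le_mul_of_nonneg_left ?_ two_pos.le) (abs_nonneg _)
          rw [Real.mul_rpow (Nat.cast_nonneg _) hτ.1.le]
          exact mul_le_mul (Real.rpow_le_rpow (Nat.cast_nonneg _) (by linarith) hδ0.le)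
            (rpow_le_rpow_of_mem_Ioo hτ hδ3) (Real.rpow_nonneg hτ.1.le _) (by positivity)
      _ = _ := by ring
  have hs3 := (((hsum δ hδ0.le hδ2).mul_left 2).mul_right (τ ^ δ'))
  rw [← Real.norm_eq_abs]
  exact tsum_of_norm_bounded hs3.hasSum hmaj

/-- `∑ t^(k+N+1) / ((k+1)⋯(k+N+1))` at `t = 1 - τ`. -/
theorem exists_hasSum_inv_ascFactorial (N : ℕ) : ∃ p : Polynomial ℝ, ∃ γ : ℝ, γ ≠ 0 ∧
    ∀ τ ∈ Set.Ioo (0 : ℝ) 1, HasSum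
      (fun k : ℕ => (1 - τ) ^ (k + N + 1) * ((((k + 1).ascFactorial (N + 1) : ℕ) : ℝ))⁻¹)
      (p.eval τ + γ * (τ ^ N * Real.log τ)) := by
  induction N with
  | zero =>
    refine ⟨0, -1, by norm_num, fun τ hτ => ?_⟩
    have := Real.hasSum_pow_div_log_of_abs_lt_one (x := 1 - τ)
      (by rw [abs_lt]; constructor <;> linarith [hτ.1, hτ.2])
    simpa [div_eq_mul_inv, Nat.ascFactorial] using this
  | succ N ih =>
    obtain ⟨p, γ, hγ, h⟩ := ih
    refine ⟨Polynomial.C ((N : ℝ) + 1)⁻¹ * (Polynomial.C ((N + 1).factorial : ℝ)⁻¹ *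
      (1 - Polynomial.X) ^ (N + 1) - Polynomial.X * p), -γ / (N + 1),
      div_ne_zero (neg_ne_zero.2 hγ) (by positivity), fun τ hτ => ?_⟩
    have hs := h τ hτ
    -- With `a_k = 1/((k+1)⋯(k+N+1))`, partial fractions give `a_k - a_(k+1) =
    -- (N+1)/((k+1)⋯(k+N+2))`. To match the powers of `1-τ`, the first series is multiplied by `1-τ`
    -- and the second is shifted; the logarithms then combine to `γ((1-τ) - 1) = -γτ`, which raises
    -- the power of `τ` by one.
    have h1 := hs.mul_left (1 - τ)
    have h2 := (hasSum_nat_add_iff' 1).2 hs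
    have h3 := (h1.sub h2).mul_left ((N : ℝ) + 1)⁻¹
    have e2 : Polynomial.eval τ (Polynomial.C ((N : ℝ) + 1)⁻¹ *
        (Polynomial.C ((N + 1).factorial : ℝ)⁻¹ * (1 - Polynomial.X) ^ (N + 1) -
          Polynomial.X * p)) + -γ / (N + 1) * (τ ^ (N + 1) * Real.log τ) = ((N : ℝ) + 1)⁻¹ *
        ((1 - τ) * (p.eval τ + γ * (τ ^ N * Real.log τ)) - (p.eval τ + γ * (τ ^ N * Real.log τ) -
          ∑ i ∈ Finset.range 1, (1 - τ) ^ (i + N + 1) *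
            (((i + 1).ascFactorial (N + 1) : ℕ) : ℝ)⁻¹)) := by
      have hf : ((0 + 1).ascFactorial (N + 1) : ℕ) = (N + 1).factorial := by
        rw [zero_add, Nat.one_ascFactorial]
      rw [Finset.sum_range_one, hf]
      simp only [Polynomial.eval_mul, Polynomial.eval_sub, Polynomial.eval_C, Polynomial.eval_pow,
        Polynomial.eval_X, Polynomial.eval_one, zero_add]
      ring
    rw [e2]
    refine (congrArg (fun F => HasSum F _) (funext fun k => ?_)).mpr h3
    have a1 : (((k + 1).ascFactorial (N + 1 + 1) : ℕ) : ℝ) =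
        ((k + 1).ascFactorial (N + 1) : ℕ) * ((k : ℝ) + N + 2) := by
      rw [Nat.ascFactorial_succ (n := k + 1) (k := N + 1)]; push_cast; ring
    have a2 : ((k : ℝ) + 1) * ((k + 1 + 1).ascFactorial (N + 1) : ℕ) =
        ((k + 1).ascFactorial (N + 1) : ℕ) * ((k : ℝ) + N + 2) := by
      have := Nat.succ_ascFactorial (k + 1) (N + 1)
      have h' : (((k + 1 : ℕ) : ℝ)) * ((k + 1 + 1).ascFactorial (N + 1) : ℕ) =
        ((k + 1 + (N + 1) : ℕ) : ℝ) * ((k + 1).ascFactorial (N + 1) : ℕ) := by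
        exact_mod_cast this
      push_cast at h'
      linarith
    have p0 : (((k + 1).ascFactorial (N + 1) : ℕ) : ℝ) ≠ 0 := by
      exact_mod_cast (Nat.ascFactorial_pos _ _).ne'
    have p1 : (((k + 1 + 1).ascFactorial (N + 1) : ℕ) : ℝ) ≠ 0 := by
      exact_mod_cast (Nat.ascFactorial_pos _ _).ne'
    have p2 : ((k : ℝ) + N + 2) ≠ 0 := by positivity
    have p3 : ((k : ℝ) + 1) ≠ 0 := by positivity
    have p4 : ((N : ℝ) + 1) ≠ 0 := by positivity
    rw [a1]
    have a3 : (((k + 1 + 1).ascFactorial (N + 1) : ℕ) : ℝ)⁻¹ =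
        ((k : ℝ) + 1) / (((k + 1).ascFactorial (N + 1) : ℕ) * ((k : ℝ) + N + 2)) := by
      rw [← a2]; field_simp
    rw [a3]
    rw [show k + (N + 1) + 1 = (k + N + 1) + 1 by ring,
      show k + 1 + N + 1 = (k + N + 1) + 1 by ring, pow_succ]
    field_simp
    ring

/-! ### The coefficients of `S_m` -/

theorem ascPochhammer_eval_add_one_mul (k : ℕ) (x : ℝ) :
    (ascPochhammer ℝ k).eval (x + 1) * x = (ascPochhammer ℝ k).eval x * (x + k) := by
  induction k with
  | zero => simp
  | succ k ih =>
    rw [ascPochhammer_succ_eval, ascPochhammer_succ_eval, mul_right_comm, ih]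
    push_cast
    ring

theorem ascPochhammer_eval_ne_zero (k : ℕ) {x : ℝ} (hx : 0 < x) :
    (ascPochhammer ℝ k).eval x ≠ 0 :=
  (ascPochhammer_pos k x hx).ne'

/-- A sequence with `x₀ = 0` and `m x_{m+1} = (m+N) x_m` is proportional to `(m)_N`. -/
theorem eq_mul_ascPochhammer_of_recurrence {N : ℕ} (hN : 0 < N) {x : ℕ → ℝ} (h0 : x 0 = 0)
    (h : ∀ m : ℕ, (m : ℝ) * x (m + 1) = (m + N) * x m) (m : ℕ) :
    x m = x 1 / N.factorial * (ascPochhammer ℝ N).eval (m : ℝ) := by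
  -- At `m = 0` the recurrence says nothing about `x 1`, so the induction has to start at `m = 1`;
  -- at `m = 0` both sides vanish because `(0)_N = 0` for `N > 0`.
  rcases Nat.eq_zero_or_pos m with rfl | hm
  · simp [h0, hN.ne']
  induction m, hm using Nat.le_induction with
  | base =>
    have : (N.factorial : ℝ) ≠ 0 := by positivity
    rw [Nat.cast_one, ascPochhammer_eval_one]
    field_simp
  | succ m hm ih =>
    have hm' : (m : ℝ) ≠ 0 := by positivity
    have h1 := ascPochhammer_eval_add_one_mul N (m : ℝ)
    apply mul_left_cancel₀ hm'
    rw [h m, ih]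
    push_cast
    linear_combination (-x 1 / N.factorial) * h1

/-- The Taylor coefficients of `S_m`. -/
def sCoeff (n m k : ℕ) : ℝ :=
  (ascPochhammer ℝ m).eval ((n : ℝ) - 1) / (ascPochhammer ℝ m).eval ((n : ℝ) / 2) *
    ((k.factorial : ℝ)⁻¹ * (ascPochhammer ℝ k).eval (m : ℝ) *
      (ascPochhammer ℝ k).eval (1 - (n : ℝ) / 2) *
        ((ascPochhammer ℝ k).eval ((m : ℝ) + (n : ℝ) / 2))⁻¹)

theorem S_eq_tsum (n m : ℕ) (t : ℝ) : S n m t = ∑' k, sCoeff n m k * t ^ k := by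
  simp only [S, ordinaryHypergeometric_eq_tsum, sCoeff, smul_eq_mul, mul_assoc, tsum_mul_left]

theorem sCoeff_succ {n : ℕ} (hn : 2 < n) (m k : ℕ) :
    sCoeff n m (k + 1) * ((m + (n : ℝ) / 2 + k) * (k + 1)) =
      sCoeff n m k * ((m + k) * (1 - (n : ℝ) / 2 + k)) := by
  have hn' : (2 : ℝ) < n := by exact_mod_cast hn
  have h1 : (m : ℝ) + (n : ℝ) / 2 + k ≠ 0 := by positivity
  have h2 := ascPochhammer_eval_ne_zero k (x := (m : ℝ) + (n : ℝ) / 2) (by positivity)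
  have h3 := ascPochhammer_eval_ne_zero m (x := (n : ℝ) / 2) (by positivity)
  have h4 : (k.factorial : ℝ) ≠ 0 := by positivity
  simp only [sCoeff, ascPochhammer_succ_eval, Nat.factorial_succ, Nat.cast_mul]
  push_cast
  field_simp

/-- The contiguous relation in `m`, with denominators cleared. Together with the ratio `sCoeff_succ`
in `k` it yields the value `S_m(1)`, the recurrence of the logarithmic coefficients and the raising
and lowering relations. The factor `m` on the left is unavoidable: `S_0 = 1` gives no information on
`S_1`. -/
theorem sCoeff_succ_left {n : ℕ} (hn : 2 < n) (m k : ℕ) :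
    sCoeff n (m + 1) k * (m * (m + (n : ℝ) / 2 + k)) =
      sCoeff n m k * ((m + n - 1) * (m + k)) := by
  have hn' : (2 : ℝ) < n := by exact_mod_cast hn
  have h1 : (m : ℝ) + (n : ℝ) / 2 + k ≠ 0 := by positivity
  have h1' : (m : ℝ) + (n : ℝ) / 2 ≠ 0 := by positivity
  have h2 := ascPochhammer_eval_ne_zero k (x := (m : ℝ) + (n : ℝ) / 2) (by positivity)
  have h2' := ascPochhammer_eval_ne_zero k (x := (m : ℝ) + (n : ℝ) / 2 + 1) (by positivity)
  have h3 := ascPochhammer_eval_ne_zero m (x := (n : ℝ) / 2) (by positivity)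
  have h4 : (k.factorial : ℝ) ≠ 0 := by positivity
  have e1 := ascPochhammer_eval_add_one_mul k (m : ℝ)
  have e2 := ascPochhammer_eval_add_one_mul k ((m : ℝ) + (n : ℝ) / 2)
  simp only [sCoeff, ascPochhammer_succ_eval]
  push_cast
  rw [show (m : ℝ) + 1 + (n : ℝ) / 2 = m + (n : ℝ) / 2 + 1 by ring]
  have e3 : ((ascPochhammer ℝ k).eval ((m : ℝ) + (n : ℝ) / 2 + 1))⁻¹ * (m + (n : ℝ) / 2 + k) =
      ((ascPochhammer ℝ k).eval ((m : ℝ) + (n : ℝ) / 2))⁻¹ * (m + (n : ℝ) / 2) := by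
    rw [inv_mul_eq_div, inv_mul_eq_div, div_eq_div_iff h2' h2]
    linear_combination -e2
  have e4 : (n : ℝ) / 2 + m ≠ 0 := by positivity
  calc _ = (ascPochhammer ℝ m).eval ((n : ℝ) - 1) * ((n : ℝ) - 1 + m) /
        ((ascPochhammer ℝ m).eval ((n : ℝ) / 2) * ((n : ℝ) / 2 + m)) * (k.factorial : ℝ)⁻¹ *
        ((ascPochhammer ℝ k).eval ((m : ℝ) + 1) * m) * (ascPochhammer ℝ k).eval (1 - (n : ℝ) / 2) *
        (((ascPochhammer ℝ k).eval ((m : ℝ) + (n : ℝ) / 2 + 1))⁻¹ * (m + (n : ℝ) / 2 + k)) := by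
        ring
    _ = _ := by
        rw [e1, e3]
        field_simp
        ring

theorem sCoeff_zero_left (n : ℕ) {k : ℕ} (hk : k ≠ 0) : sCoeff n 0 k = 0 := by
  simp [sCoeff, hk]

theorem sCoeff_zero_zero (n : ℕ) : sCoeff n 0 0 = 1 := by
  simp [sCoeff]

/-! ### Asymptotics of the coefficients -/

theorem tendsto_const_div_natCast_add_one (C : ℝ) :
    Tendsto (fun k : ℕ => C / ((k : ℝ) + 1)) atTop (𝓝 0) :=
  ((tendsto_const_div_atTop_nhds_zero_nat C).comp (tendsto_add_atTop_nat 1)).congr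
    fun k => by simp

/-- The infinite product `∏ (1 + a_k)` converges because `a` is dominated by a telescoping series,
and the tail of that series gives the rate `1/(k+1)`. Since `a_k ≥ 0`, the sequence `|q_k|`
increases, so the limit vanishes only if `q_0` does. -/
theorem exists_limit_of_ratio {q a : ℕ → ℝ} {A : ℝ} (hq : ∀ k, q (k + 1) = q k * (1 + a k))
    (ha0 : ∀ k, 0 ≤ a k) (ha : ∀ k : ℕ, a k ≤ A * (1 / ((k : ℝ) + 1) - 1 / ((k : ℝ) + 2))) :
    ∃ κ C : ℝ, (∀ k : ℕ, |q k - κ| ≤ C / ((k : ℝ) + 1)) ∧ |q 0| ≤ |κ| ∧ (q 0 = 0 → κ = 0) := by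
  have hA : 0 ≤ A := by
    have := (ha0 0).trans (ha 0)
    norm_num at this
    exact this
  have hbd : ∀ k : ℕ, |q k| ≤ |q 0| * Real.exp (A * (1 - 1 / ((k : ℝ) + 1))) := by
    intro k
    induction k with
    | zero => simp
    | succ k ih =>
      rw [hq, abs_mul, abs_of_nonneg (add_nonneg zero_le_one (ha0 k))]
      have h1 : 1 + a k ≤ Real.exp (A * (1 / ((k : ℝ) + 1) - 1 / ((k : ℝ) + 2))) := by
        have := Real.add_one_le_exp (A * (1 / ((k : ℝ) + 1) - 1 / ((k : ℝ) + 2)))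
        linarith [ha k]
      calc |q k| * (1 + a k) ≤ |q 0| * Real.exp (A * (1 - 1 / ((k : ℝ) + 1))) *
            Real.exp (A * (1 / ((k : ℝ) + 1) - 1 / ((k : ℝ) + 2))) :=
            mul_le_mul ih h1 (add_nonneg zero_le_one (ha0 k)) (by positivity)
        _ = _ := by
            rw [mul_assoc, ← Real.exp_add]
            congr 2
            push_cast
            ring
  set B := |q 0| * Real.exp A with hB
  have hB0 : 0 ≤ B := by positivity
  have hbd' : ∀ k : ℕ, |q k| ≤ B := fun k => (hbd k).trans <| by
    refine mul_le_mul_of_nonneg_left (Real.exp_le_exp.2 ?_) (abs_nonneg _)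
    have : 0 ≤ 1 / ((k : ℝ) + 1) := by positivity
    nlinarith
  have hmono : ∀ k, |q 0| ≤ |q k| := by
    intro k
    induction k with
    | zero => exact le_rfl
    | succ k ih =>
      rw [hq, abs_mul, abs_of_nonneg (add_nonneg zero_le_one (ha0 k))]
      nlinarith [abs_nonneg (q k), ha0 k]
  have hdiff : ∀ k j : ℕ, |q (k + j) - q k| ≤
      B * A * (1 / ((k : ℝ) + 1) - 1 / ((k : ℝ) + j + 1)) := by
    intro k j
    induction j with
    | zero => simp
    | succ j ih =>
      have e : q (k + (j + 1)) - q k = (q (k + j) - q k) + q (k + j) * a (k + j) := by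
        rw [← add_assoc, hq]; ring
      rw [e]
      have h1 : |q (k + j) * a (k + j)| ≤
          B * (A * (1 / ((k : ℝ) + j + 1) - 1 / ((k : ℝ) + j + 2))) := by
        rw [abs_mul, abs_of_nonneg (ha0 _)]
        refine mul_le_mul (hbd' _) ?_ (ha0 _) hB0
        have := ha (k + j)
        push_cast at this
        exact this
      refine (abs_add_le _ _).trans ((add_le_add ih h1).trans (le_of_eq ?_))
      push_cast
      ring
  have hdiff' : ∀ k j : ℕ, |q (k + j) - q k| ≤ B * A / ((k : ℝ) + 1) := by
    intro k j
    have : 0 ≤ 1 / ((k : ℝ) + j + 1) := by positivity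
    calc _ ≤ B * A * (1 / ((k : ℝ) + 1) - 1 / ((k : ℝ) + j + 1)) := hdiff k j
      _ ≤ B * A * (1 / ((k : ℝ) + 1)) := mul_le_mul_of_nonneg_left (by linarith) (by positivity)
      _ = _ := by ring
  have hc : CauchySeq q := by
    refine cauchySeq_of_le_tendsto_0' (fun k : ℕ => B * A / ((k : ℝ) + 1)) ?_ ?_
    · intro k l hkl
      obtain ⟨j, rfl⟩ := Nat.exists_eq_add_of_le hkl
      rw [dist_comm, Real.dist_eq]
      exact hdiff' k j
    · exact tendsto_const_div_natCast_add_one _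
  obtain ⟨κ, hκ⟩ := cauchySeq_tendsto_of_complete hc
  refine ⟨κ, B * A, fun k => ?_, ge_of_tendsto' hκ.abs hmono, fun h0 => ?_⟩
  · rw [abs_sub_comm]
    have h1 : Tendsto (fun j => |q (k + j) - q k|) atTop (𝓝 |κ - q k|) := by
      refine (Tendsto.sub_const ?_ _).abs
      simpa only [add_comm k] using (tendsto_add_atTop_iff_nat k).2 hκ
    exact le_of_tendsto' h1 (hdiff' k)
  · have : ∀ k, q k = 0 := fun k => by
      have := hbd' k
      rw [hB, h0, abs_zero, zero_mul] at this
      exact abs_nonpos_iff.1 this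
    exact tendsto_nhds_unique hκ (tendsto_const_nhds.congr fun k => (this k).symm)

/-- The Taylor coefficients decay like `k^(-n)`, and the weight `(k+1)⋯(k+n)` compensates this
exactly. The shift by `n` in the index makes the excess of the ratio over `1` nonnegative, as
`exists_limit_of_ratio` requires. -/
theorem sCoeff_asymptotics_ratio {n : ℕ} (hn : 2 < n) (m k : ℕ) :
    sCoeff n m (k + 1 + n) * ((k + 1 + 1).ascFactorial n : ℕ) =
      sCoeff n m (k + n) * ((k + 1).ascFactorial n : ℕ) *
        (1 + ((n : ℝ) / 2 * (m + n - 1)) / ((k + n + m + (n : ℝ) / 2) * (k + 1))) := by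
  have hn' : (2 : ℝ) < n := by exact_mod_cast hn
  have h1 := sCoeff_succ hn m (k + n)
  have a2 : ((k : ℝ) + 1) * ((k + 1 + 1).ascFactorial n : ℕ) =
      ((k + 1).ascFactorial n : ℕ) * ((k : ℝ) + 1 + n) := by
    have h' : (((k + 1 : ℕ) : ℝ)) * ((k + 1 + 1).ascFactorial n : ℕ) =
      ((k + 1 + n : ℕ) : ℝ) * ((k + 1).ascFactorial n : ℕ) := by
      exact_mod_cast Nat.succ_ascFactorial (k + 1) n
    push_cast at h'
    linarith
  rw [show k + n + 1 = k + 1 + n by ring] at h1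
  push_cast at h1
  have p1 : (k : ℝ) + n + m + (n : ℝ) / 2 ≠ 0 := by positivity
  have p2 : (k : ℝ) + 1 ≠ 0 := by positivity
  have p3 : (k : ℝ) + n + 1 ≠ 0 := by positivity
  have e1 : sCoeff n m (k + 1 + n) = sCoeff n m (k + n) *
      ((m + (k + n)) * (1 - (n : ℝ) / 2 + (k + n))) /
        ((k + n + m + (n : ℝ) / 2) * (k + n + 1)) := by
    rw [eq_div_iff (mul_ne_zero p1 p3), ← h1]; ring
  have e2 : (((k + 1 + 1).ascFactorial n : ℕ) : ℝ) =
      ((k + 1).ascFactorial n : ℕ) * ((k : ℝ) + 1 + n) / (k + 1) := by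
    rw [eq_div_iff p2, ← a2]; ring
  rw [e1, e2]
  field_simp
  ring

theorem exists_sCoeff_asymptotics {n : ℕ} (hn : 2 < n) (m : ℕ) :
    ∃ κ C : ℝ, (∀ k : ℕ, |sCoeff n m (k + n) * ((k + 1).ascFactorial n : ℕ) - κ| ≤
      C / ((k : ℝ) + 1)) ∧ (sCoeff n m n = 0 → κ = 0) ∧ (sCoeff n m n ≠ 0 → κ ≠ 0) := by
  have hn' : (2 : ℝ) < n := by exact_mod_cast hn
  have hA : 0 ≤ (n : ℝ) / 2 * (m + n - 1) := by
    have : (0 : ℝ) ≤ m + n - 1 := by linarith [Nat.cast_nonneg (α := ℝ) m]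
    positivity
  have hf : (((0 + 1).ascFactorial n : ℕ) : ℝ) ≠ 0 := by
    exact_mod_cast (Nat.ascFactorial_pos _ _).ne'
  obtain ⟨κ, C, h1, h2, h3⟩ := exists_limit_of_ratio
    (q := fun k => sCoeff n m (k + n) * ((k + 1).ascFactorial n : ℕ))
    (a := fun k => ((n : ℝ) / 2 * (m + n - 1)) / ((k + n + m + (n : ℝ) / 2) * (k + 1)))
    (A := (n : ℝ) / 2 * (m + n - 1))
    (fun k => sCoeff_asymptotics_ratio hn m k) (fun k => by positivity) (fun k => by
      have e : (1 / ((k : ℝ) + 1) - 1 / ((k : ℝ) + 2)) = 1 / ((k + 2) * (k + 1)) := by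
        field_simp; ring
      rw [e, ← mul_one_div]
      refine mul_le_mul_of_nonneg_left ?_ hA
      refine one_div_le_one_div_of_le (by positivity) ?_
      refine mul_le_mul_of_nonneg_right ?_ (by positivity)
      have : (0 : ℝ) ≤ m := Nat.cast_nonneg m
      linarith)
  refine ⟨κ, C, h1, fun h => h3 (by simp [h]), fun h hκ => ?_⟩
  rw [hκ, abs_zero] at h2
  have := abs_nonpos_iff.1 h2
  simp only [zero_add] at this hf
  exact (mul_ne_zero h hf) this

theorem exists_abs_sCoeff_le {n : ℕ} (hn : 2 < n) (m : ℕ) :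
    ∃ C : ℝ, ∀ k : ℕ, |sCoeff n m (k + n)| ≤ C / ((k : ℝ) + 1) ^ n := by
  obtain ⟨κ, C, h, -⟩ := exists_sCoeff_asymptotics hn m
  have hC : 0 ≤ C := by simpa using (abs_nonneg _).trans (h 0)
  refine ⟨|κ| + C, fun k => ?_⟩
  have hpos : (0 : ℝ) < ((k + 1).ascFactorial n : ℕ) := by
    exact_mod_cast Nat.ascFactorial_pos _ _
  have hle : ((k : ℝ) + 1) ^ n ≤ ((k + 1).ascFactorial n : ℕ) := by
    exact_mod_cast Nat.pow_succ_le_ascFactorial (k + 1) n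
  have h1 : |sCoeff n m (k + n)| * ((k + 1).ascFactorial n : ℕ) ≤ |κ| + C := by
    rw [← abs_of_pos hpos, ← abs_mul]
    have h2 := h k
    have h3 : C / ((k : ℝ) + 1) ≤ C := div_le_self hC (by linarith [Nat.cast_nonneg (α := ℝ) k])
    have h4 := abs_sub_abs_le_abs_sub (sCoeff n m (k + n) * ((k + 1).ascFactorial n : ℕ)) κ
    linarith
  rw [le_div_iff₀ (by positivity)]
  exact (mul_le_mul_of_nonneg_left hle (abs_nonneg _)).trans h1

theorem summable_sCoeff {n : ℕ} (hn : 2 < n) (m : ℕ) : Summable (sCoeff n m) := by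
  obtain ⟨C, hC⟩ := exists_abs_sCoeff_le hn m
  rw [← summable_nat_add_iff n]
  refine Summable.of_norm_bounded (g := fun k : ℕ => C * (((k + 1 : ℕ) : ℝ) ^ n)⁻¹) ?_ fun k => ?_
  · exact ((summable_nat_add_iff 1).2 (Real.summable_nat_pow_inv.2 (by omega))).mul_left C
  · simpa [div_eq_mul_inv] using hC k

theorem tendsto_mul_sCoeff {n : ℕ} (hn : 2 < n) (m : ℕ) (b : ℝ) :
    Tendsto (fun k : ℕ => (b + k) * sCoeff n m k) atTop (𝓝 0) := by
  obtain ⟨C, hC⟩ := exists_abs_sCoeff_le hn m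
  have hC0 : 0 ≤ C := by simpa using (abs_nonneg _).trans (hC 0)
  rw [← tendsto_add_atTop_iff_nat n]
  have h : Tendsto (fun k : ℕ => (|b| + n + 1) * C / ((k : ℝ) + 1)) atTop (𝓝 0) :=
    tendsto_const_div_natCast_add_one _
  refine squeeze_zero_norm (fun k => ?_) h
  have hk : (1 : ℝ) ≤ (k : ℝ) + 1 := by linarith [Nat.cast_nonneg (α := ℝ) k]
  rw [norm_mul, Real.norm_eq_abs, Real.norm_eq_abs]
  have h1 : |b + ((k + n : ℕ) : ℝ)| ≤ (|b| + n + 1) * (k + 1) := by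
    refine (abs_add_le _ _).trans ?_
    rw [Nat.abs_cast]
    push_cast
    nlinarith [abs_nonneg b, Nat.cast_nonneg (α := ℝ) n, Nat.cast_nonneg (α := ℝ) k,
      mul_nonneg (abs_nonneg b) (Nat.cast_nonneg (α := ℝ) k),
      mul_nonneg (Nat.cast_nonneg (α := ℝ) n) (Nat.cast_nonneg (α := ℝ) k)]
  have h2 : C / ((k : ℝ) + 1) ^ n ≤ C / ((k : ℝ) + 1) ^ 2 :=
    div_le_div_of_nonneg_left hC0 (by positivity) (pow_le_pow_right₀ hk (by omega))
  calc _ ≤ (|b| + n + 1) * (k + 1) * (C / ((k : ℝ) + 1) ^ 2) :=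
        mul_le_mul h1 ((hC k).trans h2) (abs_nonneg _) (by positivity)
    _ = _ := by field_simp

/-- `S_m(1) = 1`. -/
theorem hasSum_sCoeff {n : ℕ} (hn : 2 < n) (m : ℕ) : HasSum (sCoeff n m) 1 := by
  have hn' : (2 : ℝ) < n := by exact_mod_cast hn
  rcases Nat.eq_zero_or_pos m with rfl | hm
  · rw [← sCoeff_zero_zero n]
    exact hasSum_single 0 fun k hk => sCoeff_zero_left n hk
  induction m, hm using Nat.le_induction with
  | base =>
    -- For `m = 1` the partial sums have a closed form whose last term tends to zero.
    have h : ∀ K : ℕ, ∑ k ∈ Finset.range K, sCoeff n 1 k =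
        1 - ((n : ℝ) / 2 + K) * sCoeff n 1 K / (n - 1) := by
      have h1 : (n : ℝ) - 1 ≠ 0 := by linarith
      intro K
      induction K with
      | zero =>
        have : sCoeff n 1 0 = (n - 1) / ((n : ℝ) / 2) := by simp [sCoeff]
        rw [this]
        simp
        field_simp
        simp
      | succ K ih =>
        rw [Finset.sum_range_succ, ih]
        have h2 := sCoeff_succ hn 1 K
        have h3 : sCoeff n 1 (K + 1) * ((n : ℝ) / 2 + (K + 1)) =
            sCoeff n 1 K * (1 - (n : ℝ) / 2 + K) := by
          have h4 : (1 : ℝ) + K ≠ 0 := by positivity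
          apply mul_right_cancel₀ h4
          push_cast at h2
          linear_combination h2
        field_simp
        push_cast
        linear_combination 2 * h3
    have hs := (summable_sCoeff hn 1).hasSum
    have ht := hs.tendsto_sum_nat
    simp only [h] at ht
    have ht' : Tendsto (fun K : ℕ => 1 - ((n : ℝ) / 2 + K) * sCoeff n 1 K / (n - 1)) atTop
        (𝓝 (1 - 0 / ((n : ℝ) - 1))) :=
      ((tendsto_mul_sCoeff hn 1 _).div_const _).const_sub 1
    rw [zero_div, sub_zero] at ht'
    rwa [tendsto_nhds_unique ht ht'] at hs
  | succ m hm ih =>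
    have hm' : (m : ℝ) ≠ 0 := by positivity
    -- At the level of functions, `m (S_(m+1) - S_m) = -(1-t) S_m'`. At `t = 1` the Taylor
    -- coefficients of the right-hand side telescope, and only the boundary term `-K · sCoeff n m K`
    -- remains.
    have h : ∀ K : ℕ, ∑ k ∈ Finset.range K, (sCoeff n (m + 1) k - sCoeff n m k) =
        -((0 + K) * sCoeff n m K) / m := by
      intro K
      induction K with
      | zero => simp
      | succ K ih =>
        rw [Finset.sum_range_succ, ih]
        have h1 := sCoeff_succ hn m K
        have h2 := sCoeff_succ_left hn m K
        have h3 : (m : ℝ) + (n : ℝ) / 2 + K ≠ 0 := by positivity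
        apply mul_right_cancel₀ (mul_ne_zero hm' h3)
        have e : ∀ x y : ℝ, (x / m + y) * (m * ((m : ℝ) + (n : ℝ) / 2 + K)) =
            x * ((m : ℝ) + (n : ℝ) / 2 + K) + y * (m * ((m : ℝ) + (n : ℝ) / 2 + K)) := by
          intro x y; field_simp
        have e' : ∀ x : ℝ, (x / m) * (m * ((m : ℝ) + (n : ℝ) / 2 + K)) =
            x * ((m : ℝ) + (n : ℝ) / 2 + K) := by
          intro x; field_simp
        rw [e, e']
        push_cast
        linear_combination h2 + h1
    have hs := ((summable_sCoeff hn (m + 1)).sub (summable_sCoeff hn m)).hasSum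
    have ht := hs.tendsto_sum_nat
    simp only [h] at ht
    have ht' : Tendsto (fun K : ℕ => -((0 + (K : ℝ)) * sCoeff n m K) / m) atTop
        (𝓝 (-0 / (m : ℝ))) := ((tendsto_mul_sCoeff hn m 0).neg).div_const _
    rw [neg_zero, zero_div] at ht'
    rw [tendsto_nhds_unique ht ht'] at hs
    simpa using hs.add ih

theorem summable_sCoeff_mul_pow {n : ℕ} (hn : 2 < n) (m : ℕ) {t : ℝ} (ht : |t| ≤ 1) :
    Summable fun k => sCoeff n m k * t ^ k :=
  Summable.of_norm_bounded (summable_sCoeff hn m).norm fun k => by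
    rw [norm_mul, norm_pow]
    exact mul_le_of_le_one_right (norm_nonneg _) (pow_le_one₀ (norm_nonneg _) ht)

theorem continuousOn_S {n : ℕ} (hn : 2 < n) (m : ℕ) : ContinuousOn (S n m) (Set.Icc (-1) 1) := by
  have : S n m = fun t => ∑' k, sCoeff n m k * t ^ k := funext (S_eq_tsum n m)
  rw [this]
  refine continuousOn_tsum (fun k => by fun_prop) (summable_sCoeff hn m).norm fun k t ht => ?_
  rw [norm_mul, norm_pow]
  exact mul_le_of_le_one_right (norm_nonneg _) (pow_le_one₀ (norm_nonneg _) (abs_le.2 ht))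

theorem S_one {n : ℕ} (hn : 2 < n) (m : ℕ) : S n m 1 = 1 := by
  rw [S_eq_tsum]
  simpa using (hasSum_sCoeff hn m).tsum_eq

/-- The logarithmic expansion of `S_m` at `t = 1`; the coefficient of the logarithm is proportional
to `(m)_{n-1}`. -/
theorem exists_logExpansion_S {n : ℕ} (hn : 2 < n) : ∃ β : ℝ, (Odd n → β ≠ 0) ∧
    ∀ m : ℕ, ∃ p : Polynomial ℝ, p.eval 0 = 1 ∧
      LogExpansion (n - 1) (fun τ => S n m (1 - τ)) p
        (β * (ascPochhammer ℝ (n - 1)).eval (m : ℝ)) := by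
  have hn' : (2 : ℝ) < n := by exact_mod_cast hn
  choose κ C hκ hκ0 hκ1 using exists_sCoeff_asymptotics hn
  obtain ⟨e, γ, hγ, he⟩ := exists_hasSum_inv_ascFactorial (n - 1)
  have hn1 : n - 1 + 1 = n := by omega
  have hlim : ∀ m, Tendsto (fun k : ℕ => sCoeff n m (k + n) * ((k + 1).ascFactorial n : ℕ)) atTop
      (𝓝 (κ m)) := fun m => by
    rw [tendsto_iff_norm_sub_tendsto_zero]
    exact squeeze_zero (fun k => norm_nonneg _) (hκ m)
      (tendsto_const_div_natCast_add_one _)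
  -- The limit `k → ∞` of the contiguous relation in `m`.
  have hrec : ∀ m : ℕ, (m : ℝ) * κ (m + 1) = (m + (n - 1 : ℕ)) * κ m := by
    intro m
    have h1 := (hlim (m + 1)).const_mul (m : ℝ)
    have h2 : Tendsto (fun k : ℕ => ((m : ℝ) + n - 1) * (1 - ((n : ℝ) / 2) /
        ((k : ℝ) + (n + m + (n : ℝ) / 2))) *
        (sCoeff n m (k + n) * ((k + 1).ascFactorial n : ℕ))) atTop
        (𝓝 (((m : ℝ) + n - 1) * (1 - 0) * κ m)) := by
      refine Tendsto.mul (Tendsto.const_mul _ (Tendsto.const_sub _ ?_)) (hlim m)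
      exact (tendsto_natCast_atTop_atTop.atTop_add tendsto_const_nhds).const_div_atTop _
    have h3 := tendsto_nhds_unique (h1.congr fun k => ?_) h2
    · rw [h3]
      push_cast [Nat.cast_sub (by omega : 1 ≤ n)]
      ring
    · have := sCoeff_succ_left hn m (k + n)
      push_cast at this
      have h4 : (k : ℝ) + (n + m + (n : ℝ) / 2) ≠ 0 := by positivity
      have h5 : (1 - ((n : ℝ) / 2) / ((k : ℝ) + (n + m + (n : ℝ) / 2))) =
          (m + (k + n)) / ((k : ℝ) + (n + m + (n : ℝ) / 2)) := by
        field_simp; ring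
      rw [h5]
      field_simp
      linear_combination 2 * this
  have hκ00 : κ 0 = 0 := hκ0 0 (sCoeff_zero_left n (by omega))
  have hκm := eq_mul_ascPochhammer_of_recurrence (by omega : 0 < n - 1) hκ00 hrec
  refine ⟨κ 1 / (n - 1).factorial * γ, fun hodd => ?_, fun m => ?_⟩
  · refine mul_ne_zero (div_ne_zero (hκ1 1 ?_) (by positivity)) hγ
    -- For odd `n` none of the factors `1 - n/2 + k` vanishes, so the series does not terminate.
    have h1 : ∀ k : ℕ, sCoeff n 1 k ≠ 0 := by
      intro k
      induction k with
      | zero =>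
        have : (n : ℝ) - 1 ≠ 0 := by linarith
        simp [sCoeff]
        exact ⟨this, by omega⟩
      | succ k ih =>
        intro h0
        have h2 := sCoeff_succ hn 1 k
        rw [h0, zero_mul] at h2
        have h3 : (1 : ℝ) - (n : ℝ) / 2 + k ≠ 0 := by
          intro h
          have : (n : ℝ) = (2 * (k + 1) : ℕ) := by push_cast; linarith
          have := Nat.cast_injective this
          rw [this] at hodd
          exact (Nat.not_odd_iff_even.2 (even_two_mul _)) hodd
        have h4 : ((1 : ℕ) : ℝ) + k ≠ 0 := by positivity
        exact (mul_ne_zero ih (mul_ne_zero h4 h3)) h2.symm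
    exact h1 n
  -- The leading behaviour `κ_m / ((k+1)⋯(k+n))` is split off. Its sum is explicit and carries the
  -- whole logarithm; what is left decays one power faster and contributes only a polynomial and an
  -- error.
  · obtain ⟨d, hd⟩ : ∃ d : ℕ → ℝ, d = fun k => sCoeff n m (k + n) -
      κ m * (((k + 1).ascFactorial n : ℕ) : ℝ)⁻¹ := ⟨_, rfl⟩
    have hdb : ∀ k, |d k| ≤ C m / ((k : ℝ) + 1) ^ (n - 1 + 2) := by
      intro k
      have hpos : (0 : ℝ) < ((k + 1).ascFactorial n : ℕ) := by
        exact_mod_cast Nat.ascFactorial_pos _ _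
      have hle : ((k : ℝ) + 1) ^ n ≤ ((k + 1).ascFactorial n : ℕ) := by
        exact_mod_cast Nat.pow_succ_le_ascFactorial (k + 1) n
      have e1 : d k = (sCoeff n m (k + n) * ((k + 1).ascFactorial n : ℕ) - κ m) /
          ((k + 1).ascFactorial n : ℕ) := by
        rw [hd]; field_simp
      rw [e1, abs_div, abs_of_pos hpos]
      calc _ ≤ C m / ((k : ℝ) + 1) / ((k : ℝ) + 1) ^ n :=
            div_le_div₀ ((abs_nonneg _).trans (hκ m k)) (hκ m k) (by positivity) hle
        _ = _ := by
            rw [show n - 1 + 2 = n + 1 by omega, div_div, ← pow_succ']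
    obtain ⟨p, hp⟩ := logExpansion_tsum (by omega : 1 ≤ n - 1) hdb
    set X1 : Polynomial ℝ := 1 - Polynomial.X
    have hS : ∀ τ ∈ Set.Ioo (0 : ℝ) 1, S n m (1 - τ) =
        (∑ k ∈ Finset.range n, Polynomial.C (sCoeff n m k) * X1 ^ k +
          Polynomial.C (κ m) * e).eval τ + κ m * γ * (τ ^ (n - 1) * Real.log τ) +
          (X1 ^ n).eval τ * ∑' k, d k * (1 - τ) ^ k := by
      intro τ hτ
      have ht : |1 - τ| ≤ 1 := by rw [abs_le]; constructor <;> linarith [hτ.1, hτ.2]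
      have h1 := (summable_sCoeff_mul_pow hn m ht).hasSum
      have h2 := (hasSum_nat_add_iff' n).2 h1
      have h3 := (he τ hτ).mul_left (κ m)
      simp only [hn1, add_assoc _ (n - 1) 1] at h3
      have h4 := (h2.sub h3).tsum_eq
      have h5 : (∑' k, (sCoeff n m (k + n) * (1 - τ) ^ (k + n) -
          κ m * ((1 - τ) ^ (k + n) * (((k + 1).ascFactorial n : ℕ) : ℝ)⁻¹))) =
          (1 - τ) ^ n * ∑' k, d k * (1 - τ) ^ k := by
        rw [← tsum_mul_left]
        refine tsum_congr fun k => ?_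
        rw [hd]
        simp only
        ring
      rw [h5] at h4
      rw [S_eq_tsum]
      simp only [Polynomial.eval_add, Polynomial.eval_finsetSum, Polynomial.eval_mul,
        Polynomial.eval_C, Polynomial.eval_pow, X1, Polynomial.eval_sub, Polynomial.eval_one,
        Polynomial.eval_X]
      rw [h4]
      ring
    have hexp : LogExpansion (n - 1) (fun τ => S n m (1 - τ))
        (∑ k ∈ Finset.range n, Polynomial.C (sCoeff n m k) * X1 ^ k +
          Polynomial.C (κ m) * e + X1 ^ n * p) (κ m * γ) := by
      have h1 := (LogExpansion.of_polynomial (n - 1) (X1 ^ n)).mul (by omega) hp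
      intro δ hδ
      obtain ⟨D, hD⟩ := h1 δ hδ
      refine ⟨D, fun τ hτ => ?_⟩
      refine le_trans (le_of_eq ?_) (hD τ hτ)
      change |S n m (1 - τ) - _ - _| = _
      rw [hS τ hτ, Polynomial.eval_add (p := _ + _), Polynomial.eval_mul (p := X1 ^ n)]
      congr 1
      ring
    -- The constant term of the polynomial is found by letting `τ → 0` and using `S_m(1) = 1`.
    have h1τ : Tendsto (fun τ : ℝ => S n m (1 - τ)) (𝓝[>] 0) (𝓝 1) := by
      have h1 : ContinuousWithinAt (S n m) (Set.Icc (-1) 1) 1 := continuousOn_S hn m 1 (by simp)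
      have h2 := h1.tendsto
      rw [S_one hn m] at h2
      refine h2.comp (tendsto_nhdsWithin_iff.2 ⟨?_, ?_⟩)
      · have : Tendsto (fun τ : ℝ => 1 - τ) (𝓝 0) (𝓝 (1 - 0)) := tendsto_id.const_sub 1
        rw [sub_zero] at this
        exact this.mono_left nhdsWithin_le_nhds
      · filter_upwards [Ioo_mem_nhdsGT (zero_lt_one' ℝ)] with τ hτ
        constructor <;> linarith [hτ.1, hτ.2]
    refine ⟨_, ?_, by convert hexp using 1; rw [hκm m]; ring⟩
    set P := ∑ k ∈ Finset.range n, Polynomial.C (sCoeff n m k) * X1 ^ k +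
          Polynomial.C (κ m) * e + X1 ^ n * p
    obtain ⟨D, hD0, hD⟩ := hexp.exists_bound
    have hP : Tendsto (fun τ : ℝ => P.eval τ) (𝓝[>] 0) (𝓝 (P.eval 0)) :=
      (P.continuous.tendsto 0).mono_left nhdsWithin_le_nhds
    have hR : Tendsto (fun τ : ℝ => S n m (1 - τ) - P.eval τ) (𝓝[>] 0) (𝓝 0) := by
      have h3 : Tendsto (fun τ : ℝ => D * τ ^ (((n - 1 : ℕ) : ℝ) - 1 / 2)) (𝓝[>] 0) (𝓝 0) := by
        have hpos : 0 < ((n - 1 : ℕ) : ℝ) - 1 / 2 := by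
          have : (1 : ℝ) ≤ (n - 1 : ℕ) := by exact_mod_cast (by omega : 1 ≤ n - 1)
          linarith
        have := ((Real.continuousAt_rpow_const 0 _ (Or.inr hpos.le)).tendsto.const_mul D).mono_left
          (nhdsWithin_le_nhds (s := Set.Ioi 0))
        rwa [Real.zero_rpow hpos.ne', mul_zero] at this
      refine squeeze_zero_norm' ?_ h3
      filter_upwards [Ioo_mem_nhdsGT (zero_lt_one' ℝ)] with τ hτ
      exact (hD τ hτ).1
    have := h1τ.sub hR
    simp only [sub_sub_cancel, sub_zero] at this
    exact tendsto_nhds_unique hP this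

/-! ### Even dimensions: `S_m` is a polynomial -/

theorem sCoeff_eq_zero {p : ℕ} (m : ℕ) {k : ℕ} (hp : 0 < p) (hk : p ≤ k) :
    sCoeff (2 * p) m k = 0 := by
  have h : (ascPochhammer ℝ k).eval (1 - ((2 * p : ℕ) : ℝ) / 2) = 0 := by
    rw [ascPochhammer_eval_eq_zero_iff]
    refine ⟨p - 1, by omega, ?_⟩
    push_cast [Nat.cast_sub (by omega : 1 ≤ p)]
    ring
  simp only [sCoeff, h, mul_zero, zero_mul]

/-- The polynomial `S_m` in the even dimension `n = 2p`. -/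
def sPoly (p m : ℕ) : Polynomial ℝ :=
  ∑ k ∈ Finset.range p, Polynomial.C (sCoeff (2 * p) m k) * Polynomial.X ^ k

theorem coeff_sPoly {p : ℕ} (hp : 0 < p) (m k : ℕ) :
    (sPoly p m).coeff k = sCoeff (2 * p) m k := by
  simp only [sPoly, Polynomial.finsetSum_coeff, Polynomial.coeff_C_mul, Polynomial.coeff_X_pow,
    mul_ite, mul_one, mul_zero, Finset.sum_ite_eq, Finset.mem_range]
  split_ifs with h
  · rfl
  · exact (sCoeff_eq_zero m hp (not_lt.1 h)).symm

theorem S_eq_eval_sPoly {p : ℕ} (hp : 0 < p) (m : ℕ) (t : ℝ) :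
    S (2 * p) m t = (sPoly p m).eval t := by
  rw [S_eq_tsum, tsum_eq_sum (s := Finset.range p) fun k hk => by
    rw [sCoeff_eq_zero m hp (not_lt.1 (Finset.mem_range.not.1 hk)), zero_mul]]
  simp [sPoly, Polynomial.eval_finsetSum]

theorem natDegree_sPoly_lt {p : ℕ} (hp : 0 < p) (m : ℕ) : (sPoly p m).natDegree < p := by
  have : (sPoly p m).natDegree ≤ p - 1 := Polynomial.natDegree_le_iff_coeff_eq_zero.2
    fun k hk => by rw [coeff_sPoly hp, sCoeff_eq_zero m hp (by omega)]
  omega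

/-- The relations in `k` and in `m`, read as a first order differential relation. With
`sPoly_lowering` it provides the two halves of an integration by parts for `t^(m+p) S_m S_(m+1)`. -/
theorem sPoly_raising {p : ℕ} (hp : 1 < p) (m : ℕ) :
    Polynomial.C (m : ℝ) * sPoly p (m + 1) = Polynomial.C (m : ℝ) * sPoly p m -
      (1 - Polynomial.X) * Polynomial.derivative (sPoly p m) := by
  have hp0 : 0 < p := by omega
  ext k
  have h1 := sCoeff_succ (n := 2 * p) (by omega) m k
  have h2 := sCoeff_succ_left (n := 2 * p) (by omega) m k
  have hX : (Polynomial.X * Polynomial.derivative (sPoly p m)).coeff k =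
      k * sCoeff (2 * p) m k := by
    cases k with
    | zero => simp
    | succ k =>
      rw [Polynomial.coeff_X_mul, Polynomial.coeff_derivative, coeff_sPoly hp0]
      push_cast; ring
  rw [sub_mul, one_mul, Polynomial.coeff_sub, Polynomial.coeff_sub, hX, Polynomial.coeff_C_mul,
    Polynomial.coeff_C_mul, Polynomial.coeff_derivative, coeff_sPoly hp0, coeff_sPoly hp0,
    coeff_sPoly hp0]
  push_cast at h1 h2 ⊢
  have h3 : (m : ℝ) + 2 * p / 2 + k ≠ 0 := by positivity
  apply mul_right_cancel₀ h3
  linear_combination h2 + h1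

theorem sPoly_lowering {p : ℕ} (hp : 1 < p) (m : ℕ) :
    Polynomial.C ((m : ℝ) + (2 * p - 1)) * Polynomial.X * sPoly p (m + 1) +
      Polynomial.C ((m : ℝ) + p) * (1 - Polynomial.X) * sPoly p (m + 1) +
      Polynomial.X * (1 - Polynomial.X) * Polynomial.derivative (sPoly p (m + 1)) =
      Polynomial.C ((m : ℝ) + (2 * p - 1)) * sPoly p m := by
  have hp0 : 0 < p := by omega
  have e : Polynomial.C ((m : ℝ) + (2 * p - 1)) * Polynomial.X * sPoly p (m + 1) +
      Polynomial.C ((m : ℝ) + p) * (1 - Polynomial.X) * sPoly p (m + 1) +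
      Polynomial.X * (1 - Polynomial.X) * Polynomial.derivative (sPoly p (m + 1)) =
      Polynomial.C ((m : ℝ) + p) * sPoly p (m + 1) +
      Polynomial.X * (Polynomial.C ((p : ℝ) - 1) * sPoly p (m + 1) +
        Polynomial.derivative (sPoly p (m + 1)) -
        Polynomial.X * Polynomial.derivative (sPoly p (m + 1))) := by
    have : Polynomial.C ((m : ℝ) + (2 * p - 1)) =
        Polynomial.C ((m : ℝ) + p) + Polynomial.C ((p : ℝ) - 1) := by
      rw [← Polynomial.C_add]; congr 1; ring
    rw [this]; ring
  rw [e]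
  ext k
  cases k with
  | zero =>
    simp only [Polynomial.coeff_add, Polynomial.coeff_C_mul, Polynomial.coeff_X_mul_zero,
      coeff_sPoly hp0, add_zero]
    rcases Nat.eq_zero_or_pos m with rfl | hm
    · have hp' : (p : ℝ) ≠ 0 := by positivity
      have h1 : (2 * (p : ℝ)) / 2 = p := by ring
      simp [sCoeff]
      field_simp
    · have h2 := sCoeff_succ_left (n := 2 * p) (by omega) m 0
      have hm' : (m : ℝ) ≠ 0 := by positivity
      push_cast at h2
      apply mul_right_cancel₀ hm'
      linear_combination h2
  | succ k =>
    have hX : (Polynomial.X * Polynomial.derivative (sPoly p (m + 1))).coeff k =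
        k * sCoeff (2 * p) (m + 1) k := by
      cases k with
      | zero => simp
      | succ k =>
        rw [Polynomial.coeff_X_mul, Polynomial.coeff_derivative, coeff_sPoly hp0]
        push_cast; ring
    have h1 := sCoeff_succ (n := 2 * p) (by omega) m k
    have h2 := sCoeff_succ (n := 2 * p) (by omega) (m + 1) k
    have h3 := sCoeff_succ_left (n := 2 * p) (by omega) m k
    have h4 := sCoeff_succ_left (n := 2 * p) (by omega) m (k + 1)
    rw [Polynomial.coeff_add, Polynomial.coeff_X_mul, Polynomial.coeff_sub, Polynomial.coeff_add,
      hX, Polynomial.coeff_derivative]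
    simp only [Polynomial.coeff_C_mul, coeff_sPoly hp0]
    rcases Nat.eq_zero_or_pos m with rfl | hm
    · rw [sCoeff_zero_left _ (Nat.succ_ne_zero k)]
      have h5 : (1 : ℝ) + k ≠ 0 := by positivity
      apply mul_right_cancel₀ h5
      push_cast at h2 ⊢
      linear_combination h2
    · have hm' : (m : ℝ) ≠ 0 := by positivity
      have h5 : (m : ℝ) + 2 * p / 2 + k ≠ 0 := by positivity
      push_cast at h1 h2 h3 h4 ⊢
      apply mul_right_cancel₀ (mul_ne_zero hm' h5)
      linear_combination (m + (p : ℝ) + k) * h4 + (p - 1 - (k : ℝ)) * h3 +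
        (m + 2 * (p : ℝ) - 1) * h1

/-- The coefficient of `(1-t)^N` of a polynomial in `t`. -/
def coeffAtOne (N : ℕ) : Polynomial ℝ →ₗ[ℝ] ℝ :=
  (Polynomial.lcoeff ℝ N).comp
    (Polynomial.aeval (R := ℝ) (1 - Polynomial.X : Polynomial ℝ)).toLinearMap

theorem coeffAtOne_apply (N : ℕ) (P : Polynomial ℝ) :
    coeffAtOne N P = (P.comp (1 - Polynomial.X)).coeff N := rfl

/-- In the variable `1-t` the operator `(1-t) d/dt` is minus the Euler operator, so it multiplies
the coefficient of `(1-t)^N` by `-N`. Expressions of this form are the exact terms to be discarded.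
-/
theorem coeffAtOne_derivative (N : ℕ) (Q : Polynomial ℝ) :
    coeffAtOne N ((1 - Polynomial.X) * Polynomial.derivative Q + Polynomial.C (N : ℝ) * Q) = 0 := by
  have h : Polynomial.derivative (Q.comp (1 - Polynomial.X)) =
      -(Polynomial.derivative Q).comp (1 - Polynomial.X) := by
    rw [Polynomial.derivative_comp]; simp
  rw [coeffAtOne_apply, Polynomial.add_comp, Polynomial.mul_comp, Polynomial.mul_comp,
    Polynomial.C_comp, Polynomial.coeff_add, Polynomial.coeff_C_mul, ← neg_neg
      ((Polynomial.derivative Q).comp (1 - Polynomial.X)), ← h]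
  simp only [Polynomial.sub_comp, Polynomial.one_comp, Polynomial.X_comp, sub_sub_cancel]
  rw [mul_neg, Polynomial.coeff_neg]
  cases N with
  | zero => simp
  | succ N =>
    rw [Polynomial.coeff_X_mul, Polynomial.coeff_derivative]
    push_cast; ring

theorem natDegree_one_sub_X : (1 - Polynomial.X : Polynomial ℝ).natDegree = 1 := by
  rw [← neg_sub, Polynomial.natDegree_neg]
  exact Polynomial.natDegree_X_sub_C 1

theorem coeffAtOne_eq_zero {N : ℕ} {P : Polynomial ℝ} (h : P.natDegree < N) :
    coeffAtOne N P = 0 := by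
  rw [coeffAtOne_apply]
  apply Polynomial.coeff_eq_zero_of_natDegree_lt
  rwa [Polynomial.natDegree_comp, natDegree_one_sub_X, mul_one]

/-- By the raising and lowering relations, the two polynomials, multiplied by `m` and by `m+2p-1`,
differ by `(1-t)Q' + (2p-1)Q` with `Q = t^(m+p) S_m S_(m+1)`. That expression has no term in
`(1-t)^(2p-1)`. -/
theorem coeffAtOne_recurrence {p : ℕ} (hp : 1 < p) (m : ℕ) :
    (m : ℝ) * coeffAtOne (2 * p - 1) (Polynomial.X ^ (m + 1 + p - 1) * sPoly p (m + 1) ^ 2) =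
      (m + (2 * p - 1 : ℕ)) * coeffAtOne (2 * p - 1) (Polynomial.X ^ (m + p - 1) *
        sPoly p m ^ 2) := by
  obtain ⟨a, ha⟩ : ∃ a, m + p = a + 1 := ⟨m + p - 1, by omega⟩
  have ha' : (a : ℝ) + 1 = m + p := by exact_mod_cast ha.symm
  rw [show m + 1 + p - 1 = a + 1 by omega, show m + p - 1 = a by omega]
  have hR := sPoly_raising hp m
  have hL := sPoly_lowering hp m
  have hN : ((2 * p - 1 : ℕ) : ℝ) = 2 * p - 1 := by
    push_cast [Nat.cast_sub (by omega : 1 ≤ 2 * p)]; ring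
  have h0 := coeffAtOne_derivative (2 * p - 1)
    (Polynomial.X ^ (a + 1) * sPoly p m * sPoly p (m + 1))
  rw [hN] at h0 ⊢
  have e : Polynomial.C (m : ℝ) * (Polynomial.X ^ (a + 1) * sPoly p (m + 1) ^ 2) =
      Polynomial.C ((m : ℝ) + (2 * p - 1)) * (Polynomial.X ^ a * sPoly p m ^ 2) -
      ((1 - Polynomial.X) * Polynomial.derivative
        (Polynomial.X ^ (a + 1) * sPoly p m * sPoly p (m + 1)) +
      Polynomial.C (2 * (p : ℝ) - 1) *
        (Polynomial.X ^ (a + 1) * sPoly p m * sPoly p (m + 1))) := by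
    rw [Polynomial.derivative_mul, Polynomial.derivative_mul, Polynomial.derivative_X_pow,
      Nat.add_sub_cancel]
    push_cast
    rw [ha']
    rw [Polynomial.C_add (a := (m : ℝ)) (b := 2 * p - 1)] at hL ⊢
    linear_combination Polynomial.X ^ (a + 1) * sPoly p (m + 1) * hR +
      Polynomial.X ^ a * sPoly p m * hL
  rw [← smul_eq_mul, ← map_smul, Polynomial.smul_eq_C_mul, e, map_sub, h0, sub_zero,
    ← Polynomial.smul_eq_C_mul, map_smul, smul_eq_mul]

/-- From degree `p` on, the coefficients of `(1-t)^(2p-1)` are proportional to those of `t^p S_1`.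
Hence `l t^p S_1 = (1-t)^(2p-1) - L` with `deg L < p` and `l ≠ 0`. After multiplication by `S_1`,
the product `S_1 L` has degree below `2p-1` and does not contribute, so the coefficient is `S_1(1)/l
= 1/l`. -/
theorem coeffAtOne_one_ne_zero {p : ℕ} (hp : 1 < p) :
    coeffAtOne (2 * p - 1) (Polynomial.X ^ (1 + p - 1) * sPoly p 1 ^ 2) ≠ 0 := by
  have hp0 : 0 < p := by omega
  have hp' : (1 : ℝ) < p := by exact_mod_cast hp
  have hs0 : sCoeff (2 * p) 1 0 ≠ 0 := by
    have : (2 * (p : ℝ) - 1) ≠ 0 := by linarith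
    simp [sCoeff]
    exact ⟨this, by omega⟩
  set b : ℕ → ℝ := fun k => (-1) ^ (p + k) * ((2 * p - 1).choose (p + k) : ℕ) with hb
  set l : ℝ := b 0 / sCoeff (2 * p) 1 0 with hl
  have hb0 : b 0 ≠ 0 := by
    have : (2 * p - 1).choose (p + 0) ≠ 0 := (Nat.choose_pos (by omega)).ne'
    exact mul_ne_zero (pow_ne_zero _ (by norm_num)) (by exact_mod_cast this)
  have hl0 : l ≠ 0 := div_ne_zero hb0 hs0
  have hbl : ∀ k : ℕ, b k = l * sCoeff (2 * p) 1 k := by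
    intro k
    induction k with
    | zero => rw [hl]; field_simp
    | succ k ih =>
      have h2 := sCoeff_succ (n := 2 * p) (by omega) 1 k
      have h3 : sCoeff (2 * p) 1 (k + 1) * (p + (k + 1)) =
          sCoeff (2 * p) 1 k * (1 - p + k) := by
        have h4 : (1 : ℝ) + k ≠ 0 := by positivity
        apply mul_right_cancel₀ h4
        push_cast at h2
        linear_combination h2
      have h5 : b (k + 1) * (p + (k + 1)) = b k * (1 - p + k) := by
        simp only [hb]
        rcases le_or_gt (p + k) (2 * p - 1) with h | h
        · have h6 := Nat.choose_succ_right_eq (2 * p - 1) (p + k)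
          have h7 : (((2 * p - 1).choose (p + k + 1) : ℕ) : ℝ) * ((p + k + 1 : ℕ) : ℝ) =
              ((2 * p - 1).choose (p + k) : ℕ) * ((2 * p - 1 - (p + k) : ℕ) : ℝ) := by
            exact_mod_cast h6
          rw [Nat.cast_sub h, Nat.cast_sub (by omega : 1 ≤ 2 * p)] at h7
          push_cast at h7
          rw [← add_assoc p k 1, pow_succ]
          linear_combination (-1) ^ (p + k) * (-1) * h7
        · rw [Nat.choose_eq_zero_of_lt h, Nat.choose_eq_zero_of_lt (by omega)]
          simp
      have h8 : (p : ℝ) + (k + 1) ≠ 0 := by positivity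
      apply mul_right_cancel₀ h8
      rw [h5, ih]
      linear_combination -l * h3
  set L : Polynomial ℝ := (1 - Polynomial.X) ^ (2 * p - 1) -
    Polynomial.C l * (Polynomial.X ^ p * sPoly p 1) with hL
  have hLdeg : L.natDegree < p := by
    suffices h : L.natDegree ≤ p - 1 by omega
    refine Polynomial.natDegree_le_iff_coeff_eq_zero.2 fun j hj => ?_
    obtain ⟨k, rfl⟩ := Nat.exists_eq_add_of_le (by omega : p ≤ j)
    have e1 : ((1 - Polynomial.X : Polynomial ℝ) ^ (2 * p - 1)).coeff (p + k) = b k := by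
      have : (1 - Polynomial.X : Polynomial ℝ) ^ (2 * p - 1) =
          ((1 + Polynomial.X) ^ (2 * p - 1)).comp (Polynomial.C (-1) * Polynomial.X) := by
        simp [sub_eq_add_neg]
      rw [this, Polynomial.comp_C_mul_X_coeff, Polynomial.coeff_one_add_X_pow]
      simp only [hb]; ring
    rw [hL, Polynomial.coeff_sub, e1, Polynomial.coeff_C_mul, add_comm p k,
      Polynomial.coeff_X_pow_mul, coeff_sPoly hp0, hbl, sub_self]
  have e : Polynomial.X ^ (1 + p - 1) * sPoly p 1 ^ 2 =
      Polynomial.C l⁻¹ * (sPoly p 1 * (1 - Polynomial.X) ^ (2 * p - 1) - sPoly p 1 * L) := by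
    have : Polynomial.C l⁻¹ * Polynomial.C l = (1 : Polynomial ℝ) := by
      rw [← Polynomial.C_mul, inv_mul_cancel₀ hl0, Polynomial.C_1]
    rw [hL, show 1 + p - 1 = p by omega]
    linear_combination (-(sPoly p 1) ^ 2 * Polynomial.X ^ p) * this
  rw [e, ← Polynomial.smul_eq_C_mul, map_smul, smul_eq_mul]
  refine mul_ne_zero (inv_ne_zero hl0) ?_
  have hdeg : (sPoly p 1 * L).natDegree < 2 * p - 1 := by
    have := natDegree_sPoly_lt hp0 1
    exact lt_of_le_of_lt Polynomial.natDegree_mul_le (by omega)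
  rw [map_sub, coeffAtOne_eq_zero hdeg, sub_zero, coeffAtOne_apply, Polynomial.mul_comp,
    Polynomial.pow_comp, Polynomial.sub_comp, Polynomial.one_comp, Polynomial.X_comp,
    sub_sub_cancel, show 2 * p - 1 = 0 + (2 * p - 1) by omega]
  conv => lhs; arg 2; rw [zero_add]
  rw [zero_add, Polynomial.coeff_mul_X_pow', if_pos le_rfl, Nat.sub_self,
    Polynomial.coeff_zero_eq_eval_zero, Polynomial.eval_comp]
  simp only [Polynomial.eval_sub, Polynomial.eval_one, Polynomial.eval_X, sub_zero]
  rw [← S_eq_eval_sPoly hp0, S_one (by omega)]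
  exact one_ne_zero

/-! ### The expansion of `t^(m+n/2-1) S_m(t)²` -/

/-- Taylor's formula is used on `[0,1/2]`, away from the singularity at `τ = 1`. On `(1/2,1)`
everything is bounded and `τ^δ` is bounded below. -/
theorem exists_logExpansion_one_sub_rpow (N : ℕ) {a : ℝ} (ha : 0 ≤ a) :
    ∃ p : Polynomial ℝ, p.eval 0 = 1 ∧ LogExpansion N (fun τ => (1 - τ) ^ a) p 0 := by
  have hcd : ContDiffOn ℝ (N + 1 : ℕ) (fun τ : ℝ => (1 - τ) ^ a) (Set.Icc 0 (1 / 2)) := by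
    intro τ hτ
    have : (1 : ℝ) - τ ≠ 0 := by linarith [hτ.2]
    exact ((contDiffAt_const.sub contDiffAt_id).rpow_const_of_ne this).contDiffWithinAt
  obtain ⟨C, hC⟩ := exists_taylor_mean_remainder_bound (n := N) (by norm_num : (0 : ℝ) ≤ 1 / 2)
    (by exact_mod_cast hcd)
  set p : Polynomial ℝ := ∑ k ∈ Finset.range (N + 1), Polynomial.C ((k.factorial : ℝ)⁻¹ *
    iteratedDerivWithin k (fun τ : ℝ => (1 - τ) ^ a) (Set.Icc 0 (1 / 2)) 0) * Polynomial.X ^ k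
    with hp
  have hpe : ∀ τ, p.eval τ =
      taylorWithinEval (fun τ : ℝ => (1 - τ) ^ a) N (Set.Icc 0 (1 / 2)) 0 τ := by
    intro τ
    rw [taylor_within_apply, hp, Polynomial.eval_finsetSum]
    refine Finset.sum_congr rfl fun k _ => ?_
    simp only [Polynomial.eval_mul, Polynomial.eval_C, Polynomial.eval_pow, Polynomial.eval_X,
      sub_zero, smul_eq_mul]
    ring
  refine ⟨p, by rw [hpe, taylorWithinEval_self]; simp, fun δ hδ => ?_⟩
  obtain ⟨P, hP0, hP⟩ := abs_polynomial_eval_le p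
  refine ⟨|C| + (1 + P) * (2 : ℝ) ^ (max δ 0), fun τ hτ => ?_⟩
  have hτδ := Real.rpow_pos_of_pos hτ.1 δ
  rw [zero_mul, sub_zero, add_mul]
  rcases le_or_gt τ (1 / 2) with h | h
  · have h1 := hC τ ⟨hτ.1.le, h⟩
    rw [← hpe, Real.norm_eq_abs, sub_zero] at h1
    have h2 : τ ^ (N + 1) ≤ τ ^ δ := by
      rw [← Real.rpow_natCast]
      exact rpow_le_rpow_of_mem_Ioo hτ (by push_cast; exact hδ.le)
    have h3 : C * τ ^ (N + 1) ≤ |C| * τ ^ δ :=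
      mul_le_mul (le_abs_self C) h2 (pow_nonneg hτ.1.le _) (abs_nonneg C)
    have : 0 ≤ (1 + P) * (2 : ℝ) ^ (max δ 0) * τ ^ δ := by positivity
    linarith
  · have h1 : |(1 - τ) ^ a| ≤ 1 := by
      rw [abs_of_nonneg (Real.rpow_nonneg (by linarith [hτ.2]) _)]
      exact Real.rpow_le_one (by linarith [hτ.2]) (by linarith [hτ.1]) ha
    have h2 : 1 ≤ (2 : ℝ) ^ (max δ 0) * τ ^ δ := by
      calc (1 : ℝ) ≤ (2 * τ) ^ (max δ 0) := Real.one_le_rpow (by linarith) (le_max_right _ _)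
        _ = (2 : ℝ) ^ (max δ 0) * τ ^ (max δ 0) := Real.mul_rpow two_pos.le hτ.1.le
        _ ≤ _ := mul_le_mul_of_nonneg_left (rpow_le_rpow_of_mem_Ioo hτ (le_max_left _ _))
            (by positivity)
    have h3 := (abs_sub ((1 - τ) ^ a) (p.eval τ)).trans (add_le_add h1 (hP τ hτ))
    have h4 : (1 + P) * 1 ≤ (1 + P) * ((2 : ℝ) ^ (max δ 0) * τ ^ δ) :=
      mul_le_mul_of_nonneg_left h2 (by positivity)
    have : 0 ≤ |C| * τ ^ δ := by positivity
    nlinarith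

/-- One statement for both parities: for odd `n` the information lies in the logarithmic
coefficient, for even `n` there is no logarithm and it lies in the coefficient of `τ^(n-1)`. In each
case it is a nonzero multiple of `(m)_(n-1)`. -/
theorem exists_logExpansion_integrand {n : ℕ} (hn : 2 < n) :
    ∃ w β : ℝ, (Odd n → β ≠ 0) ∧ (Even n → w ≠ 0 ∧ β = 0) ∧
    ∀ m : ℕ, ∃ p : Polynomial ℝ,
      LogExpansion (n - 1) (fun τ => (1 - τ) ^ ((m : ℝ) + n / 2 - 1) * S n m (1 - τ) ^ 2) p
        (β * (ascPochhammer ℝ (n - 1)).eval (m : ℝ)) ∧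
      (Even n → p.coeff (n - 1) = w * (ascPochhammer ℝ (n - 1)).eval (m : ℝ)) := by
  rcases Nat.even_or_odd n with he | ho
  · obtain ⟨p, hp2⟩ := he.two_dvd
    subst hp2
    have hp : 1 < p := by omega
    have hp0 : 0 < p := by omega
    set x : ℕ → ℝ := fun m =>
      coeffAtOne (2 * p - 1) (Polynomial.X ^ (m + p - 1) * sPoly p m ^ 2) with hx
    have hsp0 : sPoly p 0 = 1 := by
      ext k
      rw [coeff_sPoly hp0, Polynomial.coeff_one]
      split_ifs with h
      · rw [h, sCoeff_zero_zero]
      · exact sCoeff_zero_left _ h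
    have hx0 : x 0 = 0 := by
      simp only [hx, hsp0, one_pow, mul_one]
      exact coeffAtOne_eq_zero (by rw [Polynomial.natDegree_X_pow]; omega)
    have hxm := eq_mul_ascPochhammer_of_recurrence (by omega : 0 < 2 * p - 1) hx0
      (coeffAtOne_recurrence hp)
    refine ⟨x 1 / (2 * p - 1).factorial, 0, fun ho => absurd he (Nat.not_even_iff_odd.2 ho),
      fun _ => ⟨div_ne_zero (coeffAtOne_one_ne_zero hp) (by positivity), rfl⟩, fun m => ?_⟩
    refine ⟨(Polynomial.X ^ (m + p - 1) * sPoly p m ^ 2).comp (1 - Polynomial.X), ?_,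
      fun _ => (coeffAtOne_apply _ _).symm.trans (hxm m)⟩
    rw [zero_mul]
    convert LogExpansion.of_polynomial (2 * p - 1)
      ((Polynomial.X ^ (m + p - 1) * sPoly p m ^ 2).comp (1 - Polynomial.X)) using 2 with τ
    rw [Polynomial.eval_comp, S_eq_eval_sPoly hp0]
    simp only [Polynomial.eval_mul, Polynomial.eval_pow, Polynomial.eval_X, Polynomial.eval_sub,
      Polynomial.eval_one]
    rw [← Real.rpow_natCast (1 - τ)]
    congr 2
    push_cast [Nat.cast_sub (by omega : 1 ≤ m + p)]
    ring
  · obtain ⟨β, hβ, h⟩ := exists_logExpansion_S hn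
    refine ⟨0, 2 * β, fun _ => mul_ne_zero two_ne_zero (hβ ho),
      fun he => absurd he (Nat.not_even_iff_odd.2 ho), fun m => ?_⟩
    obtain ⟨p, hp0, hp⟩ := h m
    have hn' : (2 : ℝ) < n := by exact_mod_cast hn
    obtain ⟨q, hq0, hq⟩ := exists_logExpansion_one_sub_rpow (n - 1)
      (a := (m : ℝ) + n / 2 - 1) (by linarith [Nat.cast_nonneg (α := ℝ) m])
    refine ⟨q * (p * p), ?_, fun he => absurd he (Nat.not_even_iff_odd.2 ho)⟩
    -- All constant terms are `1`, so squaring `S_m` doubles its logarithmic coefficient and the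
    -- factor `(1-τ)^a` leaves it unchanged.
    have := hq.mul (by omega) (hp.mul (by omega) hp)
    convert this using 1
    · funext τ; rw [pow_two]
    · rw [hp0, hq0]; ring

/-! ### The Mellin transform of a function with a logarithmic expansion -/

/-- A function on `(0,1]`, extended by zero. -/
def unitCut (f : ℝ → ℂ) : ℝ → ℂ := Set.indicator (Set.Ioc 0 1) f

theorem mellin_unitCut (f : ℝ → ℂ) (s : ℂ) :
    mellin (unitCut f) (s + 1) = ∫ τ in (0 : ℝ)..1, f τ * (τ : ℂ) ^ s := by
  rw [intervalIntegral.integral_of_le zero_le_one, mellin, unitCut]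
  simp_rw [← Set.indicator_smul]
  rw [setIntegral_indicator measurableSet_Ioc, Set.inter_eq_self_of_subset_right
    Set.Ioc_subset_Ioi_self]
  simp only [add_sub_cancel_right, smul_eq_mul, mul_comm]

theorem isBigO_atTop_unitCut (f : ℝ → ℂ) (a : ℝ) :
    unitCut f =O[atTop] (fun x : ℝ => x ^ (-a)) := by
  have : unitCut f =ᶠ[atTop] fun _ => (0 : ℂ) := by
    filter_upwards [eventually_gt_atTop 1] with x hx
    exact Set.indicator_of_notMem (fun h => absurd h.2 (not_le.2 hx)) _
  exact this.trans_isBigO (Asymptotics.isBigO_zero _ _)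

theorem locallyIntegrableOn_unitCut {f : ℝ → ℂ} {C : ℝ} (hf : ContinuousOn f (Set.Ioc 0 1))
    (hC : ∀ τ ∈ Set.Ioo (0 : ℝ) 1, ‖f τ‖ ≤ C) :
    LocallyIntegrableOn (unitCut f) (Set.Ioi 0) := by
  refine (Integrable.locallyIntegrable ?_).locallyIntegrableOn _
  rw [unitCut, integrable_indicator_iff measurableSet_Ioc, integrableOn_Ioc_iff_integrableOn_Ioo]
  refine Integrable.of_bound
    ((hf.mono Set.Ioo_subset_Ioc_self).aestronglyMeasurable measurableSet_Ioo) C ?_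
  exact (ae_restrict_iff' measurableSet_Ioo).2 (Eventually.of_forall hC)

theorem isBigO_nhds_unitCut {f : ℝ → ℂ} {C δ : ℝ}
    (hC : ∀ τ ∈ Set.Ioo (0 : ℝ) 1, ‖f τ‖ ≤ C * τ ^ δ) :
    unitCut f =O[𝓝[>] 0] (fun x : ℝ => x ^ (-(-δ))) := by
  refine Asymptotics.IsBigO.of_bound C ?_
  filter_upwards [Ioo_mem_nhdsGT (zero_lt_one' ℝ)] with τ hτ
  rw [unitCut, Set.indicator_of_mem (Set.Ioo_subset_Ioc_self hτ), neg_neg, Real.norm_eq_abs,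
    abs_of_pos (Real.rpow_pos_of_pos hτ.1 δ)]
  exact hC τ hτ

/-- Differentiating a Mellin transform inserts a logarithm, and the transform of the indicator
function of `(0,1]` is `1/z`; the factor `τ^N` shifts the argument. -/
theorem hasMellin_unitCut_log (N : ℕ) {z : ℂ} (hz : -(N : ℝ) < z.re) :
    HasMellin (unitCut fun τ => (τ : ℂ) ^ N * Real.log τ) z (-1 / (z + N) ^ 2) := by
  have hz' : 0 < (z + N).re := by simp; linarith
  have hz0 : z + N ≠ 0 := by rintro h; rw [h] at hz'; simp at hz'
  have hb : ∀ τ ∈ Set.Ioo (0 : ℝ) 1, ‖(1 : ℂ)‖ ≤ 1 * τ ^ (0 : ℝ) := fun τ _ => by simp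
  obtain ⟨h1, h2⟩ := mellin_hasDerivAt_of_isBigO_rpow (a := (z + N).re + 1) (b := -0)
    (locallyIntegrableOn_unitCut (f := fun _ => (1 : ℂ)) (C := 1) continuousOn_const
      fun τ _ => by simp)
    (isBigO_atTop_unitCut _ _) (by linarith) (isBigO_nhds_unitCut hb) (by simpa using hz')
  have h3 : HasDerivAt (mellin (unitCut fun _ => (1 : ℂ))) (-1 / (z + N) ^ 2) (z + N) := by
    have h4 : (fun w : ℂ => w⁻¹) =ᶠ[𝓝 (z + N)] mellin (unitCut fun _ => (1 : ℂ)) := by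
      filter_upwards [(isOpen_lt continuous_const Complex.continuous_re).mem_nhds hz'] with w hw
      rw [← one_div]
      exact (hasMellin_one_Ioc hw).2.symm
    have h5 := hasDerivAt_inv hz0
    rw [show -1 / (z + N) ^ 2 = -((z + N) ^ 2)⁻¹ by rw [neg_div, one_div]]
    exact h5.congr_of_eventuallyEq h4.symm
  have e : (unitCut fun τ => (τ : ℂ) ^ N * Real.log τ) =
      fun t : ℝ => (t : ℂ) ^ (N : ℂ) • (Real.log t • unitCut (fun _ => (1 : ℂ)) t) := by
    funext t
    by_cases ht : t ∈ Set.Ioc (0 : ℝ) 1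
    · simp [unitCut, Set.indicator_of_mem ht]
    · simp [unitCut, Set.indicator_of_notMem ht]
  rw [HasMellin, e, MellinConvergent.cpow_smul, mellin_cpow_smul]
  exact ⟨h1, h2.unique h3⟩

theorem hasMellin_sum {ι : Type*} (s : Finset ι) {f : ι → ℝ → ℂ} {z : ℂ} {m : ι → ℂ}
    (h : ∀ i ∈ s, HasMellin (f i) z (m i)) :
    HasMellin (fun t => ∑ i ∈ s, f i t) z (∑ i ∈ s, m i) := by
  refine ⟨?_, ?_⟩
  · simp only [MellinConvergent, Finset.smul_sum]
    exact integrable_finsetSum _ fun i hi => (h i hi).1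
  · simp only [mellin, Finset.smul_sum]
    rw [integral_finsetSum _ fun i hi => (h i hi).1]
    exact Finset.sum_congr rfl fun i hi => (h i hi).2

theorem hasMellin_unitCut_polynomial (p : Polynomial ℝ) {z : ℂ} (hz : 0 < z.re) :
    HasMellin (unitCut fun τ => ((p.eval τ : ℝ) : ℂ)) z
      (∑ k ∈ Finset.range (p.natDegree + 1), (p.coeff k : ℂ) * (1 / (z + k))) := by
  have e : (unitCut fun τ => ((p.eval τ : ℝ) : ℂ)) = fun t : ℝ =>
      ∑ k ∈ Finset.range (p.natDegree + 1),
        (p.coeff k : ℂ) • Set.indicator (Set.Ioc 0 1) (fun t : ℝ => (t : ℂ) ^ (k : ℂ)) t := by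
    funext t
    by_cases ht : t ∈ Set.Ioc (0 : ℝ) 1
    · simp [unitCut, Set.indicator_of_mem ht, Polynomial.eval_eq_sum_range]
    · simp [unitCut, Set.indicator_of_notMem ht]
  rw [e]
  refine hasMellin_sum _ fun k _ => ?_
  have h := hasMellin_cpow_Ioc (k : ℂ) (s := z) (by simp; positivity)
  have h' := hasMellin_const_smul h.1 (p.coeff k : ℂ)
  rwa [h.2, smul_eq_mul] at h'

/-- The polynomial gives simple poles at `s = -k-1` and the logarithm a double pole at `s = -N-1`.
The remainder is `O(τ^δ)` for all `δ < N+1`, so its Mellin transform is holomorphic for `Re s >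
-N-2`. With `N = n-1` this is the half-plane `Re s > -n-1`. -/
theorem exists_continuation_of_logExpansion {N : ℕ} {f : ℝ → ℝ} {p : Polynomial ℝ} {β : ℝ}
    (hf : LogExpansion N f p β) (hc : ContinuousOn f (Set.Icc 0 1)) :
    ∃ H : ℂ → ℂ, (∀ s : ℂ, -(N : ℝ) - 2 < s.re → DifferentiableAt ℂ H s) ∧
      ∀ s : ℂ, -1 < s.re → ∫ τ in (0 : ℝ)..1, (f τ : ℂ) * (τ : ℂ) ^ s =
        ∑ k ∈ Finset.range (p.natDegree + 1), (p.coeff k : ℂ) * (1 / (s + k + 1)) -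
          β / (s + N + 1) ^ 2 + H s := by
  set R : ℝ → ℂ := fun τ => ((f τ - p.eval τ - β * (τ ^ N * Real.log τ) : ℝ) : ℂ) with hR
  have hRc : ContinuousOn R (Set.Ioc 0 1) := by
    refine Complex.continuous_ofReal.comp_continuousOn ?_
    refine ((hc.mono Set.Ioc_subset_Icc_self).sub p.continuous.continuousOn).sub
      (continuousOn_const.mul ((continuous_pow N).continuousOn.mul ?_))
    exact Real.continuousOn_log.mono fun x hx => hx.1.ne'
  have hRb : ∀ δ : ℝ, δ < N + 1 → ∃ C, ∀ τ ∈ Set.Ioo (0 : ℝ) 1, ‖R τ‖ ≤ C * τ ^ δ := by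
    intro δ hδ
    obtain ⟨C, hC⟩ := hf δ hδ
    exact ⟨C, fun τ hτ => by rw [hR, Complex.norm_real]; exact hC τ hτ⟩
  obtain ⟨C0, hC0⟩ := hRb 0 (by positivity)
  have hloc := locallyIntegrableOn_unitCut hRc (fun τ hτ => by simpa using hC0 τ hτ)
  refine ⟨fun s => mellin (unitCut R) (s + 1), fun s hs => ?_, fun s hs => ?_⟩
  · obtain ⟨δ, hδ1, hδ2⟩ := exists_between (show -(s + 1).re < (N : ℝ) + 1 by simp; linarith)
    obtain ⟨C, hC⟩ := hRb δ hδ2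
    have := mellin_differentiableAt_of_isBigO_rpow (s := s + 1) hloc
      (isBigO_atTop_unitCut R ((s + 1).re + 1)) (by linarith) (isBigO_nhds_unitCut hC)
      (by linarith)
    exact DifferentiableAt.comp (f := fun s : ℂ => s + 1) s this (differentiableAt_id.add_const 1)
  · have hz : 0 < (s + 1).re := by simp; linarith
    have h1 := hasMellin_unitCut_polynomial p hz
    have h2 := hasMellin_unitCut_log N (z := s + 1)
      (by linarith [Nat.cast_nonneg (α := ℝ) N])
    have h3 : MellinConvergent (unitCut R) (s + 1) :=
      mellinConvergent_of_isBigO_rpow hloc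
        (isBigO_atTop_unitCut R ((s + 1).re + 1)) (by linarith) (isBigO_nhds_unitCut hC0)
        (by simpa using hz)
    have h4 := hasMellin_const_smul h2.1 (β : ℂ)
    have h5 := hasMellin_add h1.1 h4.1
    have h6 := hasMellin_add h5.1 h3
    rw [h5.2, h4.2, h1.2, h2.2] at h6
    rw [← mellin_unitCut]
    have e : (unitCut fun τ => (f τ : ℂ)) = fun t => ((unitCut fun τ => ((p.eval τ : ℝ) : ℂ)) t +
        (β : ℂ) • (unitCut fun τ => (τ : ℂ) ^ N * Real.log τ) t) + unitCut R t := by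
      funext t
      by_cases ht : t ∈ Set.Ioc (0 : ℝ) 1
      · simp only [unitCut, Set.indicator_of_mem ht, hR, smul_eq_mul]
        push_cast
        ring
      · simp [unitCut, Set.indicator_of_notMem ht]
    rw [e, h6.2]
    congr 1
    rw [sub_eq_add_neg]
    congr 1
    · refine Finset.sum_congr rfl fun k _ => ?_
      rw [add_right_comm]
    · rw [smul_eq_mul, add_right_comm s 1]
      ring

/-! ### Residues of the Gamma function -/

theorem tendsto_add_mul_Gamma (N : ℕ) :
    Tendsto (fun s : ℂ => (s + N) * Complex.Gamma s) (𝓝[≠] (-(N : ℂ)))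
      (𝓝 ((-1) ^ N / N.factorial)) := by
  induction N with
  | zero => simpa using Complex.tendsto_self_mul_Gamma_nhds_zero
  | succ N ih =>
    have h1 : Tendsto (fun s : ℂ => s + 1) (𝓝[≠] (-((N + 1 : ℕ) : ℂ))) (𝓝[≠] (-(N : ℂ))) := by
      refine tendsto_nhdsWithin_iff.2 ⟨?_, ?_⟩
      · have : Tendsto (fun s : ℂ => s + 1) (𝓝 (-((N + 1 : ℕ) : ℂ)))
            (𝓝 (-((N + 1 : ℕ) : ℂ) + 1)) := (continuous_add_const 1).tendsto _
        rw [show -((N + 1 : ℕ) : ℂ) + 1 = -(N : ℂ) by push_cast; ring] at this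
        exact this.mono_left nhdsWithin_le_nhds
      · filter_upwards [self_mem_nhdsWithin] with s hs h
        refine hs ?_
        simp only [Set.mem_singleton_iff] at h ⊢
        rw [eq_sub_of_add_eq h]; push_cast; ring
    have h2 := ih.comp h1
    have hne : -((N + 1 : ℕ) : ℂ) ≠ 0 := neg_ne_zero.2 (Nat.cast_ne_zero.2 (Nat.succ_ne_zero N))
    have h3 : Tendsto (fun s : ℂ => s⁻¹) (𝓝[≠] (-((N + 1 : ℕ) : ℂ)))
        (𝓝 (-((N + 1 : ℕ) : ℂ))⁻¹) := (continuousAt_inv₀ hne).tendsto.mono_left nhdsWithin_le_nhds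
    have h4 := h2.mul h3
    have e : (-1 : ℂ) ^ N / N.factorial * (-((N + 1 : ℕ) : ℂ))⁻¹ =
        (-1) ^ (N + 1) / ((N + 1).factorial : ℕ) := by
      have : ((N.factorial : ℕ) : ℂ) ≠ 0 := Nat.cast_ne_zero.2 N.factorial_ne_zero
      rw [Nat.factorial_succ, pow_succ]
      have : (N : ℂ) + 1 ≠ 0 := Nat.cast_add_one_ne_zero N
      push_cast
      rw [← neg_inv]
      field_simp
    rw [e] at h4
    refine h4.congr' ?_
    have h0 : ∀ᶠ s : ℂ in 𝓝[≠] (-((N + 1 : ℕ) : ℂ)), s ≠ 0 :=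
      (continuousAt_id.eventually_ne hne).filter_mono nhdsWithin_le_nhds
    filter_upwards [h0] with s hs
    simp only [Function.comp]
    rw [Complex.Gamma_add_one s hs]
    push_cast
    field_simp
    ring

theorem tendsto_mul_sum_div (p : Polynomial ℝ) (N : ℕ) :
    Tendsto (fun s : ℂ => (s + N + 1) *
      ∑ k ∈ Finset.range (p.natDegree + 1), (p.coeff k : ℂ) * (1 / (s + k + 1)))
      (𝓝[≠] (-((N : ℂ) + 1))) (𝓝 (p.coeff N)) := by
  have h0 : Tendsto (fun s : ℂ => s + N + 1) (𝓝[≠] (-((N : ℂ) + 1))) (𝓝 0) := by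
    have : Tendsto (fun s : ℂ => s + N + 1) (𝓝 (-((N : ℂ) + 1)))
        (𝓝 (-((N : ℂ) + 1) + N + 1)) := by
      exact Continuous.tendsto (by fun_prop) _
    rw [show -((N : ℂ) + 1) + N + 1 = 0 by ring] at this
    exact this.mono_left nhdsWithin_le_nhds
  have h : ∀ k ∈ Finset.range (p.natDegree + 1), Tendsto (fun s : ℂ => (s + N + 1) *
      ((p.coeff k : ℂ) * (1 / (s + k + 1)))) (𝓝[≠] (-((N : ℂ) + 1)))
      (𝓝 (if N = k then (p.coeff k : ℂ) else 0)) := by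
    intro k _
    split_ifs with hk
    · subst hk
      refine tendsto_const_nhds.congr' ?_
      filter_upwards [self_mem_nhdsWithin] with s hs
      have : s + N + 1 ≠ 0 := fun h => hs (by
        rw [Set.mem_singleton_iff]; linear_combination h)
      field_simp
    · have h1 : Tendsto (fun s : ℂ => (p.coeff k : ℂ) * (1 / (s + k + 1)))
          (𝓝[≠] (-((N : ℂ) + 1))) (𝓝 ((p.coeff k : ℂ) * (1 / (-((N : ℂ) + 1) + k + 1)))) := by
        refine Tendsto.mono_left (ContinuousAt.tendsto ?_) nhdsWithin_le_nhds
        have : -((N : ℂ) + 1) + k + 1 ≠ 0 := by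
          intro h
          apply hk
          have : (N : ℂ) = k := by linear_combination -h
          exact_mod_cast this
        fun_prop (disch := assumption)
      simpa using h0.mul h1
  have h2 := tendsto_finsetSum _ h
  simp only [← Finset.mul_sum] at h2
  rw [Finset.sum_ite_eq] at h2
  convert h2 using 2
  split_ifs with hN
  · rfl
  · rw [Polynomial.coeff_eq_zero_of_natDegree_lt (by simpa using hN)]; simp

/-! ### The residue coefficients -/

theorem meromorphicOn_Gamma_add (c : ℂ) (U : Set ℂ) :
    MeromorphicOn (fun s => Complex.Gamma (s + c)) U := fun s _ =>
  MeromorphicAt.comp_analyticAt (f := Complex.Gamma) (g := fun s => s + c)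
    (Meromorphic.Gamma _) (by fun_prop)

theorem tendsto_add_nhdsNE (a b c : ℂ) (h : a + b = c) :
    Tendsto (fun s : ℂ => s + b) (𝓝[≠] a) (𝓝[≠] c) := by
  subst h
  refine tendsto_nhdsWithin_iff.2
    ⟨((continuous_add_const b).tendsto a).mono_left nhdsWithin_le_nhds, ?_⟩
  filter_upwards [self_mem_nhdsWithin] with s hs h
  exact hs (add_right_cancel h)

theorem bergmanCoeff_eq {n : ℕ} (m : ℕ) {s : ℂ} :
    bergmanCoeff n m s = Complex.Gamma ((n : ℂ) / 2 + s + 1) /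
      (Complex.Gamma ((n : ℂ) / 2) * Complex.Gamma (s + 1)) *
      ∫ τ in (0 : ℝ)..1, (((1 - τ) ^ ((m : ℝ) + n / 2 - 1) * S n m (1 - τ) ^ 2 : ℝ) : ℂ) *
        (τ : ℂ) ^ s := by
  rw [bergmanCoeff]
  congr 1
  have := intervalIntegral.integral_comp_sub_left (a := 0) (b := 1)
    (fun t : ℝ => ((t ^ ((m : ℝ) + (n : ℝ) / 2 - 1) : ℝ) : ℂ) *
      ((1 - t : ℝ) : ℂ) ^ s * ((S n m t : ℝ) : ℂ) ^ 2) 1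
  rw [sub_self, sub_zero] at this
  rw [← this]
  refine intervalIntegral.integral_congr fun τ _ => ?_
  simp only [sub_sub_cancel]
  push_cast
  ring

/-- At `s = -n` the factor `1/Γ(s+1)` has a simple zero. For even `n` it is cancelled by the simple
pole of `Γ(n/2+s+1)`, and the simple pole of the integral remains. For odd `n` the numerator is
finite and nonzero, and the zero reduces the double pole coming from the logarithm to a simple one.
-/
theorem exists_isResidueCoeff {n : ℕ} (hn : 2 < n) : ∃ K : ℝ, K ≠ 0 ∧
    ∀ m : ℕ, IsResidueCoeff n m (K * (ascPochhammer ℝ (n - 1)).eval (m : ℝ)) := by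
  have hn' : (2 : ℝ) < n := by exact_mod_cast hn
  obtain ⟨w, β, hβ, hw, h⟩ := exists_logExpansion_integrand hn
  have hn1 : ((n - 1 : ℕ) : ℂ) = n - 1 := by push_cast [Nat.cast_sub (by omega : 1 ≤ n)]; ring
  have hn1' : ((n - 1 : ℕ) : ℝ) = n - 1 := by push_cast [Nat.cast_sub (by omega : 1 ≤ n)]; ring
  -- the factor `1 / ((s+n) Γ(s+1))`
  set r : ℂ := ((-1) ^ (n - 1) / (n - 1).factorial)⁻¹ with hr
  have hr1 : Tendsto (fun s : ℂ => ((s + n) * Complex.Gamma (s + 1))⁻¹) (𝓝[≠] (-(n : ℂ)))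
      (𝓝 r) := by
    have h1 := (tendsto_add_mul_Gamma (n - 1)).comp (tendsto_add_nhdsNE (-(n : ℂ)) 1
      (-((n - 1 : ℕ) : ℂ)) (by rw [hn1]; ring))
    refine (h1.inv₀ (div_ne_zero (pow_ne_zero _ (by norm_num)) (Nat.cast_ne_zero.2
      (Nat.factorial_ne_zero _)))).congr fun s => ?_
    simp only [Function.comp]
    rw [hn1]; congr 2; ring
  set J : ℕ → (ℂ → ℂ) → Polynomial ℝ → ℝ → ℂ → ℂ := fun m H p b s =>
    Complex.Gamma ((n : ℂ) / 2 + s + 1) /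
      (Complex.Gamma ((n : ℂ) / 2) * Complex.Gamma (s + 1)) *
    (∑ k ∈ Finset.range (p.natDegree + 1), (p.coeff k : ℂ) * (1 / (s + k + 1)) -
          b / (s + (n - 1 : ℕ) + 1) ^ 2 + H s) with hJ
  have hcont : ∀ m : ℕ, ∃ (H : ℂ → ℂ) (p : Polynomial ℝ),
      (Even n → p.coeff (n - 1) = w * (ascPochhammer ℝ (n - 1)).eval (m : ℝ)) ∧
      (∀ s : ℂ, -((n - 1 : ℕ) : ℝ) - 2 < s.re → DifferentiableAt ℂ H s) ∧
      IsContinuation n m (J m H p (β * (ascPochhammer ℝ (n - 1)).eval (m : ℝ))) := by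
    intro m
    obtain ⟨p, hp, hpe⟩ := h m
    have hcf : ContinuousOn (fun τ : ℝ => (1 - τ) ^ ((m : ℝ) + n / 2 - 1) * S n m (1 - τ) ^ 2)
        (Set.Icc 0 1) := by
      refine ContinuousOn.mul ?_ (ContinuousOn.pow ?_ 2)
      · refine ContinuousOn.rpow_const (by fun_prop) fun τ _ => Or.inr ?_
        linarith [Nat.cast_nonneg (α := ℝ) m]
      · refine (continuousOn_S hn m).comp (by fun_prop) fun τ hτ => ?_
        constructor <;> linarith [hτ.1, hτ.2]
    obtain ⟨H, hH, hHe⟩ := exists_continuation_of_logExpansion hp hcf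
    refine ⟨H, p, hpe, hH, ?_, fun s hs => ?_⟩
    · have hHm : MeromorphicOn H {s : ℂ | -(n : ℝ) - 1 < s.re} := by
        have : AnalyticOnNhd ℂ H {s : ℂ | -(n : ℝ) - 1 < s.re} :=
          DifferentiableOn.analyticOnNhd (fun s hs => (hH s (by
            rw [hn1']; simp only [Set.mem_ofPred_eq] at hs; linarith)).differentiableWithinAt)
            (isOpen_lt continuous_const Complex.continuous_re)
        exact this.meromorphicOn
      have hid : MeromorphicOn (fun s : ℂ => s) {s : ℂ | -(n : ℝ) - 1 < s.re} :=
        analyticOnNhd_id.meromorphicOn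
      have hcst : ∀ c : ℂ, MeromorphicOn (fun _ : ℂ => c) {s : ℂ | -(n : ℝ) - 1 < s.re} :=
        fun c => analyticOnNhd_const.meromorphicOn
      refine MeromorphicOn.mul (MeromorphicOn.div ?_ (MeromorphicOn.mul (hcst _)
        (meromorphicOn_Gamma_add 1 _))) (MeromorphicOn.add (MeromorphicOn.sub ?_ ?_) hHm)
      · have : (fun s : ℂ => Complex.Gamma ((n : ℂ) / 2 + s + 1)) =
            fun s => Complex.Gamma (s + ((n : ℂ) / 2 + 1)) := by
          funext s; congr 1; ring
        rw [this]
        exact meromorphicOn_Gamma_add _ _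
      · intro s hs
        refine MeromorphicAt.fun_sum fun k _ => ?_
        exact (hcst _ s hs).mul ((hcst 1 s hs).div (((hid s hs).add (hcst _ s hs)).add
          (hcst _ s hs)))
      · exact (hcst _).div (((hid.add (hcst _)).add (hcst 1)).pow 2)
    · rw [bergmanCoeff_eq, hHe s hs]
  have hΓ : Complex.Gamma ((n : ℂ) / 2) = (Real.Gamma ((n : ℝ) / 2) : ℂ) := by
    rw [← Complex.Gamma_ofReal]; push_cast; rfl
  have hΓ0 : Real.Gamma ((n : ℝ) / 2) ≠ 0 := (Real.Gamma_pos_of_pos (by positivity)).ne'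
  have hz : Tendsto (fun s : ℂ => s + n) (𝓝[≠] (-(n : ℂ))) (𝓝 0) :=
    (tendsto_add_nhdsNE (-(n : ℂ)) n 0 (by ring)).mono_right nhdsWithin_le_nhds
  have hΦ : ∀ (H : ℂ → ℂ) (p : Polynomial ℝ),
      (∀ s : ℂ, -((n - 1 : ℕ) : ℝ) - 2 < s.re → DifferentiableAt ℂ H s) →
      Tendsto (fun s : ℂ => (s + n) * (∑ k ∈ Finset.range (p.natDegree + 1),
        (p.coeff k : ℂ) * (1 / (s + k + 1)) + H s)) (𝓝[≠] (-(n : ℂ)))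
        (𝓝 (p.coeff (n - 1))) := by
    intro H p hH
    have h1 := tendsto_mul_sum_div p (n - 1)
    rw [hn1, sub_add_cancel] at h1
    have h2 : Tendsto H (𝓝[≠] (-(n : ℂ))) (𝓝 (H (-(n : ℂ)))) :=
      (hH (-(n : ℂ)) (by rw [hn1']; simp; linarith)).continuousAt.tendsto.mono_left
        nhdsWithin_le_nhds
    have h3 := h1.add (hz.mul h2)
    rw [zero_mul, add_zero] at h3
    refine h3.congr fun s => ?_
    ring
  have hrr : r = (((-1) ^ (n - 1) * (n - 1).factorial : ℝ) : ℂ) := by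
    rw [hr, inv_div]
    push_cast
    rcases neg_one_pow_eq_or ℂ (n - 1) with h | h <;> rw [h] <;> simp [div_neg]
  have hfac : ((n - 1).factorial : ℝ) ≠ 0 := by positivity
  rcases Nat.even_or_odd n with he | ho
  · obtain ⟨hw0, hβ0⟩ := hw he
    obtain ⟨q, hq⟩ := he.two_dvd
    have hnq : (n : ℂ) / 2 = q := by rw [hq]; push_cast; ring
    have hq1 : ((q - 1 : ℕ) : ℂ) = q - 1 := by push_cast [Nat.cast_sub (by omega : 1 ≤ q)]; ring
    have hnum : Tendsto (fun s : ℂ => (s + n) * Complex.Gamma ((n : ℂ) / 2 + s + 1))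
        (𝓝[≠] (-(n : ℂ))) (𝓝 ((-1) ^ (q - 1) / (q - 1).factorial)) := by
      have hnq2 : (n : ℂ) = 2 * q := by rw [hq]; push_cast; ring
      have h1 := (tendsto_add_mul_Gamma (q - 1)).comp (tendsto_add_nhdsNE (-(n : ℂ))
        ((n : ℂ) / 2 + 1) (-((q - 1 : ℕ) : ℂ)) (by rw [hq1, hnq, hnq2]; ring))
      refine h1.congr fun s => ?_
      simp only [Function.comp]
      rw [hq1, hnq, hnq2]
      congr 1
      · ring
      · congr 1; ring
    refine ⟨(-1) ^ (q - 1) / (q - 1).factorial / Real.Gamma ((n : ℝ) / 2) *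
      ((-1) ^ (n - 1) * (n - 1).factorial) * w, ?_, fun m => ?_⟩
    · refine mul_ne_zero (mul_ne_zero (div_ne_zero (div_ne_zero ?_ (by positivity)) hΓ0)
        (mul_ne_zero ?_ hfac)) hw0 <;> exact pow_ne_zero _ (by norm_num)
    · obtain ⟨H, p, hpe, hH, hJc⟩ := hcont m
      refine ⟨_, hJc, ?_⟩
      have h1 := ((hnum.div_const (Complex.Gamma ((n : ℂ) / 2))).mul hr1).mul (hΦ H p hH)
      have e : (((-1) ^ (q - 1) / (q - 1).factorial / Real.Gamma ((n : ℝ) / 2) *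
          ((-1) ^ (n - 1) * (n - 1).factorial) * w *
          (ascPochhammer ℝ (n - 1)).eval (m : ℝ) : ℝ) : ℂ) =
          (-1) ^ (q - 1) / (q - 1).factorial / Complex.Gamma ((n : ℂ) / 2) * r *
          (p.coeff (n - 1) : ℝ) := by
        rw [hpe he, hΓ, hrr]; push_cast; ring
      rw [e]
      refine h1.congr' ?_
      filter_upwards [self_mem_nhdsWithin] with s hs
      have hs' : s + n ≠ 0 := fun h => hs (eq_neg_of_add_eq_zero_left h)
      simp only [hJ, hβ0, zero_mul, Complex.ofReal_zero, zero_div, sub_zero]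
      field_simp
  · have hnum : Tendsto (fun s : ℂ => Complex.Gamma ((n : ℂ) / 2 + s + 1))
        (𝓝[≠] (-(n : ℂ))) (𝓝 (Real.Gamma (1 - (n : ℝ) / 2) : ℂ)) := by
      have hne : ∀ k : ℕ, (1 - (n : ℂ) / 2) ≠ -k := by
        intro k hk
        have : (n : ℂ) = (2 * (k + 1) : ℕ) := by push_cast; linear_combination -2 * hk
        have h2 : n = 2 * (k + 1) := by exact_mod_cast this
        rw [h2] at ho
        exact (Nat.not_odd_iff_even.2 (even_two_mul _)) ho
      rw [← Complex.Gamma_ofReal]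
      have e : ((1 - (n : ℝ) / 2 : ℝ) : ℂ) = 1 - (n : ℂ) / 2 := by push_cast; rfl
      rw [e]
      have h1 : Tendsto (fun s : ℂ => s + ((n : ℂ) / 2 + 1)) (𝓝[≠] (-(n : ℂ)))
          (𝓝 (1 - (n : ℂ) / 2)) :=
        (tendsto_add_nhdsNE _ _ _ (by ring)).mono_right nhdsWithin_le_nhds
      refine ((Complex.differentiableAt_Gamma _ hne).continuousAt.tendsto.comp h1).congr
        fun s => ?_
      simp only [Function.comp]
      congr 1; ring
    have hneR : ∀ k : ℕ, (1 - (n : ℝ) / 2) ≠ -k := by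
      intro k hk
      have : (n : ℝ) = (2 * (k + 1) : ℕ) := by push_cast; linarith
      have h2 : n = 2 * (k + 1) := by exact_mod_cast this
      rw [h2] at ho
      exact (Nat.not_odd_iff_even.2 (even_two_mul _)) ho
    refine ⟨Real.Gamma (1 - (n : ℝ) / 2) / Real.Gamma ((n : ℝ) / 2) *
      ((-1) ^ (n - 1) * (n - 1).factorial) * (-β), ?_, fun m => ?_⟩
    · exact mul_ne_zero (mul_ne_zero (div_ne_zero (Real.Gamma_ne_zero hneR) hΓ0)
        (mul_ne_zero (pow_ne_zero _ (by norm_num)) hfac)) (neg_ne_zero.2 (hβ ho))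
    · obtain ⟨H, p, -, hH, hJc⟩ := hcont m
      refine ⟨_, hJc, ?_⟩
      set b := β * (ascPochhammer ℝ (n - 1)).eval (m : ℝ) with hb
      -- Against a double pole all simple poles disappear in the limit, so the coefficients of `p`
      -- do not matter.
      have h2 : Tendsto (fun s : ℂ => (s + n) * ((s + n) * (∑ k ∈ Finset.range (p.natDegree + 1),
        (p.coeff k : ℂ) * (1 / (s + k + 1)) + H s)) - b) (𝓝[≠] (-(n : ℂ)))
          (𝓝 (0 * (p.coeff (n - 1)) - b)) := (hz.mul (hΦ H p hH)).sub_const _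
      have h1 := ((hnum.div_const (Complex.Gamma ((n : ℂ) / 2))).mul hr1).mul h2
      have e : ((Real.Gamma (1 - (n : ℝ) / 2) / Real.Gamma ((n : ℝ) / 2) *
          ((-1) ^ (n - 1) * (n - 1).factorial) * (-β) *
          (ascPochhammer ℝ (n - 1)).eval (m : ℝ) : ℝ) : ℂ) =
          Real.Gamma (1 - (n : ℝ) / 2) / Complex.Gamma ((n : ℂ) / 2) * r *
          (0 * (p.coeff (n - 1)) - b) := by
        rw [hΓ, hrr, hb]; push_cast; ring
      rw [e]
      refine h1.congr' ?_
      filter_upwards [self_mem_nhdsWithin] with s hs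
      have hs' : s + n ≠ 0 := fun h => hs (eq_neg_of_add_eq_zero_left h)
      have hs2 : s + (n - 1 : ℕ) + 1 = s + n := by rw [hn1]; ring
      simp only [hJ, hs2]
      field_simp
      ring

/-- The identity theorem for meromorphic functions: two continuations agree near `0`, and the
half-plane is connected, so their difference has infinite order at `-n` as well. -/
theorem isResidueCoeff_unique {n m : ℕ} {c d : ℝ} (hc : IsResidueCoeff n m c)
    (hd : IsResidueCoeff n m d) : c = d := by
  obtain ⟨J, ⟨hJ, hJe⟩, hJt⟩ := hc
  obtain ⟨K, ⟨hK, hKe⟩, hKt⟩ := hd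
  have hU : IsConnected {s : ℂ | -(n : ℝ) - 1 < s.re} :=
    ⟨⟨0, by simp only [Set.mem_ofPred_eq, Complex.zero_re]; linarith [Nat.cast_nonneg (α := ℝ) n]⟩,
      (convex_halfSpace_re_gt _).isPreconnected⟩
  have hmem : -(n : ℂ) ∈ {s : ℂ | -(n : ℝ) - 1 < s.re} := by simp
  have hmem0 : (0 : ℂ) ∈ {s : ℂ | -(n : ℝ) - 1 < s.re} := by
    simp only [Set.mem_ofPred_eq, Complex.zero_re]; linarith [Nat.cast_nonneg (α := ℝ) n]
  have hD := hJ.sub hK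
  have htop0 : meromorphicOrderAt (J - K) 0 = ⊤ := by
    rw [meromorphicOrderAt_eq_top_iff]
    refine Eventually.filter_mono nhdsWithin_le_nhds ?_
    filter_upwards [(isOpen_lt continuous_const Complex.continuous_re).mem_nhds
      (show (-1 : ℝ) < (0 : ℂ).re by simp)] with s hs
    simp [hJe s hs, hKe s hs]
  have htop : meromorphicOrderAt (J - K) (-(n : ℂ)) = ⊤ := by
    by_contra h
    exact (hD.meromorphicOrderAt_ne_top_of_isPreconnected hU.isPreconnected hmem hmem0 h) htop0
  rw [meromorphicOrderAt_eq_top_iff] at htop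
  have h1 : Tendsto (fun s : ℂ => (s + n) * J s) (𝓝[≠] (-(n : ℂ))) (𝓝 (d : ℂ)) := by
    refine hKt.congr' ?_
    filter_upwards [htop] with s hs
    rw [sub_eq_zero.1 (by simpa using hs : J s - K s = 0)]
  exact_mod_cast tendsto_nhds_unique hJt h1

theorem isResidueCoeff_Icirc {n : ℕ} (hn : 2 < n) (m : ℕ) : IsResidueCoeff n m (Icirc n m) := by
  obtain ⟨K, -, hK⟩ := exists_isResidueCoeff hn
  have h : ∃ c : ℝ, IsResidueCoeff n m c := ⟨_, hK m⟩
  rw [Icirc, dif_pos h]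
  exact h.choose_spec

/-- The only fact about the analytic continuation that enters the proof of invariance. -/
theorem exists_Icirc_eq {n : ℕ} (hn : 2 < n) : ∃ K : ℝ, K ≠ 0 ∧
    ∀ m : ℕ, Icirc n m = K * (ascPochhammer ℝ (n - 1)).eval (m : ℝ) := by
  obtain ⟨K, hK0, hK⟩ := exists_isResidueCoeff hn
  exact ⟨K, hK0, fun m => isResidueCoeff_unique (isResidueCoeff_Icirc hn m) (hK m)⟩

/-! ### The surface measure of the sphere -/

/-- The unit sphere of `ℝⁿ`, as a type. -/
abbrev Sph (n : ℕ) := sphere (0 : E n) 1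

theorem norm_coe_sph {n : ℕ} (ζ : Sph n) : ‖(ζ : E n)‖ = 1 := mem_sphere_zero_iff_norm.1 ζ.2

theorem isProbabilityMeasure_sphereMeasure {n : ℕ} (hn : 0 < n) :
    IsProbabilityMeasure (sphereMeasure n) := by
  have : Nonempty (Fin n) := ⟨⟨0, hn⟩⟩
  have : Nontrivial (E n) := inferInstance
  refine ⟨?_⟩
  rw [sphereMeasure, Measure.smul_apply, smul_eq_mul]
  refine ENNReal.inv_mul_cancel ?_ (measure_ne_top _ _)
  rw [Ne, Measure.measure_univ_eq_zero]
  exact Measure.toSphere_ne_zero _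

instance {n : ℕ} : IsFiniteMeasure (sphereMeasure n) := by
  rcases Nat.eq_zero_or_pos n with rfl | hn
  · have : (volume : Measure (E 0)).toSphere = 0 := by
      rw [Measure.toSphere_eq_zero_iff]; infer_instance
    rw [sphereMeasure, this, smul_zero]
    infer_instance
  · have := isProbabilityMeasure_sphereMeasure hn
    infer_instance

/-- The homeomorphism of the sphere defined by an orthogonal transformation. -/
def sphOrthogonal {n : ℕ} (U : E n ≃ₗᵢ[ℝ] E n) : Sph n ≃ₜ Sph n where
  toFun ζ := ⟨U ζ, by rw [mem_sphere_zero_iff_norm, U.norm_map, norm_coe_sph]⟩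
  invFun ζ := ⟨U.symm ζ, by rw [mem_sphere_zero_iff_norm, U.symm.norm_map, norm_coe_sph]⟩
  left_inv ζ := Subtype.ext (U.symm_apply_apply _)
  right_inv ζ := Subtype.ext (U.apply_symm_apply _)
  continuous_toFun := by fun_prop
  continuous_invFun := by fun_prop

-- The surface measure of a set is defined through the volume of the cone over it, and `U` preserves
-- volume and maps cones to cones.
open scoped Pointwise in
theorem measurePreserving_sphOrthogonal {n : ℕ} (U : E n ≃ₗᵢ[ℝ] E n) :
    MeasurePreserving (sphOrthogonal U) (sphereMeasure n) (sphereMeasure n) := by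
  refine ⟨(sphOrthogonal U).continuous.measurable, ?_⟩
  rw [sphereMeasure, Measure.map_smul]
  congr 1
  refine Measure.ext fun s hs => ?_
  rw [Measure.map_apply (sphOrthogonal U).continuous.measurable hs, Measure.toSphere_apply' _ hs,
    Measure.toSphere_apply' _ ((sphOrthogonal U).continuous.measurable hs)]
  congr 1
  have h : Set.Ioo (0 : ℝ) 1 • ((↑) '' (sphOrthogonal U ⁻¹' s) : Set (E n)) =
      U ⁻¹' (Set.Ioo (0 : ℝ) 1 • ((↑) '' s : Set (E n))) := by
    ext x
    simp only [Set.mem_smul, Set.mem_image, Set.mem_preimage]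
    constructor
    · rintro ⟨r, hr, _, ⟨ζ, hζ, rfl⟩, rfl⟩
      exact ⟨r, hr, _, ⟨_, hζ, rfl⟩, by rw [map_smul]; rfl⟩
    · rintro ⟨r, hr, _, ⟨ζ, hζ, rfl⟩, h⟩
      refine ⟨r, hr, _, ⟨(sphOrthogonal U).symm ζ, ?_, rfl⟩, ?_⟩
      · rwa [Homeomorph.apply_symm_apply]
      · change r • U.symm (ζ : E n) = x
        rw [← map_smul, h, U.symm_apply_apply]
  rw [h]
  exact U.measurePreserving.measure_preimage_emb U.toHomeomorph.measurableEmbedding _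

-- The cone over a point lies in a line, a null set when `n > 1`. This makes the diagonal, where the
-- logarithmic kernel is singular, negligible.
open scoped Pointwise in
theorem nullSingletonClass_sphereMeasure {n : ℕ} (hn : 1 < n) :
    NullSingletonClass (sphereMeasure n) := by
  refine ⟨fun ζ => ?_⟩
  rw [sphereMeasure, Measure.smul_apply, Measure.toSphere_apply' _ (measurableSet_singleton ζ)]
  have h : Set.Ioo (0 : ℝ) 1 • ((↑) '' ({ζ} : Set (Sph n)) : Set (E n)) ⊆
      (Submodule.span ℝ {(ζ : E n)} : Set (E n)) := by
    intro x hx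
    simp only [Set.mem_smul, Set.image_singleton, Set.mem_singleton_iff] at hx
    obtain ⟨r, -, _, rfl, rfl⟩ := hx
    exact Submodule.smul_mem _ _ (Submodule.mem_span_singleton_self _)
  have h0 : volume (Submodule.span ℝ {(ζ : E n)} : Set (E n)) = 0 := by
    refine Measure.addHaar_submodule _ _ fun htop => ?_
    have h1 := finrank_span_singleton (K := ℝ) (v := (ζ : E n)) (by
      intro h
      have := norm_coe_sph ζ
      rw [h, norm_zero] at this
      exact zero_ne_one this)
    rw [htop, finrank_top, finrank_euclideanSpace_fin] at h1
    omega
  rw [measure_mono_null h h0]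
  simp

/-! ### Second derivatives along lines -/

section Lines

variable {n : ℕ} {F : Type*} [NormedAddCommGroup F] [NormedSpace ℝ F]

theorem laplacian_eq_sum_fderiv (f : E n → F) (x : E n) :
    Laplacian.laplacian f x = ∑ i, fderiv ℝ (fderiv ℝ f) x
      (EuclideanSpace.basisFun (Fin n) ℝ i) (EuclideanSpace.basisFun (Fin n) ℝ i) := by
  rw [InnerProductSpace.laplacian_eq_iteratedFDeriv_orthonormalBasis f
    (EuclideanSpace.basisFun (Fin n) ℝ)]
  simp only [iteratedFDeriv_two_apply]
  rfl

theorem hasDerivAt_line {f : E n → F} {x v : E n} {t : ℝ}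
    (hf : DifferentiableAt ℝ f (x + t • v)) :
    HasDerivAt (fun t : ℝ => f (x + t • v)) (fderiv ℝ f (x + t • v) v) t := by
  have h : HasDerivAt (fun t : ℝ => x + t • v) v t := by
    simpa using ((hasDerivAt_id t).smul_const v).const_add x
  exact hf.hasFDerivAt.comp_hasDerivAt t h

theorem eventually_line {p : E n → Prop} {x v : E n} (h : ∀ᶠ y in 𝓝 x, p y) :
    ∀ᶠ t : ℝ in 𝓝 0, p (x + t • v) := by
  have : Tendsto (fun t : ℝ => x + t • v) (𝓝 0) (𝓝 (x + (0 : ℝ) • v)) :=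
    Continuous.tendsto (by fun_prop) _
  rw [zero_smul, add_zero] at this
  exact this.eventually h

theorem hasDerivAt_line_deriv {f : E n → F} {x v : E n} (hf : ContDiffAt ℝ 2 f x) :
    HasDerivAt (fun t : ℝ => fderiv ℝ f (x + t • v) v) (fderiv ℝ (fderiv ℝ f) x v v) 0 := by
  have h1 : DifferentiableAt ℝ (fderiv ℝ f) x :=
    (hf.fderiv_right (m := 1) (by norm_num)).differentiableAt (by norm_num)
  have h2 := hasDerivAt_line (f := fderiv ℝ f) (x := x) (v := v) (t := 0) (by simpa using h1)
  simp only [zero_smul, add_zero] at h2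
  exact h2.clm_apply (hasDerivAt_const 0 v) |>.congr_deriv (by simp)

theorem deriv_line_eventuallyEq {f : E n → F} {x v : E n} (hf : ContDiffAt ℝ 2 f x) :
    deriv (fun t : ℝ => f (x + t • v)) =ᶠ[𝓝 0] fun t => fderiv ℝ f (x + t • v) v := by
  filter_upwards [eventually_line (v := v) (hf.eventually (by simp))] with t ht
  exact (hasDerivAt_line (ht.differentiableAt (by norm_num))).deriv

theorem fderiv_fderiv_eq_of_line {f : E n → F} {x v : E n} (hf : ContDiffAt ℝ 2 f x)
    {g' : ℝ → F} {g'' : F} (h1 : ∀ᶠ t in 𝓝 (0 : ℝ), HasDerivAt (fun t : ℝ => f (x + t • v)) (g' t) t)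
    (h2 : HasDerivAt g' g'' 0) : fderiv ℝ (fderiv ℝ f) x v v = g'' := by
  have h3 : g' =ᶠ[𝓝 0] fun t => fderiv ℝ f (x + t • v) v := by
    filter_upwards [h1, deriv_line_eventuallyEq (v := v) hf] with t ht ht'
    rw [← ht', ht.deriv]
  exact (hasDerivAt_line_deriv hf).unique (h2.congr_of_eventuallyEq h3.symm)

theorem laplacian_nonpos_of_isLocalMax {f : E n → ℝ} {x : E n} (hf : ContDiffAt ℝ 2 f x)
    (hx : IsLocalMax f x) : Laplacian.laplacian f x ≤ 0 := by
  rw [laplacian_eq_sum_fderiv]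
  refine Finset.sum_nonpos fun i _ => ?_
  set v := EuclideanSpace.basisFun (Fin n) ℝ i
  by_contra! hpos
  set g : ℝ → ℝ := fun t => f (x + t • v) with hg
  have hd2 : deriv (deriv g) 0 = fderiv ℝ (fderiv ℝ f) x v v := by
    rw [(deriv_line_eventuallyEq hf).deriv_eq]
    exact (hasDerivAt_line_deriv hf).deriv
  have hd1 : deriv g 0 = 0 := by
    rw [(deriv_line_eventuallyEq hf).eq_of_nhds]
    simp [hx.fderiv_eq_zero]
  have hgc : ContinuousAt g 0 :=
    (hasDerivAt_line (f := f) (x := x) (v := v) (t := 0)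
      (by simpa using hf.differentiableAt (by norm_num))).continuousAt
  -- A positive second derivative would make `0` a local minimum as well as a local maximum of the
  -- restriction to the line. The restriction would then be locally constant, with vanishing second
  -- derivative.
  have hmin := isLocalMin_of_deriv_deriv_pos (by rw [hd2]; exact hpos) hd1 hgc
  have hmax : ∀ᶠ t in 𝓝 (0 : ℝ), g t ≤ g 0 := by
    have := eventually_line (v := v) hx
    simpa [hg] using this
  have hconst : g =ᶠ[𝓝 0] fun _ => g 0 := by
    filter_upwards [hmin, hmax] with t h1 h2
    exact le_antisymm h2 h1
  have : deriv (deriv g) 0 = 0 := by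
    rw [hconst.deriv.deriv_eq]
    simp
  linarith

end Lines

theorem contDiff_normSq {n : ℕ} : ContDiff ℝ 2 (fun x : E n => ‖x‖ ^ 2) := contDiff_norm_sq ℝ

theorem fderiv_normSq {n : ℕ} (x v : E n) :
    fderiv ℝ (fun x : E n => ‖x‖ ^ 2) x v = 2 * inner ℝ x v := by
  rw [(hasStrictFDerivAt_norm_sq x).hasFDerivAt.fderiv]
  simp

theorem laplacian_normSq {n : ℕ} (x : E n) :
    Laplacian.laplacian (fun x : E n => ‖x‖ ^ 2) x = 2 * n := by
  rw [laplacian_eq_sum_fderiv]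
  have h : ∀ i : Fin n, fderiv ℝ (fderiv ℝ fun x : E n => ‖x‖ ^ 2) x
      (EuclideanSpace.basisFun (Fin n) ℝ i) (EuclideanSpace.basisFun (Fin n) ℝ i) = 2 := by
    intro i
    set v := EuclideanSpace.basisFun (Fin n) ℝ i
    have hv : ‖v‖ = 1 := (EuclideanSpace.basisFun (Fin n) ℝ).orthonormal.1 i
    refine fderiv_fderiv_eq_of_line (contDiff_normSq.contDiffAt)
      (g' := fun t => 2 * (inner ℝ x v + t * inner ℝ v v))
      (Eventually.of_forall fun t => ?_) ?_
    · have := hasDerivAt_line (f := fun x : E n => ‖x‖ ^ 2) (x := x) (v := v) (t := t)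
        (contDiff_normSq.differentiable (by norm_num) _)
      rw [fderiv_normSq, inner_add_left, inner_smul_left] at this
      exact this
    · have := (((hasDerivAt_id (0 : ℝ)).mul_const (inner ℝ v v)).const_add (inner ℝ x v)).const_mul 2
      refine this.congr_deriv ?_
      rw [real_inner_self_eq_norm_sq, hv]; norm_num
  rw [Finset.sum_congr rfl fun i _ => h i]
  simp [mul_comm]

/-- Maximum principle for `(1-|x|²)Δu + 2κ⟨x,∇u⟩ = 0`, `κ ≥ 0`. -/
theorem le_zero_of_boundary {n : ℕ} (hn : 0 < n) {κ R : ℝ} (hκ : 0 ≤ κ) (hR : R ≤ 1)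
    {u : E n → ℝ} (hc : ContinuousOn u (closedBall 0 R)) (h2 : ContDiffOn ℝ 2 u (ball 0 R))
    (hL : ∀ x ∈ ball (0 : E n) R,
      (1 - ‖x‖ ^ 2) * Laplacian.laplacian u x + 2 * κ * fderiv ℝ u x x = 0)
    (hb : ∀ x ∈ sphere (0 : E n) R, u x ≤ 0) : ∀ x ∈ closedBall (0 : E n) R, u x ≤ 0 := by
  by_contra! hcon
  obtain ⟨x0, hx0, hpos⟩ := hcon
  -- The perturbation `ε(|x|² - 1)` is nonpositive on the closed ball and at least `-ε`, so `v` is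
  -- still positive at `x0`. At an interior maximum of `v` one finds `⟨x,∇u⟩ = -2ε|x|² ≤ 0` and `Δu
  -- ≤ -2nε < 0`, which contradicts the equation.
  set ε := u x0 / 2 with hε
  have hε0 : 0 < ε := by positivity
  set v : E n → ℝ := fun x => u x + (ε * ‖x‖ ^ 2 - ε) with hv
  have hvc : ContinuousOn v (closedBall 0 R) := hc.add (by fun_prop)
  obtain ⟨x1, hx1, hmax⟩ := (isCompact_closedBall (0 : E n) R).exists_isMaxOn ⟨x0, hx0⟩ hvc
  have hv0 : 0 < v x0 := by
    have : 0 ≤ ε * ‖x0‖ ^ 2 := by positivity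
    simp only [hv]; linarith
  have hv1 : 0 < v x1 := hv0.trans_le (hmax hx0)
  have hx1b : x1 ∈ ball (0 : E n) R := by
    rw [mem_ball_zero_iff]
    rw [mem_closedBall_zero_iff] at hx1
    refine lt_of_le_of_ne hx1 fun h => ?_
    have h1 := hb x1 (mem_sphere_zero_iff_norm.2 h)
    have h3 : ‖x1‖ ^ 2 ≤ 1 := pow_le_one₀ (norm_nonneg _) (h.le.trans hR)
    have : v x1 ≤ 0 := by simp only [hv]; nlinarith
    linarith
  have hx1n : ‖x1‖ < 1 := (mem_ball_zero_iff.1 hx1b).trans_le hR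
  have hloc : IsLocalMax v x1 :=
    (hmax.on_subset ball_subset_closedBall).isLocalMax (isOpen_ball.mem_nhds hx1b)
  have hu2 : ContDiffAt ℝ 2 u x1 := h2.contDiffAt (isOpen_ball.mem_nhds hx1b)
  have hq2 : ContDiffAt ℝ 2 (fun x : E n => ε * ‖x‖ ^ 2 - ε) x1 :=
    ((contDiffAt_const.mul contDiff_normSq.contDiffAt).sub contDiffAt_const)
  have hlap := laplacian_nonpos_of_isLocalMax (hu2.add hq2) hloc
  have hd := hloc.fderiv_eq_zero
  have hud : DifferentiableAt ℝ u x1 := hu2.differentiableAt (by norm_num)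
  have hqd : fderiv ℝ (fun x : E n => ε * ‖x‖ ^ 2 - ε) x1 x1 = 2 * ε * ‖x1‖ ^ 2 := by
    rw [fderiv_sub_const, fderiv_const_mul (contDiff_normSq.differentiable (by norm_num) _)]
    rw [smul_apply, fderiv_normSq, real_inner_self_eq_norm_sq, smul_eq_mul]
    ring
  have hql : Laplacian.laplacian (fun x : E n => ε * ‖x‖ ^ 2 - ε) x1 = 2 * n * ε := by
    have e : (fun x : E n => ε * ‖x‖ ^ 2 - ε) = ε • (fun x : E n => ‖x‖ ^ 2) - fun _ => ε := by
      funext x; simp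
    have hs : ContDiffAt ℝ 2 (ε • fun x : E n => ‖x‖ ^ 2) x1 :=
      contDiff_normSq.contDiffAt.const_smul ε
    rw [e, hs.laplacian_sub contDiffAt_const, InnerProductSpace.laplacian_smul _ contDiff_normSq.contDiffAt,
      laplacian_normSq, InnerProductSpace.laplacian_const]
    simp; ring
  have hlap2 : Laplacian.laplacian v x1 = Laplacian.laplacian u x1 + 2 * n * ε := by
    rw [← hql]; exact hu2.laplacian_add hq2
  have hd2 : fderiv ℝ u x1 x1 = -(2 * ε * ‖x1‖ ^ 2) := by
    have h3 : fderiv ℝ v x1 x1 = fderiv ℝ u x1 x1 + 2 * ε * ‖x1‖ ^ 2 := by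
      rw [← hqd, hv, fderiv_fun_add hud (hq2.differentiableAt (by norm_num))]; rfl
    rw [hd] at h3
    simp at h3
    linarith
  change Laplacian.laplacian v x1 ≤ 0 at hlap
  rw [hlap2] at hlap
  have hLx := hL x1 hx1b
  rw [hd2] at hLx
  have hn' : (0 : ℝ) < n := by exact_mod_cast hn
  have h5 : 0 < 1 - ‖x1‖ ^ 2 := by nlinarith [norm_nonneg x1]
  have h6 : Laplacian.laplacian u x1 < 0 := by nlinarith [mul_pos hn' hε0]
  have h7 : 0 ≤ κ * (ε * ‖x1‖ ^ 2) := by positivity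
  nlinarith [mul_neg_of_pos_of_neg h5 h6]

/-! ### The Poisson kernels -/

/-- `(1-|x|²)^α / |x-z|^(n-1+α)`: the Euclidean Poisson kernel for `α = 1`, the hyperbolic one
for `α = n - 1`. -/
def poissonKernel {n : ℕ} (α : ℝ) (x z : E n) : ℝ :=
  (1 - ‖x‖ ^ 2) ^ α * (‖x - z‖ ^ 2) ^ (-((n - 1 + α) / 2))

/-- The domain of smoothness of the Poisson kernels. -/
def kernelDomain (n : ℕ) : Set (E n × E n) := {p | ‖p.1‖ < 1 ∧ p.1 ≠ p.2}

theorem isOpen_kernelDomain (n : ℕ) : IsOpen (kernelDomain n) :=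
  (isOpen_lt (f := fun p : E n × E n => ‖p.1‖) (by fun_prop) continuous_const).inter
    (isOpen_ne_fun continuous_fst continuous_snd)

theorem ne_of_norm_lt {n : ℕ} {x : E n} (hx : ‖x‖ < 1) (ζ : Sph n) : x ≠ ζ := fun h => by
  rw [h, norm_coe_sph] at hx
  exact lt_irrefl _ hx

theorem mem_kernelDomain {n : ℕ} {x : E n} (hx : x ∈ ball (0 : E n) 1) (ζ : Sph n) :
    (x, (ζ : E n)) ∈ kernelDomain n :=
  ⟨mem_ball_zero_iff.1 hx, ne_of_norm_lt (mem_ball_zero_iff.1 hx) ζ⟩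

theorem one_sub_normSq_pos {n : ℕ} {x : E n} (hx : ‖x‖ < 1) : 0 < 1 - ‖x‖ ^ 2 := by
  nlinarith [norm_nonneg x]

theorem contDiffOn_poissonKernel {n : ℕ} (α : ℝ) :
    ContDiffOn ℝ ⊤ (fun p : E n × E n => ((poissonKernel α p.1 p.2 : ℝ) : ℂ)) (kernelDomain n) := by
  intro p hp
  have h1 : (1 - ‖p.1‖ ^ 2) ≠ 0 := (one_sub_normSq_pos hp.1).ne'
  have h2 : ‖p.1 - p.2‖ ^ 2 ≠ 0 := pow_ne_zero _ (norm_ne_zero_iff.2 (sub_ne_zero.2 hp.2))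
  have hc : ContDiffAt ℝ ⊤ (fun p : E n × E n => poissonKernel α p.1 p.2) p := by
    unfold poissonKernel
    refine ContDiffAt.mul ?_ ?_
    · exact (contDiffAt_const.sub (contDiffAt_fst.norm_sq ℝ)).rpow_const_of_ne h1
    · exact ((contDiffAt_fst.sub contDiffAt_snd).norm_sq ℝ).rpow_const_of_ne h2
  exact (Complex.ofRealCLM.contDiff.contDiffAt.comp p hc).contDiffWithinAt

theorem poissonKernel_nonneg {n : ℕ} (α : ℝ) {x : E n} (hx : ‖x‖ ≤ 1) (z : E n) :
    0 ≤ poissonKernel α x z := by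
  have : 0 ≤ 1 - ‖x‖ ^ 2 := by nlinarith [norm_nonneg x]
  unfold poissonKernel
  positivity

theorem poissonKernel_zero {n : ℕ} (α : ℝ) (ζ : Sph n) : poissonKernel α 0 (ζ : E n) = 1 := by
  simp [poissonKernel]

theorem norm_smul_sub_sq {n : ℕ} (r : ℝ) (ζ η : Sph n) :
    ‖r • (ζ : E n) - η‖ ^ 2 = (1 - r) ^ 2 + r * ‖(ζ : E n) - η‖ ^ 2 := by
  rw [norm_sub_sq_real, norm_sub_sq_real, norm_smul, inner_smul_left, mul_pow, norm_coe_sph,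
    norm_coe_sph, Real.norm_eq_abs, sq_abs]
  simp only [conj_trivial]
  ring

theorem poissonKernel_smul_comm {n : ℕ} (α r : ℝ) (ζ η : Sph n) :
    poissonKernel α (r • (ζ : E n)) η = poissonKernel α (r • (η : E n)) ζ := by
  simp only [poissonKernel, norm_smul_sub_sq, norm_smul, norm_coe_sph, norm_sub_rev (ζ : E n)]

theorem poissonKernel_map {n : ℕ} (α : ℝ) (U : E n ≃ₗᵢ[ℝ] E n) (x z : E n) :
    poissonKernel α (U x) (U z) = poissonKernel α x z := by
  simp only [poissonKernel, ← map_sub, U.norm_map]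

/-- The logarithmic second derivative of `A^α D^(-b)`. -/
theorem hasDerivAt_rpow_mul_rpow {a0 a1 a2 d0 d1 d2 α b : ℝ} (ha : a0 ≠ 0) (hd : d0 ≠ 0) :
    ∃ g' : ℝ → ℝ, (∀ᶠ t in 𝓝 (0 : ℝ), HasDerivAt (fun t => (a0 + a1 * t + a2 * t ^ 2) ^ α *
      (d0 + d1 * t + d2 * t ^ 2) ^ (-b)) (g' t) t) ∧
      g' 0 = a0 ^ α * d0 ^ (-b) * (α * (a1 / a0) - b * (d1 / d0)) ∧
      HasDerivAt g' (a0 ^ α * d0 ^ (-b) * ((α * (a1 / a0) - b * (d1 / d0)) ^ 2 +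
        α * (2 * a2 / a0 - (a1 / a0) ^ 2) - b * (2 * d2 / d0 - (d1 / d0) ^ 2))) 0 := by
  have hA : ∀ (c0 c1 c2 t : ℝ), HasDerivAt (fun t => c0 + c1 * t + c2 * t ^ 2)
      (c1 + 2 * c2 * t) t := by
    intro c0 c1 c2 t
    have := (((hasDerivAt_id t).const_mul c1).const_add c0).add (((hasDerivAt_id t).pow 2).const_mul c2)
    refine this.congr_deriv ?_
    simp; ring
  have hne : ∀ {c0 : ℝ} (c1 c2 : ℝ), c0 ≠ 0 → ∀ᶠ t in 𝓝 (0 : ℝ), c0 + c1 * t + c2 * t ^ 2 ≠ 0 := by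
    intro c0 c1 c2 hc
    exact (hA c0 c1 c2 0).continuousAt.eventually_ne (by simpa using hc)
  set g : ℝ → ℝ := fun t => (a0 + a1 * t + a2 * t ^ 2) ^ α * (d0 + d1 * t + d2 * t ^ 2) ^ (-b)
    with hg
  set l : ℝ → ℝ := fun t => α * ((a1 + 2 * a2 * t) / (a0 + a1 * t + a2 * t ^ 2)) -
    b * ((d1 + 2 * d2 * t) / (d0 + d1 * t + d2 * t ^ 2)) with hl
  have h1 : ∀ᶠ t in 𝓝 (0 : ℝ), HasDerivAt g (g t * l t) t := by
    filter_upwards [hne a1 a2 ha, hne d1 d2 hd] with t hta htd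
    have e := ((hA a0 a1 a2 t).rpow_const (p := α) (Or.inl hta)).mul
      ((hA d0 d1 d2 t).rpow_const (p := -b) (Or.inl htd))
    refine e.congr_deriv ?_
    rw [Real.rpow_sub_one hta, Real.rpow_sub_one htd]
    simp only [hg, hl]
    field_simp
    ring
  refine ⟨fun t => g t * l t, h1, by simp [hg, hl], ?_⟩
  have h2 := h1.self_of_nhds
  have hB : ∀ c1 c2 : ℝ, HasDerivAt (fun t : ℝ => c1 + 2 * c2 * t) (2 * c2) 0 := by
    intro c1 c2
    simpa using ((hasDerivAt_id (0 : ℝ)).const_mul (2 * c2)).const_add c1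
  have h3 : HasDerivAt l (α * (2 * a2 / a0 - (a1 / a0) ^ 2) -
      b * (2 * d2 / d0 - (d1 / d0) ^ 2)) 0 := by
    have e1 := ((hB a1 a2).div (hA a0 a1 a2 0) (by simpa using ha)).const_mul α
    have e2 := ((hB d1 d2).div (hA d0 d1 d2 0) (by simpa using hd)).const_mul b
    refine (e1.sub e2).congr_deriv ?_
    simp only [mul_zero, add_zero, ne_eq, OfNat.ofNat_ne_zero, not_false_eq_true, zero_pow]
    field_simp
  refine (h2.mul h3).congr_deriv ?_
  simp only [hg, hl, mul_zero, add_zero, ne_eq, OfNat.ofNat_ne_zero, not_false_eq_true, zero_pow]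
  ring

theorem contDiffAt_poissonKernel {n : ℕ} (α : ℝ) {x : E n} (hx : ‖x‖ < 1) (ζ : Sph n) :
    ContDiffAt ℝ 2 (fun y : E n => poissonKernel α y ζ) x := by
  have h1 : (1 - ‖x‖ ^ 2) ≠ 0 := (one_sub_normSq_pos hx).ne'
  have h2 : ‖x - ζ‖ ^ 2 ≠ 0 :=
    pow_ne_zero _ (norm_ne_zero_iff.2 (sub_ne_zero.2 (ne_of_norm_lt hx ζ)))
  unfold poissonKernel
  exact ((contDiffAt_const.sub (contDiffAt_id.norm_sq ℝ)).rpow_const_of_ne h1).mul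
    (((contDiffAt_id.sub contDiffAt_const).norm_sq ℝ).rpow_const_of_ne h2)

theorem poissonKernel_derivatives {n : ℕ} (α : ℝ) {x : E n} (hx : ‖x‖ < 1) (ζ : Sph n) (v : E n) :
    fderiv ℝ (fun y : E n => poissonKernel α y ζ) x v = poissonKernel α x ζ *
      (α * (-2 * inner ℝ x v / (1 - ‖x‖ ^ 2)) -
        (n - 1 + α) / 2 * (2 * inner ℝ (x - ζ) v / ‖x - ζ‖ ^ 2)) ∧
    fderiv ℝ (fderiv ℝ fun y : E n => poissonKernel α y ζ) x v v = poissonKernel α x ζ *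
      ((α * (-2 * inner ℝ x v / (1 - ‖x‖ ^ 2)) -
        (n - 1 + α) / 2 * (2 * inner ℝ (x - ζ) v / ‖x - ζ‖ ^ 2)) ^ 2 +
        α * (2 * (-‖v‖ ^ 2) / (1 - ‖x‖ ^ 2) - (-2 * inner ℝ x v / (1 - ‖x‖ ^ 2)) ^ 2) -
        (n - 1 + α) / 2 * (2 * ‖v‖ ^ 2 / ‖x - ζ‖ ^ 2 -
          (2 * inner ℝ (x - ζ) v / ‖x - ζ‖ ^ 2) ^ 2)) := by
  have h1 : (1 - ‖x‖ ^ 2) ≠ 0 := (one_sub_normSq_pos hx).ne'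
  have h2 : ‖x - ζ‖ ^ 2 ≠ 0 :=
    pow_ne_zero _ (norm_ne_zero_iff.2 (sub_ne_zero.2 (ne_of_norm_lt hx ζ)))
  obtain ⟨g', hg1, hg0, hg2⟩ := hasDerivAt_rpow_mul_rpow (a1 := -2 * inner ℝ x v)
    (a2 := -‖v‖ ^ 2) (d1 := 2 * inner ℝ (x - ζ) v) (d2 := ‖v‖ ^ 2) (α := α)
    (b := (n - 1 + α) / 2) h1 h2
  have hline : (fun t : ℝ => poissonKernel α (x + t • v) (ζ : E n)) = fun t =>
      (1 - ‖x‖ ^ 2 + -2 * inner ℝ x v * t + -‖v‖ ^ 2 * t ^ 2) ^ α *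
      (‖x - ζ‖ ^ 2 + 2 * inner ℝ (x - ζ) v * t + ‖v‖ ^ 2 * t ^ 2) ^ (-((n - 1 + α) / 2)) := by
    funext t
    have e : ∀ y : E n, ‖y + t • v‖ ^ 2 = ‖y‖ ^ 2 + 2 * inner ℝ y v * t + ‖v‖ ^ 2 * t ^ 2 := by
      intro y
      rw [norm_add_sq_real, norm_smul, inner_smul_right, mul_pow, Real.norm_eq_abs, sq_abs]
      ring
    rw [poissonKernel, show x + t • v - (ζ : E n) = (x - ζ) + t • v by abel, e, e]
    congr 2
    ring
  rw [← hline] at hg1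
  have hcd := contDiffAt_poissonKernel α hx ζ
  refine ⟨?_, fderiv_fderiv_eq_of_line hcd hg1 hg2⟩
  have h3 := hasDerivAt_line (f := fun y : E n => poissonKernel α y ζ) (x := x) (v := v) (t := 0)
    (by simpa using hcd.differentiableAt (by norm_num))
  simp only [zero_smul, add_zero] at h3
  rw [h3.unique hg1.self_of_nhds, hg0]
  rfl

theorem sum_inner_basisFun_mul {n : ℕ} (x y : E n) :
    ∑ i, inner ℝ x (EuclideanSpace.basisFun (Fin n) ℝ i) *
      inner ℝ y (EuclideanSpace.basisFun (Fin n) ℝ i) = inner ℝ x y := by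
  rw [← (EuclideanSpace.basisFun (Fin n) ℝ).sum_inner_mul_inner x y]
  exact Finset.sum_congr rfl fun i _ => by rw [real_inner_comm y]

theorem sum_log_derivatives {n : ℕ} {p q : Fin n → ℝ} {X Y Z A D α b : ℝ} (hA : A ≠ 0) (hD : D ≠ 0)
    (h1 : ∑ i, p i * p i = X) (h2 : ∑ i, p i * q i = Y) (h3 : ∑ i, q i * q i = Z) :
    ∑ i, ((α * (-2 * p i / A) - b * (2 * q i / D)) ^ 2 +
      α * (2 * (-1) / A - (-2 * p i / A) ^ 2) - b * (2 * 1 / D - (2 * q i / D) ^ 2)) =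
    4 * α * (α - 1) / A ^ 2 * X + 4 * b * (b + 1) / D ^ 2 * Z + 8 * α * b / (A * D) * Y +
      n * (-2 * α / A - 2 * b / D) := by
  have : ∀ i, (α * (-2 * p i / A) - b * (2 * q i / D)) ^ 2 +
      α * (2 * (-1) / A - (-2 * p i / A) ^ 2) - b * (2 * 1 / D - (2 * q i / D) ^ 2) =
      4 * α * (α - 1) / A ^ 2 * (p i * p i) + 4 * b * (b + 1) / D ^ 2 * (q i * q i) +
      8 * α * b / (A * D) * (p i * q i) + (-2 * α / A - 2 * b / D) := by
    intro i
    field_simp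
    ring
  simp only [this, Finset.sum_add_distrib, ← Finset.mul_sum, h1, h2, h3, Finset.sum_const,
    Finset.card_univ, Fintype.card_fin, nsmul_eq_mul]

/-- The Poisson kernels are annihilated by `(1-|x|²)Δ + 2(α-1)⟨x,∇⟩`. -/
theorem poissonKernel_equation {n : ℕ} {α : ℝ} (hα : (α - 1) * (α - (n - 1)) = 0) {x : E n}
    (hx : ‖x‖ < 1) (ζ : Sph n) :
    (1 - ‖x‖ ^ 2) * ∑ i, fderiv ℝ (fderiv ℝ fun y : E n => poissonKernel α y ζ) x
      (EuclideanSpace.basisFun (Fin n) ℝ i) (EuclideanSpace.basisFun (Fin n) ℝ i) +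
      2 * (α - 1) * fderiv ℝ (fun y : E n => poissonKernel α y ζ) x x = 0 := by
  have h1 : (1 - ‖x‖ ^ 2) ≠ 0 := (one_sub_normSq_pos hx).ne'
  have h2 : ‖x - ζ‖ ^ 2 ≠ 0 :=
    pow_ne_zero _ (norm_ne_zero_iff.2 (sub_ne_zero.2 (ne_of_norm_lt hx ζ)))
  have hb : ∀ i, ‖EuclideanSpace.basisFun (Fin n) ℝ i‖ ^ 2 = 1 := fun i => by
    rw [(EuclideanSpace.basisFun (Fin n) ℝ).orthonormal.1 i, one_pow]
  simp only [(poissonKernel_derivatives α hx ζ _).1, (poissonKernel_derivatives α hx ζ _).2, hb]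
  rw [← Finset.mul_sum]
  -- Because `|ζ| = 1`, all scalar products are functions of `|x|²` and `|x-ζ|²`. The equation
  -- becomes a rational identity in these two quantities, valid for both roots `α = 1` and `α =
  -- n-1`.
  have hxζ : inner ℝ (x - (ζ : E n)) x = (‖x‖ ^ 2 + ‖x - ζ‖ ^ 2 - 1) / 2 := by
    have h3 : ‖(ζ : E n)‖ ^ 2 = ‖x - (x - ζ)‖ ^ 2 := by rw [sub_sub_cancel]
    rw [norm_sub_sq_real, norm_coe_sph, real_inner_comm] at h3
    linarith
  have s1 := sum_inner_basisFun_mul x x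
  have s2 := sum_inner_basisFun_mul x (x - ζ)
  have s3 := sum_inner_basisFun_mul (x - (ζ : E n)) (x - ζ)
  rw [real_inner_self_eq_norm_sq] at s1 s3
  rw [real_inner_comm, hxζ] at s2
  rw [sum_log_derivatives h1 h2 s1 s2 s3, hxζ, real_inner_self_eq_norm_sq]
  clear s1 s2 s3 hxζ hb
  generalize ‖x - (ζ : E n)‖ ^ 2 = D at *
  generalize poissonKernel α x ζ = K at *
  generalize ‖x‖ ^ 2 = X at *
  obtain ⟨A, hA⟩ : ∃ A, A = 1 - X := ⟨_, rfl⟩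
  obtain rfl : X = 1 - A := by linarith
  rw [sub_sub_cancel] at *
  field_simp
  rcases mul_eq_zero.1 hα with h | h
  · rw [sub_eq_zero.1 h]; ring
  · rw [sub_eq_zero.1 h]; ring

/-! ### Poisson integrals are smooth -/

section KernelIntegral

variable {n : ℕ} {F : Type*} [NormedAddCommGroup F] [NormedSpace ℝ F]

/-- The derivative of a kernel in the first variable. -/
def partialFst (G : E n × E n → F) (p : E n × E n) : E n →L[ℝ] F :=
  (fderiv ℝ G p).comp (ContinuousLinearMap.inl ℝ (E n) (E n))

theorem contDiffOn_partialFst {G : E n × E n → F} (hG : ContDiffOn ℝ ⊤ G (kernelDomain n)) :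
    ContDiffOn ℝ ⊤ (partialFst G) (kernelDomain n) :=
  (hG.fderiv_of_isOpen (isOpen_kernelDomain n) (m := ⊤) le_top).clm_comp contDiffOn_const

theorem hasFDerivAt_fst {G : E n × E n → F} (hG : ContDiffOn ℝ ⊤ G (kernelDomain n))
    {x z : E n} (hp : (x, z) ∈ kernelDomain n) :
    HasFDerivAt (fun y => G (y, z)) (partialFst G (x, z)) x := by
  have h1 : HasFDerivAt G (fderiv ℝ G (x, z)) (x, z) :=
    ((hG.contDiffAt ((isOpen_kernelDomain n).mem_nhds hp)).differentiableAt (by simp)).hasFDerivAt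
  exact h1.comp x (hasFDerivAt_prodMk_left x z)

theorem continuous_kernel_snd {F : Type*} [TopologicalSpace F] {G : E n × E n → F} (hG : ContinuousOn G (kernelDomain n))
    {x : E n} (hx : x ∈ ball (0 : E n) 1) : Continuous fun ζ : Sph n => G (x, ζ) :=
  hG.comp_continuous (by fun_prop) fun ζ => mem_kernelDomain hx ζ

theorem exists_kernel_bound {F : Type*} [NormedAddCommGroup F] {G : E n × E n → F} (hG : ContinuousOn G (kernelDomain n))
    {R : ℝ} (hR : R < 1) :
    ∃ C, ∀ x ∈ closedBall (0 : E n) R, ∀ ζ : Sph n, ‖G (x, ζ)‖ ≤ C := by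
  have hK : IsCompact (closedBall (0 : E n) R ×ˢ sphere (0 : E n) 1) :=
    (isCompact_closedBall _ _).prod (isCompact_sphere _ _)
  obtain ⟨C, hC⟩ := hK.exists_bound_of_continuousOn (hG.mono (by
    rintro ⟨x, ζ⟩ ⟨hx, hζ⟩
    exact mem_kernelDomain (closedBall_subset_ball hR hx) ⟨ζ, hζ⟩))
  exact ⟨C, fun x hx ζ => hC (x, ζ) ⟨hx, ζ.2⟩⟩

theorem hasFDerivAt_kernelIntegral [NormedSpace ℂ F] [SMulCommClass ℝ ℂ F] {G : E n × E n → F} (hG : ContDiffOn ℝ ⊤ G (kernelDomain n))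
    {h : Sph n → ℂ} (hh : Integrable h (sphereMeasure n)) {x : E n} (hx : x ∈ ball (0 : E n) 1) :
    HasFDerivAt (fun y => ∫ ζ, h ζ • G (y, ζ) ∂sphereMeasure n)
      (∫ ζ, h ζ • partialFst G (x, ζ) ∂sphereMeasure n) x := by
  obtain ⟨R, hxR, hR⟩ := exists_between (mem_ball_zero_iff.1 hx)
  have hG' := (contDiffOn_partialFst hG).continuousOn
  obtain ⟨C, hC⟩ := exists_kernel_bound hG' hR
  obtain ⟨C0, hC0⟩ := exists_kernel_bound hG.continuousOn hR
  have hsub : ∀ y ∈ ball (0 : E n) R, y ∈ ball (0 : E n) 1 := fun y hy => ball_subset_ball hR.le hy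
  refine hasFDerivAt_integral_of_dominated_of_fderiv_le (s := ball 0 R)
    (F' := fun y ζ => h ζ • partialFst G (y, ζ)) (bound := fun ζ => ‖h ζ‖ * C)
    (isOpen_ball.mem_nhds (mem_ball_zero_iff.2 hxR)) ?_ ?_ ?_ ?_ ?_ ?_
  · filter_upwards [isOpen_ball.mem_nhds hx] with y hy
    exact hh.aestronglyMeasurable.smul
      (continuous_kernel_snd hG.continuousOn hy).aestronglyMeasurable
  · exact hh.smul_bdd C0
      (continuous_kernel_snd hG.continuousOn hx).aestronglyMeasurable
      (Eventually.of_forall fun ζ => hC0 x (mem_closedBall_zero_iff.2 hxR.le) ζ)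
  · exact hh.aestronglyMeasurable.smul (continuous_kernel_snd hG' hx).aestronglyMeasurable
  · refine Eventually.of_forall fun ζ y hy => ?_
    rw [norm_smul]
    exact mul_le_mul_of_nonneg_left (hC y (ball_subset_closedBall hy) ζ) (norm_nonneg _)
  · exact hh.norm.mul_const C
  · exact Eventually.of_forall fun ζ y hy =>
      (hasFDerivAt_fst hG (mem_kernelDomain (hsub y hy) ζ)).const_smul (h ζ)

end KernelIntegral

/-- The Poisson integral of a function on the sphere. -/
def poissonIntegral {n : ℕ} (α : ℝ) (h : Sph n → ℂ) (x : E n) : ℂ :=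
  ∫ ζ, h ζ • ((poissonKernel α x ζ : ℝ) : ℂ) ∂sphereMeasure n

/-- The operator `(1-|x|²)Δ + 2κ⟨x,∇⟩`. -/
def SolvesL {n : ℕ} (κ R : ℝ) (u : E n → ℂ) : Prop :=
  ContDiffOn ℝ 2 u (ball 0 R) ∧ ∀ x ∈ ball (0 : E n) R,
    ((1 - ‖x‖ ^ 2 : ℝ) : ℂ) * Laplacian.laplacian u x + 2 * (κ : ℂ) * fderiv ℝ u x x = 0

/-- Smoothness of the kernel off the sphere allows differentiating twice under the integral sign for
any integrable `h`; the equation is inherited from the kernel. -/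
theorem solvesL_poissonIntegral {n : ℕ} {α : ℝ} (hα : (α - 1) * (α - (n - 1)) = 0)
    {h : Sph n → ℂ} (hh : Integrable h (sphereMeasure n)) :
    SolvesL (α - 1) 1 (poissonIntegral α h) := by
  set G : E n × E n → ℂ := fun p => ((poissonKernel α p.1 p.2 : ℝ) : ℂ) with hGdef
  have hG : ContDiffOn ℝ ⊤ G (kernelDomain n) := contDiffOn_poissonKernel α
  have hG1 := contDiffOn_partialFst hG
  have hG2 := contDiffOn_partialFst hG1
  have d0 := fun x (hx : x ∈ ball (0 : E n) 1) => hasFDerivAt_kernelIntegral hG hh hx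
  have d1 := fun x (hx : x ∈ ball (0 : E n) 1) => hasFDerivAt_kernelIntegral hG1 hh hx
  have d2 := fun x (hx : x ∈ ball (0 : E n) 1) => hasFDerivAt_kernelIntegral hG2 hh hx
  change ∀ x ∈ ball (0 : E n) 1, HasFDerivAt (poissonIntegral α h) _ x at d0
  have e0 : Set.EqOn (fderiv ℝ (poissonIntegral α h))
      (fun x => ∫ ζ, h ζ • partialFst G (x, ζ) ∂sphereMeasure n) (ball 0 1) :=
    fun x hx => (d0 x hx).fderiv
  have e1 : ∀ x ∈ ball (0 : E n) 1, fderiv ℝ (fderiv ℝ (poissonIntegral α h)) x =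
      ∫ ζ, h ζ • partialFst (partialFst G) (x, ζ) ∂sphereMeasure n := fun x hx => by
    rw [(e0.eventuallyEq_of_mem (isOpen_ball.mem_nhds hx)).fderiv_eq, (d1 x hx).fderiv]
  constructor
  · have c1 : ContDiffOn ℝ 1 (fun x => ∫ ζ, h ζ • partialFst G (x, ζ) ∂sphereMeasure n)
        (ball 0 1) := by
      rw [show (1 : WithTop ℕ∞) = 0 + 1 by simp, contDiffOn_succ_iff_fderiv_of_isOpen isOpen_ball]
      refine ⟨fun x hx => (d1 x hx).differentiableAt.differentiableWithinAt, by simp, ?_⟩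
      rw [contDiffOn_zero]
      refine ContinuousOn.congr (f := fun x => ∫ ζ, h ζ • partialFst (partialFst G) (x, ζ)
        ∂sphereMeasure n) (fun x hx => (d2 x hx).continuousAt.continuousWithinAt) ?_
      exact fun x hx => (d1 x hx).fderiv
    rw [show (2 : WithTop ℕ∞) = 1 + 1 by norm_num, contDiffOn_succ_iff_fderiv_of_isOpen isOpen_ball]
    exact ⟨fun x hx => (d0 x hx).differentiableAt.differentiableWithinAt, by simp, c1.congr e0⟩
  · intro x hx
    have hx1 := mem_ball_zero_iff.1 hx
    have i1 : Integrable (fun ζ : Sph n => h ζ • partialFst G (x, ζ)) (sphereMeasure n) := by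
      obtain ⟨C, hC⟩ := exists_kernel_bound hG1.continuousOn hx1
      exact hh.smul_bdd C (continuous_kernel_snd hG1.continuousOn hx).aestronglyMeasurable
        (Eventually.of_forall fun ζ => hC x (by simp) ζ)
    have i2 : Integrable (fun ζ : Sph n => h ζ • partialFst (partialFst G) (x, ζ))
        (sphereMeasure n) := by
      obtain ⟨C, hC⟩ := exists_kernel_bound hG2.continuousOn hx1
      exact hh.smul_bdd C (continuous_kernel_snd hG2.continuousOn hx).aestronglyMeasurable
        (Eventually.of_forall fun ζ => hC x (by simp) ζ)
    have i3 : ∀ v w : E n, Integrable (fun ζ : Sph n =>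
        (h ζ • partialFst (partialFst G) (x, ζ)) v w) (sphereMeasure n) := fun v w =>
      (i2.apply_continuousLinearMap v).apply_continuousLinearMap w
    rw [laplacian_eq_sum_fderiv, e0 hx, e1 x hx, ContinuousLinearMap.integral_apply i1]
    simp only [ContinuousLinearMap.integral_apply i2,
      ContinuousLinearMap.integral_apply (i2.apply_continuousLinearMap _)]
    rw [← integral_finsetSum _ fun i _ => i3 _ _, ← integral_const_mul, ← integral_const_mul,
      ← integral_add ((integrable_finsetSum _ fun i _ => i3 _ _).const_mul _)
        ((i1.apply_continuousLinearMap _).const_mul _)]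
    refine integral_eq_zero_of_ae (Eventually.of_forall fun ζ => ?_)
    have hcast := contDiffAt_poissonKernel α hx1 ζ
    have f0 : ∀ y ∈ ball (0 : E n) 1, ∀ v, partialFst G (y, ζ) v =
        ((fderiv ℝ (fun y : E n => poissonKernel α y ζ) y v : ℝ) : ℂ) := by
      intro y hy v
      have a1 := hasFDerivAt_fst hG (mem_kernelDomain hy ζ)
      have a2 := Complex.ofRealCLM.hasFDerivAt.comp y ((contDiffAt_poissonKernel α
        (mem_ball_zero_iff.1 hy) ζ).differentiableAt (by norm_num)).hasFDerivAt
      rw [a1.unique a2]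
      rfl
    have f1 : ∀ v w, partialFst (partialFst G) (x, ζ) v w =
        ((fderiv ℝ (fderiv ℝ (fun y : E n => poissonKernel α y ζ)) x v w : ℝ) : ℂ) := by
      intro v w
      have a1 := (hasFDerivAt_fst hG1 (mem_kernelDomain hx ζ)).clm_apply (hasFDerivAt_const w x)
      have a2 := Complex.ofRealCLM.hasFDerivAt.comp x ((((hcast.fderiv_right (m := 1)
        (by norm_num)).differentiableAt (by norm_num)).hasFDerivAt).clm_apply
        (hasFDerivAt_const w x))
      have a3 := a1.congr_of_eventuallyEq (f₁ := fun y => ((fderiv ℝ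
        (fun y : E n => poissonKernel α y ζ) y w : ℝ) : ℂ)) (by
          filter_upwards [isOpen_ball.mem_nhds hx] with y hy
          exact (f0 y hy w).symm)
      have a4 := congrArg (fun T : E n →L[ℝ] ℂ => T v) (a3.unique a2)
      simpa using a4
    simp only [smul_apply, f0 x hx, f1, smul_eq_mul, Pi.zero_apply]
    have := congrArg (fun r : ℝ => h ζ * (r : ℂ)) (poissonKernel_equation hα hx1 ζ)
    push_cast at this
    rw [mul_zero] at this
    rw [← Finset.mul_sum, ← this]
    push_cast
    ring

/-! ### The Dirichlet problem for `(1-|x|²)Δ + 2κ⟨x,∇⟩` on the ball -/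

theorem SolvesL.sub {n : ℕ} {κ R : ℝ} {u v : E n → ℂ} (hu : SolvesL κ R u) (hv : SolvesL κ R v) :
    SolvesL κ R (fun x => u x - v x) := by
  refine ⟨hu.1.sub hv.1, fun x hx => ?_⟩
  have cu := hu.1.contDiffAt (isOpen_ball.mem_nhds hx)
  have cv := hv.1.contDiffAt (isOpen_ball.mem_nhds hx)
  have h1 : Laplacian.laplacian (fun x => u x - v x) x =
      Laplacian.laplacian u x - Laplacian.laplacian v x := cu.laplacian_sub cv
  rw [h1, fderiv_fun_sub (cu.differentiableAt (by norm_num)) (cv.differentiableAt (by norm_num)),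
    sub_apply]
  linear_combination hu.2 x hx - hv.2 x hx

theorem solvesL_const {n : ℕ} (κ R : ℝ) (c : ℂ) : SolvesL κ R (fun _ : E n => c) := by
  refine ⟨contDiffOn_const, fun x _ => ?_⟩
  rw [laplacian_eq_sum_fderiv]
  simp

theorem SolvesL.mono {n : ℕ} {κ R R' : ℝ} {u : E n → ℂ} (hu : SolvesL κ R u) (h : R' ≤ R) :
    SolvesL κ R' u :=
  ⟨hu.1.mono (ball_subset_ball h), fun x hx => hu.2 x (ball_subset_ball h hx)⟩

theorem SolvesL.congr {n : ℕ} {κ R : ℝ} {u v : E n → ℂ} (hu : SolvesL κ R u)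
    (h : Set.EqOn v u (ball 0 R)) : SolvesL κ R v := by
  refine ⟨hu.1.congr h, fun x hx => ?_⟩
  have h1 : v =ᶠ[𝓝 x] u := h.eventuallyEq_of_mem (isOpen_ball.mem_nhds hx)
  rw [h1.fderiv_eq, InnerProductSpace.laplacian_congr_nhds h1 |>.self_of_nhds]
  exact hu.2 x hx

theorem SolvesL.clm_comp {n : ℕ} {κ R : ℝ} {u : E n → ℂ} (hu : SolvesL κ R u) (l : ℂ →L[ℝ] ℝ) :
    ContDiffOn ℝ 2 (l ∘ u) (ball 0 R) ∧ ∀ x ∈ ball (0 : E n) R,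
      (1 - ‖x‖ ^ 2) * Laplacian.laplacian (l ∘ u) x + 2 * κ * fderiv ℝ (l ∘ u) x x = 0 := by
  refine ⟨l.contDiff.comp_contDiffOn hu.1, fun x hx => ?_⟩
  have cu := hu.1.contDiffAt (isOpen_ball.mem_nhds hx)
  rw [cu.laplacian_CLM_comp_left, fderiv_comp x l.differentiableAt
    (cu.differentiableAt (by norm_num)), l.fderiv]
  have h := congrArg l (hu.2 x hx)
  have e : ((1 - ‖x‖ ^ 2 : ℝ) : ℂ) * Laplacian.laplacian u x + 2 * (κ : ℂ) * fderiv ℝ u x x =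
      (1 - ‖x‖ ^ 2) • Laplacian.laplacian u x + (2 * κ) • fderiv ℝ u x x := by
    simp only [Complex.real_smul]
    push_cast
    ring
  rw [e, map_add, map_smul, map_smul, map_zero] at h
  exact h

theorem SolvesL.eq_zero_of_boundary {n : ℕ} (hn : 0 < n) {κ R : ℝ} (hκ : 0 ≤ κ) (hR : R ≤ 1)
    {u : E n → ℂ} (hc : ContinuousOn u (closedBall 0 R)) (hL : SolvesL κ R u)
    (hb : ∀ x ∈ sphere (0 : E n) R, u x = 0) : ∀ x ∈ closedBall (0 : E n) R, u x = 0 := by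
  intro x hx
  have key : ∀ l : ℂ →L[ℝ] ℝ, l (u x) ≤ 0 := fun l =>
    le_zero_of_boundary hn hκ hR (l.continuous.comp_continuousOn hc) (hL.clm_comp l).1
      (hL.clm_comp l).2 (fun y hy => by simp [hb y hy]) x hx
  refine Complex.ext ?_ ?_
  · exact le_antisymm (key Complex.reCLM) (by simpa using key (-Complex.reCLM))
  · exact le_antisymm (key Complex.imCLM) (by simpa using key (-Complex.imCLM))

/-- The exponents of the Euclidean and of the hyperbolic Poisson kernel. -/
def IsPoissonExponent (n : ℕ) (α : ℝ) : Prop := 1 ≤ α ∧ (α - 1) * (α - (n - 1)) = 0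

theorem isPoissonExponent_one (n : ℕ) : IsPoissonExponent n 1 := ⟨le_rfl, by ring⟩

theorem isPoissonExponent_hyp {n : ℕ} (hn : 2 < n) : IsPoissonExponent n (n - 1) := by
  have : (3 : ℝ) ≤ n := by exact_mod_cast hn
  exact ⟨by linarith, by ring⟩

theorem integrable_of_continuous_sph {n : ℕ} {F : Type*} [NormedAddCommGroup F] {h : Sph n → F}
    (hh : Continuous h) : Integrable h (sphereMeasure n) :=
  hh.integrable_of_hasCompactSupport (HasCompactSupport.of_compactSpace h)

theorem continuous_poissonKernel_snd {n : ℕ} (α : ℝ) {x : E n} (hx : x ∈ ball (0 : E n) 1) :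
    Continuous fun ζ : Sph n => poissonKernel α x ζ := by
  have := Complex.continuous_re.comp
    (continuous_kernel_snd (contDiffOn_poissonKernel (n := n) α).continuousOn hx)
  exact this

theorem poissonIntegral_comp_orthogonal {n : ℕ} (α : ℝ) (h : Sph n → ℂ) (U : E n ≃ₗᵢ[ℝ] E n)
    (x : E n) : poissonIntegral α h (U x) = poissonIntegral α (h ∘ sphOrthogonal U) x := by
  rw [poissonIntegral, ← (measurePreserving_sphOrthogonal U).integral_comp
    (sphOrthogonal U).measurableEmbedding]
  refine integral_congr_ae (Eventually.of_forall fun ζ => ?_)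
  change _ • ((poissonKernel α (U x) (U ζ) : ℝ) : ℂ) = _
  rw [poissonKernel_map]
  rfl

/-- The Poisson kernels have total mass one. -/
theorem poissonIntegral_one {n : ℕ} (hn : 0 < n) {α : ℝ} (hα : IsPoissonExponent n α) {x : E n}
    (hx : x ∈ ball (0 : E n) 1) : poissonIntegral α (fun _ => 1) x = 1 := by
  have := isProbabilityMeasure_sphereMeasure hn
  have hx1 := mem_ball_zero_iff.1 hx
  have hL := solvesL_poissonIntegral hα.2 (integrable_const (1 : ℂ) (μ := sphereMeasure n))
  set u := poissonIntegral (n := n) α (fun _ => 1) with hu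
  have h0 : u 0 = 1 := by
    rw [hu, poissonIntegral]
    simp [poissonKernel_zero]
  have hsub : closedBall (0 : E n) ‖x‖ ⊆ ball 0 1 := closedBall_subset_ball hx1
  -- By rotation invariance the integral depends only on `|x|`: a reflection exchanges any two
  -- points of the same norm. It is therefore constant on the sphere of radius `|x|`, hence on the
  -- ball inside by uniqueness, and equal to its value `1` at the centre.
  have h1 := SolvesL.eq_zero_of_boundary hn (κ := α - 1) (R := ‖x‖) (u := fun y => u y - u x)
    (by linarith [hα.1]) hx1.le ((hL.1.continuousOn.mono hsub).sub continuousOn_const)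
    ((hL.mono hx1.le).sub (solvesL_const _ _ _)) (fun y hy => by
      have e := Submodule.reflection_sub (v := x) (w := y) (mem_sphere_zero_iff_norm.1 hy).symm
      rw [sub_eq_zero, ← e, hu, poissonIntegral_comp_orthogonal]
      rfl) 0 (by simp)
  rw [h0] at h1
  exact (sub_eq_zero.1 h1).symm

theorem integral_poissonKernel {n : ℕ} (hn : 0 < n) {α : ℝ} (hα : IsPoissonExponent n α) {x : E n}
    (hx : x ∈ ball (0 : E n) 1) : ∫ ζ : Sph n, poissonKernel α x ζ ∂sphereMeasure n = 1 := by
  have h := poissonIntegral_one hn hα hx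
  simp only [poissonIntegral, one_smul] at h
  rw [integral_complex_ofReal] at h
  exact_mod_cast h

theorem norm_poissonIntegral_le {n : ℕ} (hn : 0 < n) {α : ℝ} (hα : IsPoissonExponent n α)
    {h : Sph n → ℂ} {M : ℝ} (hM : ∀ ζ, ‖h ζ‖ ≤ M) {x : E n} (hx : x ∈ ball (0 : E n) 1) :
    ‖poissonIntegral α h x‖ ≤ M := by
  have e : ∫ ζ : Sph n, M * poissonKernel α x ζ ∂sphereMeasure n = M := by
    rw [integral_const_mul, integral_poissonKernel hn hα hx, mul_one]
  rw [← e]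
  refine norm_integral_le_of_norm_le
    ((integrable_of_continuous_sph (continuous_poissonKernel_snd α hx)).const_mul M)
    (Eventually.of_forall fun ζ => ?_)
  have h0 := poissonKernel_nonneg α (mem_ball_zero_iff.1 hx).le (ζ : E n)
  rw [norm_smul, Complex.norm_real, Real.norm_of_nonneg h0]
  exact mul_le_mul_of_nonneg_right (hM ζ) h0

/-- The kernels form an approximate identity: they are nonnegative, have mass one, and tend to zero
uniformly away from `ζ` because of the factor `(1-|x|²)^α`. -/
theorem tendsto_poissonIntegral {n : ℕ} (hn : 0 < n) {α : ℝ} (hα : IsPoissonExponent n α)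
    {h : Sph n → ℂ} (hh : Continuous h) (ζ : Sph n) :
    Tendsto (poissonIntegral α h) (𝓝[ball 0 1] (ζ : E n)) (𝓝 (h ζ)) := by
  have hα0 : 0 < α := by linarith [hα.1]
  have hn1 : (1 : ℝ) ≤ n := by exact_mod_cast hn
  have hb : ∀ᶠ x in 𝓝[ball 0 1] (ζ : E n), x ∈ ball (0 : E n) 1 := eventually_mem_nhdsWithin
  have key := tendsto_integral_peak_smul_of_integrable_of_tendsto (μ := sphereMeasure n)
    (φ := fun (x : E n) (η : Sph n) => poissonKernel α x η) (l := nhdsWithin (ζ : E n) (ball (0 : E n) 1))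
    (x₀ := ζ) (g := h) (a := h ζ) (t := Set.univ) MeasurableSet.univ univ_mem
    (measure_ne_top _ _) ?_ ?_ ?_ ?_ (integrable_of_continuous_sph hh) hh.continuousAt
  · refine key.congr fun x => ?_
    refine integral_congr_ae (Eventually.of_forall fun η => ?_)
    simp only [Complex.real_smul, smul_eq_mul, mul_comm]
  · filter_upwards [hb] with x hx η using poissonKernel_nonneg α (mem_ball_zero_iff.1 hx).le _
  · intro V hV hζV
    obtain ⟨δ, hδ, hδV⟩ := Metric.isOpen_iff.1 hV ζ hζV
    rw [Metric.tendstoUniformlyOn_iff]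
    intro ε hε
    have hlim : Tendsto (fun x : E n => (1 - ‖x‖ ^ 2) ^ α * ((δ / 2) ^ 2) ^ (-((n - 1 + α) / 2)))
        (𝓝[ball 0 1] (ζ : E n)) (𝓝 0) := by
      have hc : ContinuousAt (fun x : E n => (1 - ‖x‖ ^ 2) ^ α *
          ((δ / 2) ^ 2) ^ (-((n - 1 + α) / 2))) (ζ : E n) := by
        refine ContinuousAt.mul ?_ continuousAt_const
        exact ContinuousAt.rpow_const (by fun_prop) (Or.inr hα0.le)
      have := hc.tendsto.mono_left (nhdsWithin_le_nhds (a := (ζ : E n)) (s := ball (0 : E n) 1))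
      simpa [norm_coe_sph, Real.zero_rpow hα0.ne'] using this
    have hnear : ∀ᶠ x : E n in 𝓝[ball 0 1] (ζ : E n), dist x (ζ : E n) < δ / 2 :=
      nhdsWithin_le_nhds (ball_mem_nhds _ (by positivity))
    filter_upwards [hb, hlim.eventually (gt_mem_nhds hε), hnear] with x hx hx2 hx3 η hη
    have hx1 := mem_ball_zero_iff.1 hx
    have hfar : δ / 2 ≤ ‖x - η‖ := by
      have h1 : δ ≤ dist η ζ := by
        by_contra! hlt
        exact hη (hδV hlt)
      have h2 : dist (η : E n) ζ ≤ dist (η : E n) x + dist x ζ := dist_triangle _ _ _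
      rw [Subtype.dist_eq] at h1
      rw [← dist_eq_norm, dist_comm]
      linarith
    rw [Pi.zero_apply, dist_zero_left, Real.norm_of_nonneg (poissonKernel_nonneg α hx1.le _)]
    refine lt_of_le_of_lt ?_ hx2
    rw [poissonKernel]
    refine mul_le_mul_of_nonneg_left ?_ (Real.rpow_nonneg (one_sub_normSq_pos hx1).le _)
    refine Real.rpow_le_rpow_of_nonpos (by positivity) (by gcongr) ?_
    linarith
  · refine (tendsto_const_nhds (x := (1 : ℝ))).congr' ?_
    filter_upwards [hb] with x hx
    rw [Measure.restrict_univ, integral_poissonKernel hn hα hx]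
  · filter_upwards [hb] with x hx
    exact (continuous_poissonKernel_snd α hx).aestronglyMeasurable

open Classical in
/-- The solution of the Dirichlet problem with boundary values `h`. -/
def poissonExtension {n : ℕ} (α : ℝ) (h : Sph n → ℂ) (x : E n) : ℂ :=
  if hx : x ∈ sphere (0 : E n) 1 then h ⟨x, hx⟩ else poissonIntegral α h x

theorem poissonExtension_coe {n : ℕ} (α : ℝ) (h : Sph n → ℂ) (ζ : Sph n) :
    poissonExtension α h ζ = h ζ := by
  rw [poissonExtension, dif_pos ζ.2]

theorem poissonExtension_of_mem_ball {n : ℕ} (α : ℝ) (h : Sph n → ℂ) {x : E n}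
    (hx : x ∈ ball (0 : E n) 1) : poissonExtension α h x = poissonIntegral α h x := by
  rw [poissonExtension, dif_neg]
  intro hx'
  exact absurd (mem_sphere_zero_iff_norm.1 hx') (mem_ball_zero_iff.1 hx).ne

theorem solvesL_poissonExtension {n : ℕ} {α : ℝ} (hα : IsPoissonExponent n α)
    {h : Sph n → ℂ} (hh : Integrable h (sphereMeasure n)) :
    SolvesL (α - 1) 1 (poissonExtension α h) :=
  (solvesL_poissonIntegral hα.2 hh).congr fun _ hx => poissonExtension_of_mem_ball α h hx

theorem continuousOn_poissonExtension {n : ℕ} (hn : 0 < n) {α : ℝ} (hα : IsPoissonExponent n α)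
    {h : Sph n → ℂ} (hh : Continuous h) :
    ContinuousOn (poissonExtension α h) (closedBall 0 1) := by
  have hb : ContinuousOn (poissonExtension α h) (ball 0 1) :=
    (solvesL_poissonExtension hα (integrable_of_continuous_sph hh)).1.continuousOn
  rw [← ball_union_sphere]
  intro x hx
  rcases hx with hx | hx
  · exact (hb.continuousAt (isOpen_ball.mem_nhds hx)).continuousWithinAt
  · refine ContinuousWithinAt.union ?_ ?_
    · have h1 := tendsto_poissonIntegral hn hα hh ⟨x, hx⟩
      rw [← poissonExtension_coe α h ⟨x, hx⟩] at h1
      refine h1.congr' ?_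
      filter_upwards [eventually_mem_nhdsWithin] with y hy
      exact (poissonExtension_of_mem_ball α h hy).symm
    · have h2 : ContinuousOn (poissonExtension α h) (sphere 0 1) := by
        rw [continuousOn_iff_continuous_domRestrict]
        convert hh using 1
        funext ζ
        exact poissonExtension_coe α h ζ
      exact h2 x hx

/-- Poisson's formula. -/
theorem SolvesL.eq_poissonIntegral {n : ℕ} (hn : 0 < n) {α : ℝ} (hα : IsPoissonExponent n α)
    {f : E n → ℂ} (hc : ContinuousOn f (closedBall 0 1)) (hL : SolvesL (α - 1) 1 f) {x : E n}
    (hx : x ∈ ball (0 : E n) 1) : f x = poissonIntegral α (fun ζ => f ζ) x := by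
  have hh : Continuous fun ζ : Sph n => f ζ :=
    hc.comp_continuous continuous_subtype_val fun ζ => sphere_subset_closedBall ζ.2
  have h := SolvesL.eq_zero_of_boundary hn (by linarith [hα.1]) le_rfl
    (hc.sub (continuousOn_poissonExtension hn hα hh))
    (hL.sub (solvesL_poissonExtension hα (integrable_of_continuous_sph hh)))
    (fun y hy => by
      simp only [Pi.sub_apply]
      rw [poissonExtension_coe α (fun ζ : Sph n => f ζ) ⟨y, hy⟩, sub_self]) x
    (ball_subset_closedBall hx)
  rw [← poissonExtension_of_mem_ball α _ hx]
  exact sub_eq_zero.1 h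

theorem isHHarmonic_iff_solvesL {n : ℕ} {f : E n → ℂ} :
    IsHHarmonic n f ↔ SolvesL ((n : ℝ) - 1 - 1) 1 f := by
  refine and_congr_right fun _ => forall₂_congr fun x hx => ?_
  have : ((1 - ‖x‖ ^ 2 : ℝ) : ℂ) ≠ 0 :=
    Complex.ofReal_ne_zero.2 (one_sub_normSq_pos (mem_ball_zero_iff.1 hx)).ne'
  rw [hypLaplacian, mul_eq_zero, or_iff_right this]
  have e : (((n : ℝ) - 1 - 1 : ℝ) : ℂ) = (n : ℂ) - 2 := by push_cast; ring
  rw [e]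

/-! ### Polynomials as functions on `ℝⁿ` -/

section Poly

variable {n : ℕ}

/-- The polynomial function on `ℝⁿ` defined by a polynomial with complex coefficients. -/
def evalPoly (P : MvPolynomial (Fin n) ℂ) (x : E n) : ℂ :=
  MvPolynomial.eval (fun i => (x i : ℂ)) P

/-- The Laplacian of polynomials. -/
def polyLaplacian (n : ℕ) : MvPolynomial (Fin n) ℂ →ₗ[ℂ] MvPolynomial (Fin n) ℂ :=
  ∑ i, (MvPolynomial.pderiv i).toLinearMap ∘ₗ (MvPolynomial.pderiv i).toLinearMap

theorem polyLaplacian_apply (P : MvPolynomial (Fin n) ℂ) :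
    polyLaplacian n P = ∑ i, MvPolynomial.pderiv i (MvPolynomial.pderiv i P) := by
  simp [polyLaplacian]

theorem isHarmonicPoly_iff {m : ℕ} {P : MvPolynomial (Fin n) ℂ} :
    IsHarmonicPoly n m P ↔ P.IsHomogeneous m ∧ polyLaplacian n P = 0 := by
  rw [IsHarmonicPoly, polyLaplacian_apply]

/-- The `i`-th coordinate as a complex valued functional. -/
def coordCLM (i : Fin n) : E n →L[ℝ] ℂ := Complex.ofRealCLM.comp (EuclideanSpace.proj i)

theorem coordCLM_apply (i : Fin n) (x : E n) : coordCLM i x = x i := rfl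

theorem hasFDerivAt_evalPoly (P : MvPolynomial (Fin n) ℂ) (x : E n) :
    HasFDerivAt (evalPoly P) (∑ i, evalPoly (MvPolynomial.pderiv i P) x • coordCLM i) x := by
  induction P using MvPolynomial.induction_on with
  | C a =>
    have : evalPoly (MvPolynomial.C a : MvPolynomial (Fin n) ℂ) = fun _ => a := by
      funext y; simp [evalPoly]
    rw [this]
    refine (hasFDerivAt_const a x).congr_fderiv (Finset.sum_eq_zero fun i _ => ?_).symm
    rw [MvPolynomial.pderiv_C, evalPoly, map_zero]
    exact ContinuousLinearMap.ext fun v => zero_mul (coordCLM i v)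
  | add p q hp hq =>
    have : evalPoly (p + q) = fun y => evalPoly p y + evalPoly q y := by
      funext y; simp [evalPoly]
    rw [this]
    refine (hp.add hq).congr_fderiv ?_
    rw [← Finset.sum_add_distrib]
    refine Finset.sum_congr rfl fun i _ => ?_
    rw [← add_smul]
    simp [evalPoly]
  | mul_X p j hp =>
    have : evalPoly (p * MvPolynomial.X j) = fun y => evalPoly p y * coordCLM j y := by
      funext y; simp [evalPoly, coordCLM_apply]
    rw [this]
    refine (hp.mul (coordCLM j).hasFDerivAt).congr_fderiv ?_
    have e : ∀ i, evalPoly (MvPolynomial.pderiv i (p * MvPolynomial.X j)) x • coordCLM i =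
        coordCLM j x • (evalPoly (MvPolynomial.pderiv i p) x • coordCLM i) +
        (if i = j then evalPoly p x • coordCLM i else 0) := by
      intro i
      rw [MvPolynomial.pderiv_mul, MvPolynomial.pderiv_X]
      by_cases h : i = j
      · subst h
        simp only [evalPoly, map_add, map_mul, MvPolynomial.eval_X, Pi.single_eq_same,
          mul_one, if_true, smul_smul, coordCLM_apply, mul_comm]
        exact ContinuousLinearMap.ext fun v => add_mul _ _ (coordCLM i v)
      · simp only [evalPoly, map_mul, MvPolynomial.eval_X, Pi.single_eq_of_ne (Ne.symm h),
          mul_zero, add_zero, h, if_false, smul_smul, coordCLM_apply, mul_comm]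
    simp only [e, Finset.sum_add_distrib, Finset.sum_ite_eq', Finset.mem_univ, if_true,
      ← Finset.smul_sum]
    rw [add_comm]

theorem contDiff_evalPoly (P : MvPolynomial (Fin n) ℂ) : ContDiff ℝ ⊤ (evalPoly P) := by
  induction P using MvPolynomial.induction_on with
  | C a =>
    have : evalPoly (MvPolynomial.C a : MvPolynomial (Fin n) ℂ) = fun _ => a := by
      funext y; simp [evalPoly]
    rw [this]
    exact contDiff_const
  | add p q hp hq =>
    have : evalPoly (p + q) = fun y => evalPoly p y + evalPoly q y := by
      funext y; simp [evalPoly]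
    rw [this]
    exact hp.add hq
  | mul_X p j hp =>
    have : evalPoly (p * MvPolynomial.X j) = fun y => evalPoly p y * coordCLM j y := by
      funext y; simp [evalPoly, coordCLM_apply]
    rw [this]
    exact hp.mul (coordCLM j).contDiff

theorem fderiv_evalPoly_basisFun (P : MvPolynomial (Fin n) ℂ) (x : E n) (i : Fin n) :
    fderiv ℝ (evalPoly P) x (EuclideanSpace.basisFun (Fin n) ℝ i) =
      evalPoly (MvPolynomial.pderiv i P) x := by
  rw [(hasFDerivAt_evalPoly P x).fderiv]
  simp [coordCLM_apply, PiLp.single_apply, apply_ite]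

theorem laplacian_evalPoly (P : MvPolynomial (Fin n) ℂ) (x : E n) :
    Laplacian.laplacian (evalPoly P) x = evalPoly (polyLaplacian n P) x := by
  rw [laplacian_eq_sum_fderiv, polyLaplacian_apply, evalPoly, map_sum]
  refine Finset.sum_congr rfl fun i _ => ?_
  change _ = evalPoly _ x
  rw [← fderiv_evalPoly_basisFun]
  have h1 : DifferentiableAt ℝ (fderiv ℝ (evalPoly P)) x :=
    ((contDiff_evalPoly P).fderiv_right (m := 1) (by simp)).contDiffAt.differentiableAt (by simp)
  have h2 : evalPoly (MvPolynomial.pderiv i P) =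
      fun y => fderiv ℝ (evalPoly P) y (EuclideanSpace.basisFun (Fin n) ℝ i) :=
    funext fun y => (fderiv_evalPoly_basisFun P y i).symm
  rw [h2, (h1.hasFDerivAt.clm_apply (hasFDerivAt_const _ x)).fderiv]
  simp

theorem solvesL_evalPoly {P : MvPolynomial (Fin n) ℂ} (hP : polyLaplacian n P = 0) :
    SolvesL (1 - 1) 1 (evalPoly P) := by
  refine ⟨((contDiff_evalPoly P).of_le le_top).contDiffOn, fun x _ => ?_⟩
  rw [laplacian_evalPoly, hP]
  simp [evalPoly]

theorem evalPoly_smul {m : ℕ} {P : MvPolynomial (Fin n) ℂ} (hP : P.IsHomogeneous m) (r : ℝ)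
    (x : E n) : evalPoly P (r • x) = (r : ℂ) ^ m * evalPoly P x := by
  rw [evalPoly, evalPoly, MvPolynomial.eval_eq', MvPolynomial.eval_eq', Finset.mul_sum]
  refine Finset.sum_congr rfl fun d hd => ?_
  have h : ∑ i, d i = m := by
    rw [hP.degree_eq_sum_deg_support hd]
    refine (Finset.sum_subset (Finset.subset_univ _) fun i _ hi => ?_).symm
    simpa using hi
  simp only [PiLp.smul_apply, smul_eq_mul, Complex.ofReal_mul, mul_pow, Finset.prod_mul_distrib,
    Finset.prod_pow_eq_pow_sum, h]
  ring

/-- The Euclidean Poisson integral followed by dilation has the spherical harmonics of degree `m` as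
eigenfunctions with eigenvalue `r^m`. Both the orthogonality of different degrees and the
eigenvalues of the logarithmic kernel come from this. -/
theorem poissonIntegral_evalPoly (hn : 0 < n) {m : ℕ} {P : MvPolynomial (Fin n) ℂ}
    (hP : IsHarmonicPoly n m P) {r : ℝ} (hr0 : 0 ≤ r) (hr : r < 1) (ζ : Sph n) :
    poissonIntegral 1 (fun η => evalPoly P η) (r • (ζ : E n)) = (r : ℂ) ^ m * evalPoly P ζ := by
  rw [← evalPoly_smul hP.1]
  refine ((solvesL_evalPoly (isHarmonicPoly_iff.1 hP).2).eq_poissonIntegral hn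
    (isPoissonExponent_one n) (contDiff_evalPoly P).continuous.continuousOn ?_).symm
  rwa [mem_ball_zero_iff, norm_smul, norm_coe_sph, mul_one, Real.norm_of_nonneg hr0]

/-! #### Every polynomial agrees on the sphere with a harmonic one -/

theorem coeff_pderiv_pderiv (P : MvPolynomial (Fin n) ℂ) (i : Fin n) (d : Fin n →₀ ℕ) :
    MvPolynomial.coeff d (MvPolynomial.pderiv i (MvPolynomial.pderiv i P)) =
      MvPolynomial.coeff (d + Finsupp.single i 1 + Finsupp.single i 1) P *
        (((d + Finsupp.single i 1 : Fin n →₀ ℕ) i : ℂ) + 1) * ((d i : ℂ) + 1) := by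
  rw [MvPolynomial.coeff_pderiv, MvPolynomial.coeff_pderiv]

theorem degree_add_single_add_single (d : Fin n →₀ ℕ) (i : Fin n) :
    (d + Finsupp.single i 1 + Finsupp.single i 1).degree = d.degree + 2 := by
  simp [map_add, Finsupp.degree_single]

theorem polyLaplacian_homogeneousComponent {P : MvPolynomial (Fin n) ℂ}
    (hP : polyLaplacian n P = 0) (k : ℕ) :
    polyLaplacian n (MvPolynomial.homogeneousComponent k P) = 0 := by
  ext d
  have h := congrArg (MvPolynomial.coeff d) hP
  rw [polyLaplacian_apply, MvPolynomial.coeff_sum] at h ⊢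
  simp only [coeff_pderiv_pderiv, MvPolynomial.coeff_homogeneousComponent,
    degree_add_single_add_single] at h ⊢
  split_ifs with hk
  · exact h
  · simp

theorem mem_restrictTotalDegree_iff {d : ℕ} {P : MvPolynomial (Fin n) ℂ} :
    P ∈ MvPolynomial.restrictTotalDegree (Fin n) ℂ d ↔
      ∀ s : Fin n →₀ ℕ, d < s.degree → MvPolynomial.coeff s P = 0 := by
  rw [MvPolynomial.mem_restrictTotalDegree]
  constructor
  · intro h s hs
    exact MvPolynomial.coeff_eq_zero_of_totalDegree_lt (lt_of_le_of_lt h hs)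
  · intro h
    refine Finset.sup_le fun s hs => ?_
    by_contra! hlt
    exact MvPolynomial.mem_support_iff.1 hs (h s hlt)

theorem polyLaplacian_mem_restrictTotalDegree {d : ℕ} {P : MvPolynomial (Fin n) ℂ}
    (hP : P ∈ MvPolynomial.restrictTotalDegree (Fin n) ℂ (d + 2)) :
    polyLaplacian n P ∈ MvPolynomial.restrictTotalDegree (Fin n) ℂ d := by
  rw [mem_restrictTotalDegree_iff] at hP ⊢
  intro s hs
  rw [polyLaplacian_apply, MvPolynomial.coeff_sum]
  refine Finset.sum_eq_zero fun i _ => ?_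
  rw [coeff_pderiv_pderiv, hP _ (by rw [degree_add_single_add_single]; omega), zero_mul, zero_mul]

/-- The polynomial `1 - |x|²`. -/
def oneSubNormSqPoly (n : ℕ) : MvPolynomial (Fin n) ℂ := 1 - ∑ i, MvPolynomial.X i ^ 2

theorem evalPoly_oneSubNormSqPoly (x : E n) :
    evalPoly (oneSubNormSqPoly n) x = ((1 - ‖x‖ ^ 2 : ℝ) : ℂ) := by
  rw [EuclideanSpace.real_norm_sq_eq]
  simp [evalPoly, oneSubNormSqPoly]

theorem evalPoly_mul (P Q : MvPolynomial (Fin n) ℂ) (x : E n) :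
    evalPoly (P * Q) x = evalPoly P x * evalPoly Q x := map_mul _ _ _

theorem totalDegree_oneSubNormSqPoly_le : (oneSubNormSqPoly n).totalDegree ≤ 2 := by
  refine (MvPolynomial.totalDegree_sub _ _).trans (max_le (by simp) ?_)
  refine MvPolynomial.totalDegree_finsetSum_le fun i _ => ?_
  simp

/-- A polynomial vanishing on a product of infinite sets is zero, and the cube `(0,1/n)^n` lies in
the ball. -/
theorem eq_zero_of_evalPoly_eq_zero (hn : 0 < n) {Q : MvPolynomial (Fin n) ℂ}
    (hQ : ∀ x ∈ ball (0 : E n) 1, evalPoly Q x = 0) : Q = 0 := by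
  have hn' : (0 : ℝ) < n := by exact_mod_cast hn
  refine MvPolynomial.funext_set (fun _ => (fun t : ℝ => (t : ℂ)) '' Set.Ioo 0 ((n : ℝ)⁻¹))
    (fun _ => (Set.Ioo_infinite (by positivity)).image
      Complex.ofReal_injective.injOn) fun y hy => ?_
  choose x hx hxy using fun i => hy i (Set.mem_univ i)
  have h := hQ (WithLp.toLp 2 x) ?_
  · rw [map_zero, ← h, evalPoly]
    congr 2
    funext i
    exact (hxy i).symm
  · rw [mem_ball_zero_iff, ← sq_lt_one_iff₀ (norm_nonneg _), EuclideanSpace.real_norm_sq_eq]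
    have h1 : ∀ i, x i ^ 2 < (n : ℝ)⁻¹ := by
      intro i
      have h2 : (n : ℝ)⁻¹ ≤ 1 := inv_le_one_of_one_le₀ (by exact_mod_cast hn)
      nlinarith [(hx i).1, (hx i).2]
    calc ∑ i, x i ^ 2 < ∑ _i : Fin n, (n : ℝ)⁻¹ :=
          Finset.sum_lt_sum_of_nonempty ⟨⟨0, hn⟩, Finset.mem_univ _⟩ fun i _ => h1 i
      _ = 1 := by simp [hn'.ne']

/-- The map `Q ↦ Δ((1-|x|²)Q)` sends polynomials of degree at most `d` to such polynomials. It is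
injective, because a harmonic function vanishing on the sphere is zero, hence surjective by finite
dimension. Solving `Δ((1-|x|²)Q) = ΔP` makes `P - (1-|x|²)Q` harmonic without changing it on the
sphere. -/
theorem exists_harmonic_eq_on_sphere (hn : 0 < n) (P : MvPolynomial (Fin n) ℂ) :
    ∃ H : MvPolynomial (Fin n) ℂ, polyLaplacian n H = 0 ∧
      ∀ ζ : Sph n, evalPoly H ζ = evalPoly P ζ := by
  set d := P.totalDegree
  set W := MvPolynomial.restrictTotalDegree (Fin n) ℂ d
  have hmul : ∀ Q ∈ W, oneSubNormSqPoly n * Q ∈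
      MvPolynomial.restrictTotalDegree (Fin n) ℂ (d + 2) := by
    intro Q hQ
    rw [MvPolynomial.mem_restrictTotalDegree]
    have h1 := MvPolynomial.totalDegree_mul (oneSubNormSqPoly n) Q
    have h2 := totalDegree_oneSubNormSqPoly_le (n := n)
    have h3 : Q.totalDegree ≤ d := (MvPolynomial.mem_restrictTotalDegree _ _ _).1 hQ
    omega
  let T : W →ₗ[ℂ] W := ((polyLaplacian n ∘ₗ LinearMap.mulLeft ℂ (oneSubNormSqPoly n)) ∘ₗ
    W.subtype).codRestrict W fun Q => polyLaplacian_mem_restrictTotalDegree (hmul Q Q.2)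
  have hT : ∀ Q : W, ((T Q : W) : MvPolynomial (Fin n) ℂ) =
      polyLaplacian n (oneSubNormSqPoly n * (Q : MvPolynomial (Fin n) ℂ)) := fun Q => rfl
  have hinj : Function.Injective T := by
    rw [← LinearMap.ker_eq_bot, LinearMap.ker_eq_bot']
    intro Q hQ
    have h0 : polyLaplacian n (oneSubNormSqPoly n * (Q : MvPolynomial (Fin n) ℂ)) = 0 := by rw [← hT, hQ]; rfl
    have h1 := SolvesL.eq_zero_of_boundary hn (by norm_num) le_rfl
      (contDiff_evalPoly (oneSubNormSqPoly n * (Q : MvPolynomial (Fin n) ℂ))).continuous.continuousOn (solvesL_evalPoly h0) (fun x hx => by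
        rw [evalPoly_mul, evalPoly_oneSubNormSqPoly, mem_sphere_zero_iff_norm.1 hx]
        simp)
    refine Subtype.ext (eq_zero_of_evalPoly_eq_zero hn fun x hx => ?_)
    have h2 := h1 x (ball_subset_closedBall hx)
    rw [evalPoly_mul, evalPoly_oneSubNormSqPoly] at h2
    refine (mul_eq_zero.1 h2).resolve_left ?_
    exact Complex.ofReal_ne_zero.2 (one_sub_normSq_pos (mem_ball_zero_iff.1 hx)).ne'
  obtain ⟨Q, hQ⟩ := LinearMap.injective_iff_surjective.1 hinj
    ⟨polyLaplacian n P, polyLaplacian_mem_restrictTotalDegree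
      ((MvPolynomial.mem_restrictTotalDegree _ _ _).2 (by omega))⟩
  refine ⟨P - oneSubNormSqPoly n * (Q : MvPolynomial (Fin n) ℂ), ?_, fun ζ => ?_⟩
  · rw [map_sub, ← hT, hQ, sub_self]
  · have : evalPoly (P - oneSubNormSqPoly n * (Q : MvPolynomial (Fin n) ℂ)) (ζ : E n) =
        evalPoly P ζ - evalPoly (oneSubNormSqPoly n * (Q : MvPolynomial (Fin n) ℂ)) (ζ : E n) := map_sub _ _ _
    rw [this, evalPoly_mul, evalPoly_oneSubNormSqPoly, norm_coe_sph]
    simp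

theorem exists_sum_harmonic_eq_on_sphere (hn : 0 < n) (P : MvPolynomial (Fin n) ℂ) :
    ∃ (d : ℕ) (H : ℕ → MvPolynomial (Fin n) ℂ), (∀ m, IsHarmonicPoly n m (H m)) ∧
      ∀ ζ : Sph n, evalPoly P ζ = ∑ m ∈ Finset.range d, evalPoly (H m) ζ := by
  obtain ⟨H, hH, hP⟩ := exists_harmonic_eq_on_sphere hn P
  refine ⟨H.totalDegree + 1, fun m => MvPolynomial.homogeneousComponent m H, fun m =>
    isHarmonicPoly_iff.2 ⟨MvPolynomial.homogeneousComponent_isHomogeneous m H,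
      polyLaplacian_homogeneousComponent hH m⟩, fun ζ => ?_⟩
  rw [← hP]
  conv_lhs => rw [← MvPolynomial.sum_homogeneousComponent H, evalPoly, map_sum]
  rfl

end Poly

/-! ### Hilbert sums of subspaces -/

section HilbertSum

variable {H : Type*} [NormedAddCommGroup H] [InnerProductSpace ℂ H]
  {V : ℕ → Submodule ℂ H} [∀ m, CompleteSpace (V m)]

theorem starProjection_eq_of_hasSum
    (hV : OrthogonalFamily ℂ (fun m => V m) fun m => (V m).subtypeₗᵢ) {v : ℕ → H} {u : H}
    (hv : ∀ m, v m ∈ V m) (hu : HasSum v u) (m : ℕ) : (V m).starProjection u = v m := by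
  have h1 : HasSum (fun k => (V m).starProjection (v k)) ((V m).starProjection u) :=
    hu.mapL (V m).starProjection
  refine h1.unique ?_
  convert hasSum_ite_eq m (v m) using 2 with k
  split_ifs with h
  · rw [h]
    exact Submodule.starProjection_eq_self_iff.2 (hv m)
  · refine (Submodule.starProjection_apply_eq_zero_iff _).2 ?_
    rw [Submodule.mem_orthogonal]
    intro w hw
    exact hV (Ne.symm h) ⟨w, hw⟩ ⟨v k, hv k⟩

theorem hasSum_starProjection [CompleteSpace H]
    (hV : OrthogonalFamily ℂ (fun m => V m) fun m => (V m).subtypeₗᵢ)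
    (hd : (⨆ m, V m).topologicalClosure = ⊤) (u : H) :
    HasSum (fun m => (V m).starProjection u) u := by
  have hI := IsHilbertSum.mkInternal V hV hd.ge
  have h1 := hI.hasSum_linearIsometryEquiv_symm (hI.linearIsometryEquiv u)
  rw [LinearIsometryEquiv.symm_apply_apply] at h1
  convert h1 using 2 with m
  exact starProjection_eq_of_hasSum hV (fun k => (hI.linearIsometryEquiv u k).2) h1 m

theorem hasSum_inner_starProjection [CompleteSpace H]
    (hV : OrthogonalFamily ℂ (fun m => V m) fun m => (V m).subtypeₗᵢ)
    (hd : (⨆ m, V m).topologicalClosure = ⊤) (u v : H) :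
    HasSum (fun m => inner ℂ ((V m).starProjection u) ((V m).starProjection v)) (inner ℂ u v) := by
  have h1 : HasSum (fun m => inner ℂ u ((V m).starProjection v)) (inner ℂ u v) :=
    (hasSum_starProjection hV hd v).mapL (innerSL ℂ u)
  refine (congrArg (fun F => HasSum F _) (funext fun m => ?_)).mpr h1
  rw [Submodule.inner_starProjection_left_eq_right]
  congr 1
  exact Submodule.starProjection_eq_self_iff.2 (Submodule.starProjection_apply_mem _ _)

end HilbertSum

/-! ### Symmetry of the Poisson integral -/

theorem continuous_poissonKernel_smul {n : ℕ} (α : ℝ) {r : ℝ} (hr0 : 0 ≤ r) (hr : r < 1) :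
    Continuous fun p : Sph n × Sph n => ((poissonKernel α (r • (p.1 : E n)) p.2 : ℝ) : ℂ) := by
  refine (contDiffOn_poissonKernel (n := n) α).continuousOn.comp_continuous
    (f := fun p : Sph n × Sph n => (r • (p.1 : E n), (p.2 : E n))) (by fun_prop) fun p => ?_
  refine mem_kernelDomain ?_ p.2
  rwa [mem_ball_zero_iff, norm_smul, norm_coe_sph, mul_one, Real.norm_of_nonneg hr0]

theorem smul_coe_mem_ball {n : ℕ} {r : ℝ} (hr0 : 0 ≤ r) (hr : r < 1) (ζ : Sph n) :
    r • (ζ : E n) ∈ ball (0 : E n) 1 := by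
  rwa [mem_ball_zero_iff, norm_smul, norm_coe_sph, mul_one, Real.norm_of_nonneg hr0]

theorem integrable_poissonKernel_mul {n : ℕ} (α : ℝ) {r : ℝ} (hr0 : 0 ≤ r) (hr : r < 1)
    {h k : Sph n → ℂ} (hh : Integrable h (sphereMeasure n)) (hk : Integrable k (sphereMeasure n)) :
    Integrable (fun p : Sph n × Sph n => k p.1 *
      (h p.2 * ((poissonKernel α (r • (p.1 : E n)) p.2 : ℝ) : ℂ)))
      ((sphereMeasure n).prod (sphereMeasure n)) := by
  have hc := continuous_poissonKernel_smul (n := n) α hr0 hr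
  obtain ⟨C, hC⟩ := isCompact_univ.exists_bound_of_continuousOn hc.continuousOn
  have := (hk.mul_prod hh).mul_bdd hc.aestronglyMeasurable
    (Eventually.of_forall fun p => hC p (Set.mem_univ p))
  simpa only [mul_assoc] using this

/-- Fubini's theorem and the symmetry of the kernel under exchanging `rζ, η` with `rη, ζ`. -/
theorem integral_mul_poissonIntegral_comm {n : ℕ} (α : ℝ) {r : ℝ} (hr0 : 0 ≤ r) (hr : r < 1)
    {h k : Sph n → ℂ} (hh : Integrable h (sphereMeasure n)) (hk : Integrable k (sphereMeasure n)) :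
    ∫ ζ : Sph n, k ζ * poissonIntegral α h (r • (ζ : E n)) ∂sphereMeasure n =
      ∫ ζ : Sph n, h ζ * poissonIntegral α k (r • (ζ : E n)) ∂sphereMeasure n := by
  have hi := integrable_poissonKernel_mul α hr0 hr hh hk
  have h1 := integral_integral_swap (f := fun ζ η : Sph n => k ζ *
      (h η * ((poissonKernel α (r • (ζ : E n)) η : ℝ) : ℂ))) hi
  simp only [integral_const_mul] at h1
  refine h1.trans (integral_congr_ae (Eventually.of_forall fun η => ?_))
  simp only [poissonIntegral, smul_eq_mul, ← integral_const_mul]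
  refine integral_congr_ae (Eventually.of_forall fun ζ => ?_)
  simp only [poissonKernel_smul_comm α r ζ η]
  ring

/-! ### Spherical harmonics -/

/-- The space `L²` of the sphere. -/
abbrev L2 (n : ℕ) := Lp ℂ 2 (sphereMeasure n)

/-- Continuous functions on the sphere, as elements of `L²`. -/
abbrev contL2 {n : ℕ} (h : C(Sph n, ℂ)) : L2 n := ContinuousMap.toLp 2 (sphereMeasure n) ℂ h

/-- The restriction of polynomials to the sphere. -/
def spherePoly (n : ℕ) : MvPolynomial (Fin n) ℂ →ₗ[ℂ] C(Sph n, ℂ) where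
  toFun P := ⟨fun ζ => evalPoly P ζ, (contDiff_evalPoly P).continuous.comp continuous_subtype_val⟩
  map_add' P Q := ContinuousMap.ext fun ζ => by simp [evalPoly]
  map_smul' c P := ContinuousMap.ext fun ζ => by
    simp [evalPoly]

theorem spherePoly_apply {n : ℕ} (P : MvPolynomial (Fin n) ℂ) (ζ : Sph n) :
    spherePoly n P ζ = evalPoly P ζ := rfl

/-- The harmonic polynomials of degree `m`, as a submodule. -/
def harmonicPolys (n m : ℕ) : Submodule ℂ (MvPolynomial (Fin n) ℂ) :=
  MvPolynomial.homogeneousSubmodule (Fin n) ℂ m ⊓ LinearMap.ker (polyLaplacian n)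

theorem mem_harmonicPolys {n m : ℕ} {P : MvPolynomial (Fin n) ℂ} :
    P ∈ harmonicPolys n m ↔ IsHarmonicPoly n m P := by
  rw [isHarmonicPoly_iff]
  rfl

/-- The spherical harmonics of degree `m`. -/
def sphericalHarmonics (n m : ℕ) : Submodule ℂ (L2 n) :=
  (harmonicPolys n m).map
    ((ContinuousMap.toLp 2 (sphereMeasure n) ℂ).toLinearMap ∘ₗ spherePoly n)

theorem mem_sphericalHarmonics {n m : ℕ} {v : L2 n} :
    v ∈ sphericalHarmonics n m ↔ ∃ P, IsHarmonicPoly n m P ∧ contL2 (spherePoly n P) = v := by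
  simp only [sphericalHarmonics, Submodule.mem_map, mem_harmonicPolys]
  rfl

instance finiteDimensional_sphericalHarmonics (n m : ℕ) :
    FiniteDimensional ℂ (sphericalHarmonics n m) := by
  have h1 : FiniteDimensional ℂ (MvPolynomial.homogeneousSubmodule (Fin n) ℂ m) :=
    Module.Finite.iff_fg.2 (MvPolynomial.homogeneousSubmodule_fg _ _ m)
  have h2 : FiniteDimensional ℂ (harmonicPolys n m) :=
    Submodule.finiteDimensional_of_le (inf_le_left)
  unfold sphericalHarmonics
  infer_instance

theorem inner_contL2 {n : ℕ} (h k : C(Sph n, ℂ)) :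
    inner ℂ (contL2 h) (contL2 k) = ∫ ζ, k ζ * (starRingEnd ℂ) (h ζ) ∂sphereMeasure n :=
  ContinuousMap.inner_toLp _ _ _

theorem conj_poissonIntegral {n : ℕ} (α : ℝ) (h : Sph n → ℂ) (x : E n) :
    (starRingEnd ℂ) (poissonIntegral α h x) =
      poissonIntegral α (fun ζ => (starRingEnd ℂ) (h ζ)) x := by
  rw [poissonIntegral, ← integral_conj, poissonIntegral]
  simp

/-- The dilated Poisson integral with `r = 1/2` is a symmetric operator, and different degrees
belong to the different eigenvalues `(1/2)^m`. -/
theorem orthogonalFamily_sphericalHarmonics {n : ℕ} (hn : 0 < n) :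
    OrthogonalFamily ℂ (fun m => sphericalHarmonics n m)
      fun m => (sphericalHarmonics n m).subtypeₗᵢ := by
  rintro m k hmk ⟨v, hv⟩ ⟨w, hw⟩
  obtain ⟨P, hP, rfl⟩ := mem_sphericalHarmonics.1 hv
  obtain ⟨Q, hQ, rfl⟩ := mem_sphericalHarmonics.1 hw
  change inner ℂ (contL2 (spherePoly n P)) (contL2 (spherePoly n Q)) = 0
  rw [inner_contL2]
  have hr0 : (0 : ℝ) ≤ 1 / 2 := by norm_num
  have hr : (1 / 2 : ℝ) < 1 := by norm_num
  have h1 := integral_mul_poissonIntegral_comm 1 hr0 hr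
    (h := fun ζ : Sph n => (starRingEnd ℂ) (evalPoly P ζ)) (k := fun ζ : Sph n => evalPoly Q ζ)
    (integrable_of_continuous_sph (Complex.continuous_conj.comp (spherePoly n P).continuous))
    (integrable_of_continuous_sph (spherePoly n Q).continuous)
  simp only [← conj_poissonIntegral, poissonIntegral_evalPoly hn hP hr0 hr,
    poissonIntegral_evalPoly hn hQ hr0 hr, map_mul, map_pow, Complex.conj_ofReal] at h1
  set I := ∫ ζ, (spherePoly n Q) ζ * (starRingEnd ℂ) ((spherePoly n P) ζ) ∂sphereMeasure n with hI
  have e1 : ∫ ζ : Sph n, evalPoly Q (ζ : E n) * ((((1 / 2 : ℝ) : ℂ)) ^ m *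
      (starRingEnd ℂ) (evalPoly P ζ)) ∂sphereMeasure n = (((1 / 2 : ℝ) : ℂ)) ^ m * I := by
    rw [hI, ← integral_const_mul]
    refine integral_congr_ae (Eventually.of_forall fun ζ => ?_)
    simp only [spherePoly_apply]
    ring
  have e2 : ∫ ζ : Sph n, (starRingEnd ℂ) (evalPoly P ζ) * ((((1 / 2 : ℝ) : ℂ)) ^ k *
      evalPoly Q (ζ : E n)) ∂sphereMeasure n = (((1 / 2 : ℝ) : ℂ)) ^ k * I := by
    rw [hI, ← integral_const_mul]
    refine integral_congr_ae (Eventually.of_forall fun ζ => ?_)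
    simp only [spherePoly_apply]
    ring
  rw [e1, e2, ← sub_eq_zero, ← sub_mul] at h1
  refine (mul_eq_zero.1 h1).resolve_left ?_
  refine sub_ne_zero.2 ?_
  rw [← Complex.ofReal_pow, ← Complex.ofReal_pow, Ne, Complex.ofReal_inj]
  exact fun h => hmk (pow_right_injective₀ (by norm_num) (by norm_num) h)

/-- The algebra of polynomial functions on the sphere. -/
def spherePolyAlgebra (n : ℕ) : StarSubalgebra ℂ C(Sph n, ℂ) where
  carrier := Set.range (spherePoly n)
  mul_mem' := by
    rintro _ _ ⟨P, rfl⟩ ⟨Q, rfl⟩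
    exact ⟨P * Q, ContinuousMap.ext fun ζ => evalPoly_mul P Q ζ⟩
  add_mem' := by
    rintro _ _ ⟨P, rfl⟩ ⟨Q, rfl⟩
    exact ⟨P + Q, map_add _ _ _⟩
  algebraMap_mem' c := ⟨MvPolynomial.C c, ContinuousMap.ext fun ζ => by
    simp [spherePoly_apply, evalPoly]⟩
  star_mem' := by
    rintro _ ⟨P, rfl⟩
    refine ⟨MvPolynomial.map (starRingEnd ℂ) P, ContinuousMap.ext fun ζ => ?_⟩
    change evalPoly _ _ = (starRingEnd ℂ) (evalPoly P ζ)
    rw [evalPoly, MvPolynomial.eval_map, evalPoly, MvPolynomial.eval, MvPolynomial.coe_eval₂Hom,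
      MvPolynomial.hom_eval₂]
    simp

/-- Polynomials are dense by Stone–Weierstrass, and on the sphere each of them is a sum of
homogeneous harmonic ones. -/
theorem topologicalClosure_iSup_sphericalHarmonics {n : ℕ} (hn : 0 < n) :
    (⨆ m, sphericalHarmonics n m).topologicalClosure = ⊤ := by
  have h1 : (spherePolyAlgebra n).topologicalClosure = ⊤ := by
    refine ContinuousMap.starSubalgebra_topologicalClosure_eq_top_of_separatesPoints _ ?_
    intro ζ η h
    obtain ⟨i, hi⟩ : ∃ i, (ζ : E n) i ≠ (η : E n) i := by
      by_contra! hcon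
      exact h (Subtype.ext (PiLp.ext hcon))
    refine ⟨_, ⟨spherePoly n (MvPolynomial.X i), ⟨_, rfl⟩, rfl⟩, ?_⟩
    simpa [spherePoly_apply, evalPoly] using hi
  have h2 : (LinearMap.range (spherePoly n)).topologicalClosure = ⊤ :=
    congrArg (fun A : StarSubalgebra ℂ C(Sph n, ℂ) => Subalgebra.toSubmodule A.toSubalgebra) h1
  have h3 := (ContinuousMap.toLp_denseRange ℂ (sphereMeasure n) ℂ
    (p := 2) (by simp)).topologicalClosure_map_submodule h2
  rw [eq_top_iff, ← h3]
  refine Submodule.topologicalClosure_mono ?_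
  rintro _ ⟨_, ⟨P, rfl⟩, rfl⟩
  obtain ⟨d, F, hF, hP⟩ := exists_sum_harmonic_eq_on_sphere hn P
  have e : spherePoly n P = ∑ m ∈ Finset.range d, spherePoly n (F m) := by
    refine ContinuousMap.ext fun ζ => ?_
    rw [ContinuousMap.sum_apply]
    exact hP ζ
  rw [e, map_sum]
  exact Submodule.sum_mem _ fun m _ => Submodule.mem_iSup_of_mem m
    (mem_sphericalHarmonics.2 ⟨F m, hF m, rfl⟩)

/-- The orthogonal projection onto the spherical harmonics of degree `m`. -/
def harmProj {n : ℕ} (m : ℕ) : L2 n →L[ℂ] L2 n := (sphericalHarmonics n m).starProjection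

/-! ### The logarithmic kernel as an average of Poisson kernels -/

theorem integral_pow_mul_one_sub_pow (m k : ℕ) :
    ∫ r in (0 : ℝ)..1, r ^ m * (1 - r) ^ k =
      (m.factorial * k.factorial / (m + k + 1).factorial : ℝ) := by
  induction k generalizing m with
  | zero =>
    simp only [pow_zero, mul_one, integral_pow, one_pow, add_zero, Nat.factorial_succ,
      Nat.factorial_zero]
    have := (Nat.cast_pos (α := ℝ)).2 (Nat.factorial_pos m)
    push_cast
    field_simp
    ring
  | succ k ih =>
    have h1 : ∀ r ∈ Set.uIcc (0 : ℝ) 1, HasDerivAt (fun r : ℝ => r ^ (m + 1) * (1 - r) ^ (k + 1))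
        ((m + 1) * (r ^ m * (1 - r) ^ (k + 1)) - (k + 1) * (r ^ (m + 1) * (1 - r) ^ k)) r := by
      intro r _
      have := ((hasDerivAt_id r).pow (m + 1)).mul (((hasDerivAt_id r).const_sub 1).pow (k + 1))
      refine this.congr_deriv ?_
      simp
      ring
    have h2 := intervalIntegral.integral_eq_sub_of_hasDerivAt h1
      (Continuous.intervalIntegrable (by fun_prop) _ _)
    rw [intervalIntegral.integral_sub (Continuous.intervalIntegrable (by fun_prop) _ _)
      (Continuous.intervalIntegrable (by fun_prop) _ _), intervalIntegral.integral_const_mul,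
      intervalIntegral.integral_const_mul, ih] at h2
    simp only [one_pow, sub_self, ne_eq, Nat.add_eq_zero_iff, one_ne_zero, and_false,
      not_false_eq_true, zero_pow, mul_zero, zero_mul] at h2
    have hm : (0 : ℝ) < m + 1 := by positivity
    rw [sub_eq_zero] at h2
    rw [show m + (k + 1) + 1 = m + 1 + k + 1 by ring]
    have h3 : ((m + 1).factorial : ℝ) = (m + 1) * m.factorial := by
      rw [Nat.factorial_succ]; push_cast; ring
    have h4 : ((k + 1).factorial : ℝ) = (k + 1) * k.factorial := by
      rw [Nat.factorial_succ]; push_cast; ring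
    rw [h4]
    rw [h3] at h2
    apply mul_left_cancel₀ hm.ne'
    rw [h2]
    ring

/-- The weight `(m)_(n-1)` of the spherical harmonics of degree `m`. -/
def weight (n m : ℕ) : ℝ := (ascPochhammer ℝ (n - 1)).eval (m : ℝ)

theorem weight_zero {n : ℕ} (hn : 1 < n) : weight n 0 = 0 := by
  rw [weight, Nat.cast_zero, ascPochhammer_eval_zero, if_neg (by omega)]

theorem weight_succ {n : ℕ} (hn : 1 < n) (m : ℕ) :
    weight n (m + 1) * m.factorial = (m + (n - 2) + 1).factorial := by
  have h1 : (ascPochhammer ℕ (n - 1)).eval (m + 1) = (m + 1).ascFactorial (n - 1) :=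
    ascPochhammer_nat_eq_ascFactorial _ _
  have h2 := Nat.factorial_mul_ascFactorial m (n - 1)
  rw [weight, ← ascPochhammer_eval_cast, h1, mul_comm, show m + (n - 2) + 1 = m + (n - 1) by omega,
    ← h2]
  push_cast
  ring

theorem one_le_weight_succ {n : ℕ} (hn : 1 < n) (m : ℕ) : 1 ≤ weight n (m + 1) := by
  have h := weight_succ hn m
  have h1 : (m.factorial : ℝ) ≤ (m + (n - 2) + 1).factorial := by
    exact_mod_cast Nat.factorial_le (by omega)
  have h2 : (0 : ℝ) < m.factorial := by exact_mod_cast Nat.factorial_pos m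
  rw [← h] at h1
  exact (le_mul_iff_one_le_left h2).1 h1

theorem weight_nonneg {n : ℕ} (hn : 1 < n) (m : ℕ) : 0 ≤ weight n m := by
  cases m with
  | zero => rw [weight_zero hn]
  | succ m => linarith [one_le_weight_succ hn m]

/-- The Beta integral expresses the reciprocal weights as moments of `(1-r)^(n-2)`. This is how the
multipliers `r^m` of the Poisson integral average to the dual weights. -/
theorem integral_pow_mul_weight {n : ℕ} (hn : 1 < n) (m : ℕ) :
    ∫ r in (0 : ℝ)..1, r ^ m * (1 - r) ^ (n - 2) =
      (n - 2).factorial / weight n (m + 1) := by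
  rw [integral_pow_mul_one_sub_pow, ← weight_succ hn]
  have h2 : (0 : ℝ) < m.factorial := by exact_mod_cast Nat.factorial_pos m
  have h3 := one_le_weight_succ hn m
  have h4 : weight n (m + 1) ≠ 0 := by linarith
  field_simp

/-- The derivative kernel whose integral in `r` is `1 / δ`. -/
def invKernel (n : ℕ) (r δ : ℝ) : ℝ :=
  (n : ℝ) / 2 * (1 - r) ^ (n - 1) * (1 + r) * ((1 - r) ^ 2 + r * δ) ^ (-((n : ℝ) / 2) - 1)

theorem base_pos {r δ : ℝ} (hr0 : 0 ≤ r) (hδ : 0 < δ) : 0 < (1 - r) ^ 2 + r * δ := by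
  rcases eq_or_lt_of_le hr0 with h | h
  · rw [← h]; norm_num
  · positivity

theorem integral_invKernel {n : ℕ} (hn : 1 < n) {δ : ℝ} (hδ : 0 < δ) :
    ∫ r in (0 : ℝ)..1, invKernel n r δ = δ⁻¹ := by
  -- The primitive is `-δ⁻¹ ((1-r)²/((1-r)²+rδ))^(n/2)` for `r < 1`; it equals `-δ⁻¹` at `r = 0` and
  -- `0` at `r = 1`.
  have h1 : ∀ r ∈ Set.uIcc (0 : ℝ) 1, HasDerivAt (fun r : ℝ => -δ⁻¹ *
      ((1 - r) ^ n * ((1 - r) ^ 2 + r * δ) ^ (-((n : ℝ) / 2)))) (invKernel n r δ) r := by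
    intro r hr
    rw [Set.uIcc_of_le zero_le_one] at hr
    have hB := base_pos hr.1 hδ
    have d1 : HasDerivAt (fun r : ℝ => 1 - r) (-1) r := (hasDerivAt_id r).const_sub 1
    have d2 : HasDerivAt (fun r : ℝ => (1 - r) ^ 2 + r * δ) (-2 * (1 - r) + δ) r := by
      refine ((d1.pow 2).add ((hasDerivAt_id r).mul_const δ)).congr_deriv ?_
      simp
    have d3 := ((d1.pow n).mul (d2.rpow_const (p := -((n : ℝ) / 2)) (Or.inl hB.ne'))).const_mul
      (-δ⁻¹)
    refine d3.congr_deriv ?_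
    have e1 : ((1 - r) ^ 2 + r * δ) ^ (-((n : ℝ) / 2)) =
        ((1 - r) ^ 2 + r * δ) ^ (-((n : ℝ) / 2) - 1) * ((1 - r) ^ 2 + r * δ) := by
      rw [Real.rpow_sub_one hB.ne']
      field_simp
    have e2 : (1 - r) ^ n = (1 - r) ^ (n - 1) * (1 - r) := by
      rw [← pow_succ]; congr 1; omega
    simp only [Pi.pow_apply]
    rw [e1, e2, invKernel]
    field_simp
    ring
  have hc : ContinuousOn (fun r => invKernel n r δ) (Set.uIcc (0 : ℝ) 1) := by
    rw [Set.uIcc_of_le zero_le_one]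
    unfold invKernel
    refine ContinuousOn.mul (by fun_prop) (ContinuousOn.rpow_const (by fun_prop) ?_)
    intro r hr
    exact Or.inl (base_pos hr.1 hδ).ne'
  rw [intervalIntegral.integral_eq_sub_of_hasDerivAt h1 hc.intervalIntegrable]
  simp [show n ≠ 0 by omega]

/-- The difference of Poisson kernels, weighted by `(1-r)^(n-2)/r`. -/
def thetaKernel (n : ℕ) (r D : ℝ) : ℝ :=
  (1 - r) ^ (n - 2) * r⁻¹ * (1 - r ^ 2) *
    (((1 - r) ^ 2 + r * D) ^ (-((n : ℝ) / 2)) - ((1 + r) ^ 2) ^ (-((n : ℝ) / 2)))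

theorem integral_invKernel_right {n : ℕ} (hn : 1 < n) {r D : ℝ} (hr0 : 0 < r) (hD : 0 < D)
    (hD4 : D ≤ 4) :
    ∫ δ in D..4, invKernel n r δ = thetaKernel n r D := by
  have h1 : ∀ δ ∈ Set.uIcc D 4, HasDerivAt (fun δ : ℝ => -((1 - r) ^ (n - 2) * r⁻¹ * (1 - r ^ 2)) *
      ((1 - r) ^ 2 + r * δ) ^ (-((n : ℝ) / 2))) (invKernel n r δ) δ := by
    intro δ hδ
    rw [Set.uIcc_of_le hD4] at hδ
    have hB := base_pos hr0.le (hD.trans_le hδ.1)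
    have d2 : HasDerivAt (fun δ : ℝ => (1 - r) ^ 2 + r * δ) r δ := by
      refine (((hasDerivAt_id δ).const_mul r).const_add ((1 - r) ^ 2)).congr_deriv ?_
      simp
    refine ((d2.rpow_const (p := -((n : ℝ) / 2)) (Or.inl hB.ne')).const_mul _).congr_deriv ?_
    have e2 : (1 - r) ^ (n - 1) = (1 - r) ^ (n - 2) * (1 - r) := by
      rw [← pow_succ]; congr 1; omega
    rw [invKernel, e2]
    field_simp
    ring
  have hc : ContinuousOn (fun δ => invKernel n r δ) (Set.uIcc D 4) := by
    rw [Set.uIcc_of_le hD4]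
    unfold invKernel
    refine ContinuousOn.mul (by fun_prop) (ContinuousOn.rpow_const (by fun_prop) ?_)
    intro δ hδ
    exact Or.inl (base_pos hr0.le (hD.trans_le hδ.1)).ne'
  rw [intervalIntegral.integral_eq_sub_of_hasDerivAt h1 hc.intervalIntegrable, thetaKernel,
    show (1 - r) ^ 2 + r * 4 = (1 + r) ^ 2 by ring]
  ring

/-- `invKernel` integrates to `1/δ` over `r` and to `thetaKernel` over `δ ∈ [D,4]`, so Fubini gives
`∫ dδ/δ`. The endpoint `4` is the largest value of `|ζ-η|²`; with it `thetaKernel` is nonnegative on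
the whole sphere. -/
theorem integral_thetaKernel {n : ℕ} (hn : 1 < n) {D : ℝ} (hD : 0 < D) (hD4 : D ≤ 4) :
    ∫ r in Set.Ioo (0 : ℝ) 1, thetaKernel n r D = Real.log 4 - Real.log D := by
  have h1 : ∫ r in Set.Ioo (0 : ℝ) 1, thetaKernel n r D =
      ∫ r in (0 : ℝ)..1, ∫ δ in D..4, invKernel n r δ := by
    rw [intervalIntegral.integral_of_le zero_le_one, integral_Ioc_eq_integral_Ioo]
    refine setIntegral_congr_fun measurableSet_Ioo fun r hr => ?_
    exact (integral_invKernel_right hn hr.1 hD hD4).symm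
  have hi : IntegrableOn (Function.uncurry fun r δ => invKernel n r δ)
      (Set.uIoc (0 : ℝ) 1 ×ˢ Set.uIoc D 4) := by
    have hc : ContinuousOn (Function.uncurry fun r δ => invKernel n r δ)
        (Set.Icc (0 : ℝ) 1 ×ˢ Set.Icc D 4) := by
      unfold invKernel Function.uncurry
      refine ContinuousOn.mul (by fun_prop) (ContinuousOn.rpow_const (by fun_prop) ?_)
      rintro ⟨r, δ⟩ ⟨hr, hδ⟩
      exact Or.inl (base_pos hr.1 (hD.trans_le hδ.1)).ne'
    refine (hc.integrableOn_compact (isCompact_Icc.prod isCompact_Icc)).mono_set ?_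
    rw [Set.uIoc_of_le zero_le_one, Set.uIoc_of_le hD4]
    exact Set.prod_mono Set.Ioc_subset_Icc_self Set.Ioc_subset_Icc_self
  rw [h1, intervalIntegral_intervalIntegral_swap hi, ← Real.log_div (by norm_num) hD.ne',
    ← integral_inv_of_pos hD (by norm_num)]
  refine intervalIntegral.integral_congr fun δ hδ => ?_
  rw [Set.uIcc_of_le hD4] at hδ
  exact integral_invKernel hn (hD.trans_le hδ.1)

theorem thetaKernel_nonneg {n : ℕ} {r D : ℝ} (hr0 : 0 < r) (hr : r < 1) (hD : 0 ≤ D)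
    (hD4 : D ≤ 4) : 0 ≤ thetaKernel n r D := by
  have h1 : 0 < 1 - r := sub_pos.2 hr
  have h2 : 0 ≤ 1 - r ^ 2 := by nlinarith
  refine mul_nonneg (by positivity) (sub_nonneg.2 ?_)
  refine Real.rpow_le_rpow_of_nonpos (by positivity) (by nlinarith) ?_
  have : (0 : ℝ) ≤ n := Nat.cast_nonneg n
  linarith

/-- The mean of `thetaKernel` over the sphere. -/
def thetaMean (n : ℕ) (r : ℝ) : ℝ :=
  (1 - r) ^ (n - 2) * r⁻¹ * (1 - (1 - r ^ 2) * ((1 + r) ^ 2) ^ (-((n : ℝ) / 2)))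

/-- The factor `1/r` is harmless at the origin, since the bracket is `O(r)` by Bernoulli's
inequality. A bound uniform in `r` is what integrability over `r` requires. -/
theorem thetaMean_le {n : ℕ} (hn : 1 < n) {r : ℝ} (hr0 : 0 < r) (hr : r < 1) :
    thetaMean n r ≤ n := by
  have h1 : ((1 + r) ^ 2) ^ (-((n : ℝ) / 2)) = (1 / (1 + r)) ^ n := by
    rw [← Real.rpow_natCast (1 + r) 2, ← Real.rpow_mul (by positivity),
      show ((2 : ℕ) : ℝ) * (-((n : ℝ) / 2)) = -(n : ℝ) by push_cast; ring,
      Real.rpow_neg (by positivity), Real.rpow_natCast, one_div, inv_pow]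
  have h2 : 1 - n * (r / (1 + r)) ≤ (1 / (1 + r)) ^ n := by
    have h3 : (-2 : ℝ) ≤ -(r / (1 + r)) := by
      have : r / (1 + r) ≤ 1 := (div_le_one (by positivity)).2 (by linarith)
      linarith
    have h4 := one_add_mul_le_pow h3 n
    rw [show (1 : ℝ) + -(r / (1 + r)) = 1 / (1 + r) by field_simp; ring] at h4
    linarith
  have h3 : (1 - r ^ 2) * (1 - n * (r / (1 + r))) ≤ (1 - r ^ 2) * (1 / (1 + r)) ^ n :=
    mul_le_mul_of_nonneg_left h2 (by nlinarith)
  have h4 : (1 - r ^ 2) * (1 - n * (r / (1 + r))) = 1 - r ^ 2 - n * r * (1 - r) := by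
    field_simp
    ring
  have hn' : (1 : ℝ) ≤ n := by exact_mod_cast hn.le
  have h5 : 1 - (1 - r ^ 2) * (1 / (1 + r)) ^ n ≤ n * r := by
    rw [h4] at h3
    nlinarith [mul_nonneg (sq_nonneg r) (sub_nonneg.2 hn')]
  have h6 : (1 - r) ^ (n - 2) ≤ 1 := pow_le_one₀ (by linarith) (by linarith)
  have h7 : 0 ≤ (1 - r) ^ (n - 2) := pow_nonneg (by linarith) _
  have hr0' : 0 < r⁻¹ := inv_pos.2 hr0
  rw [thetaMean, h1]
  calc (1 - r) ^ (n - 2) * r⁻¹ * (1 - (1 - r ^ 2) * (1 / (1 + r)) ^ n)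
      ≤ (1 - r) ^ (n - 2) * r⁻¹ * (n * r) := by gcongr
    _ = (1 - r) ^ (n - 2) * n := by field_simp
    _ ≤ 1 * n := by gcongr
    _ = n := one_mul _

/-! ### The logarithmic energy -/

section Energy

variable {n : ℕ}

theorem norm_sub_sq_le_four (ζ η : Sph n) : ‖(ζ : E n) - η‖ ^ 2 ≤ 4 := by
  have h := norm_sub_le (ζ : E n) η
  rw [norm_coe_sph, norm_coe_sph] at h
  nlinarith [norm_nonneg ((ζ : E n) - η)]

theorem norm_sub_sq_pos {ζ η : Sph n} (h : ζ ≠ η) : 0 < ‖(ζ : E n) - η‖ ^ 2 := by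
  have : (ζ : E n) - η ≠ 0 := sub_ne_zero.2 fun e => h (Subtype.ext e)
  positivity

theorem ae_ne_prod (hn : 1 < n) :
    ∀ᵐ p ∂(sphereMeasure n).prod (sphereMeasure n), p.1 ≠ p.2 := by
  have := nullSingletonClass_sphereMeasure hn
  have h : ((sphereMeasure n).prod (sphereMeasure n)) (Set.diagonal (Sph n)) = 0 := by
    rw [Measure.measure_prod_null measurableSet_diagonal]
    refine Eventually.of_forall fun ζ => ?_
    have : Prod.mk ζ ⁻¹' Set.diagonal (Sph n) = {ζ} := by
      ext η
      simp [eq_comm]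
    change sphereMeasure n (Prod.mk ζ ⁻¹' Set.diagonal (Sph n)) = 0
    rw [this]
    exact measure_singleton ζ
  exact measure_eq_zero_iff_ae_notMem.1 h

theorem harmProj_mem (m : ℕ) (u : L2 n) : harmProj m u ∈ sphericalHarmonics n m :=
  Submodule.starProjection_apply_mem _ _

theorem inner_harmProj (m : ℕ) (u v : L2 n) :
    inner ℂ u (harmProj m v) = inner ℂ (harmProj m u) (harmProj m v) := by
  unfold harmProj
  rw [Submodule.inner_starProjection_left_eq_right]
  congr 1
  exact (Submodule.starProjection_eq_self_iff.2 (Submodule.starProjection_apply_mem _ _)).symm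

theorem hasSum_harmProj (hn : 0 < n) (u : L2 n) : HasSum (fun m => harmProj m u) u :=
  hasSum_starProjection (orthogonalFamily_sphericalHarmonics hn)
    (topologicalClosure_iSup_sphericalHarmonics hn) u

theorem hasSum_inner_harmProj (hn : 0 < n) (u v : L2 n) :
    HasSum (fun m => inner ℂ (harmProj m u) (harmProj m v)) (inner ℂ u v) :=
  hasSum_inner_starProjection (orthogonalFamily_sphericalHarmonics hn)
    (topologicalClosure_iSup_sphericalHarmonics hn) u v

theorem hasSum_norm_harmProj (hn : 0 < n) (u : L2 n) :
    HasSum (fun m => ‖harmProj m u‖ ^ 2) (‖u‖ ^ 2) := by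
  have h := Complex.hasSum_re (hasSum_inner_harmProj hn u u)
  simp only [inner_self_eq_norm_sq_to_K] at h
  convert h using 1
  · funext m
    norm_cast
  · norm_cast

/-- The dilated Poisson integral, as a continuous function on the sphere. -/
def poissonMap (α r : ℝ) (hr0 : 0 ≤ r) (hr : r < 1) (h : C(Sph n, ℂ))
    (hα : (α - 1) * (α - (n - 1)) = 0) : C(Sph n, ℂ) where
  toFun ζ := poissonIntegral α h (r • (ζ : E n))
  continuous_toFun := (solvesL_poissonIntegral hα
    (integrable_of_continuous_sph h.continuous)).1.continuousOn.comp_continuous (by fun_prop)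
      fun ζ => smul_coe_mem_ball hr0 hr ζ

/-- The function `ν` is expanded in spherical harmonics and paired with its dilated Poisson
integral. By symmetry the Poisson operator can be moved onto each component, where it acts as `r^m`.
-/
theorem hasSum_pow_harmProj (hn : 0 < n) {r : ℝ} (hr0 : 0 ≤ r) (hr : r < 1) (ν : C(Sph n, ℂ)) :
    HasSum (fun m => (r : ℂ) ^ m * ((‖harmProj m (contL2 ν)‖ ^ 2 : ℝ) : ℂ))
      (∫ ζ : Sph n, (starRingEnd ℂ) (ν ζ) * poissonIntegral 1 ν (r • (ζ : E n))
        ∂sphereMeasure n) := by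
  set k := poissonMap 1 r hr0 hr ν (by ring) with hk
  have hν : Integrable ν (sphereMeasure n) := integrable_of_continuous_sph ν.continuous
  have hν' : Integrable (fun ζ => (starRingEnd ℂ) (ν ζ)) (sphereMeasure n) :=
    integrable_of_continuous_sph (Complex.continuous_conj.comp ν.continuous)
  have hkey : ∀ Y : C(Sph n, ℂ), inner ℂ (contL2 k) (contL2 Y) =
      ∫ ζ : Sph n, (starRingEnd ℂ) (ν ζ) * poissonIntegral 1 Y (r • (ζ : E n))
        ∂sphereMeasure n := by
    intro Y
    rw [inner_contL2, ← integral_mul_poissonIntegral_comm 1 hr0 hr hν'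
      (integrable_of_continuous_sph Y.continuous)]
    simp only [← conj_poissonIntegral]
    rfl
  have h1 : HasSum (fun m => inner ℂ (contL2 k) (harmProj m (contL2 ν)))
      (inner ℂ (contL2 k) (contL2 ν)) :=
    (hasSum_harmProj hn (contL2 ν)).mapL (innerSL ℂ (contL2 k))
  rw [hkey] at h1
  refine (congrArg (fun F => HasSum F _) (funext fun m => ?_)).mpr h1
  obtain ⟨P, hP, hPν⟩ := mem_sphericalHarmonics.1 (harmProj_mem m (contL2 ν))
  have h2 : inner ℂ (contL2 ν) (harmProj m (contL2 ν)) =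
      ((‖harmProj m (contL2 ν)‖ ^ 2 : ℝ) : ℂ) := by
    rw [inner_harmProj, inner_self_eq_norm_sq_to_K]
    norm_cast
  rw [← h2, ← hPν, hkey, inner_contL2, ← integral_const_mul]
  refine integral_congr_ae (Eventually.of_forall fun ζ => ?_)
  have := poissonIntegral_evalPoly hn hP hr0 hr ζ
  simp only [spherePoly_apply]
  change _ = (starRingEnd ℂ) (ν ζ) * poissonIntegral 1 (fun η : Sph n => evalPoly P η) _
  rw [this]
  ring

theorem harmProj_zero_eq_zero {ν : C(Sph n, ℂ)} (h0 : ∫ ζ, ν ζ ∂sphereMeasure n = 0) :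
    harmProj 0 (contL2 ν) = 0 := by
  refine (Submodule.starProjection_apply_eq_zero_iff _).2 ?_
  rw [Submodule.mem_orthogonal]
  intro w hw
  obtain ⟨P, hP, rfl⟩ := mem_sphericalHarmonics.1 hw
  have h1 := MvPolynomial.totalDegree_eq_zero_iff_eq_C.1
    ((MvPolynomial.totalDegree_zero_iff_isHomogeneous _).2 hP.1)
  rw [inner_contL2, h1]
  simp only [spherePoly_apply, evalPoly, MvPolynomial.eval_C]
  rw [integral_mul_const, h0, zero_mul]

theorem thetaKernel_eq (r : ℝ) (ζ η : Sph n) :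
    thetaKernel n r (‖(ζ : E n) - η‖ ^ 2) = (1 - r) ^ (n - 2) * r⁻¹ *
      (poissonKernel 1 (r • (ζ : E n)) η - (1 - r ^ 2) * ((1 + r) ^ 2) ^ (-((n : ℝ) / 2))) := by
  rw [thetaKernel, poissonKernel, norm_smul_sub_sq, norm_smul, norm_coe_sph, mul_one,
    Real.norm_eq_abs, sq_abs, Real.rpow_one, sub_add_cancel]
  ring

theorem continuous_poissonKernel_smul_real (α : ℝ) {r : ℝ} (hr0 : 0 ≤ r) (hr : r < 1) :
    Continuous fun p : Sph n × Sph n => poissonKernel α (r • (p.1 : E n)) p.2 :=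
  Complex.continuous_re.comp (continuous_poissonKernel_smul α hr0 hr)

theorem integrable_of_continuous_sph_prod {F : Type*} [NormedAddCommGroup F]
    {h : Sph n × Sph n → F} (hh : Continuous h) :
    Integrable h ((sphereMeasure n).prod (sphereMeasure n)) :=
  hh.integrable_of_hasCompactSupport (HasCompactSupport.of_compactSpace h)

theorem integrable_thetaKernel_prod {r : ℝ} (hr0 : 0 ≤ r) (hr : r < 1) :
    Integrable (fun p : Sph n × Sph n => thetaKernel n r (‖(p.1 : E n) - p.2‖ ^ 2))
      ((sphereMeasure n).prod (sphereMeasure n)) := by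
  simp only [thetaKernel_eq]
  exact integrable_of_continuous_sph_prod (continuous_const.mul
    ((continuous_poissonKernel_smul_real 1 hr0 hr).sub continuous_const))

theorem integral_thetaKernel_prod (hn : 0 < n) {r : ℝ} (hr0 : 0 ≤ r) (hr : r < 1) :
    ∫ p : Sph n × Sph n, thetaKernel n r (‖(p.1 : E n) - p.2‖ ^ 2)
      ∂(sphereMeasure n).prod (sphereMeasure n) = thetaMean n r := by
  have := isProbabilityMeasure_sphereMeasure hn
  have hK : Integrable (fun p : Sph n × Sph n => poissonKernel 1 (r • (p.1 : E n)) p.2)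
      ((sphereMeasure n).prod (sphereMeasure n)) :=
    integrable_of_continuous_sph_prod (continuous_poissonKernel_smul_real 1 hr0 hr)
  simp only [thetaKernel_eq]
  rw [integral_const_mul, integral_sub hK (integrable_const _), integral_prod _ hK]
  simp only [integral_poissonKernel hn (isPoissonExponent_one n) (smul_coe_mem_ball hr0 hr _)]
  simp [thetaMean]

/-- The kernel is nonnegative, so its norm integrates over the two spheres to `thetaMean`, which is
bounded. -/
theorem integrable_thetaKernel (hn : 1 < n) :
    Integrable (fun q : ℝ × (Sph n × Sph n) => thetaKernel n q.1 (‖(q.2.1 : E n) - q.2.2‖ ^ 2))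
      ((volume.restrict (Set.Ioo (0 : ℝ) 1)).prod
        ((sphereMeasure n).prod (sphereMeasure n))) := by
  have hm : Measurable
      (fun q : ℝ × (Sph n × Sph n) => thetaKernel n q.1 (‖(q.2.1 : E n) - q.2.2‖ ^ 2)) := by
    unfold thetaKernel
    fun_prop
  have hms := hm.aestronglyMeasurable (μ := (volume.restrict (Set.Ioo (0 : ℝ) 1)).prod
        ((sphereMeasure n).prod (sphereMeasure n)))
  rw [integrable_prod_iff hms]
  have hmem := ae_restrict_mem (μ := (volume : Measure ℝ)) (measurableSet_Ioo (a := (0 : ℝ)) (b := 1))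
  refine ⟨?_, ?_⟩
  · filter_upwards [hmem] with r hr using integrable_thetaKernel_prod hr.1.le hr.2
  · refine Integrable.of_bound hms.norm.integral_prod_right' (n : ℝ) ?_
    filter_upwards [hmem] with r hr
    have h1 : ∀ p : Sph n × Sph n, ‖thetaKernel n r (‖(p.1 : E n) - p.2‖ ^ 2)‖ =
        thetaKernel n r (‖(p.1 : E n) - p.2‖ ^ 2) := fun p =>
      Real.norm_of_nonneg (thetaKernel_nonneg hr.1 hr.2 (sq_nonneg _) (norm_sub_sq_le_four _ _))
    simp only [h1]
    rw [integral_thetaKernel_prod (by omega) hr.1.le hr.2, Real.norm_of_nonneg]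
    · exact thetaMean_le hn hr.1 hr.2
    · rw [← integral_thetaKernel_prod (by omega) hr.1.le hr.2]
      exact integral_nonneg fun p =>
        thetaKernel_nonneg hr.1 hr.2 (sq_nonneg _) (norm_sub_sq_le_four _ _)

theorem integral_thetaKernel_ae (hn : 1 < n) :
    ∀ᵐ p ∂(sphereMeasure n).prod (sphereMeasure n),
      ∫ r in Set.Ioo (0 : ℝ) 1, thetaKernel n r (‖(p.1 : E n) - p.2‖ ^ 2) =
        Real.log 4 - Real.log (‖(p.1 : E n) - p.2‖ ^ 2) := by
  filter_upwards [ae_ne_prod hn] with p hp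
  exact integral_thetaKernel hn (norm_sub_sq_pos hp) (norm_sub_sq_le_four _ _)

/-- Integrability of the logarithm is a by-product of Fubini: up to a constant it is the
`r`-integral of an integrable kernel. -/
theorem integrable_log_norm_sub (hn : 1 < n) :
    Integrable (fun p : Sph n × Sph n => Real.log (‖(p.1 : E n) - p.2‖ ^ 2))
      ((sphereMeasure n).prod (sphereMeasure n)) := by
  have h1 := (integrable_thetaKernel hn).integral_prod_right
  refine ((integrable_const (Real.log 4)).sub (h1.congr (integral_thetaKernel_ae hn))).congr
    (Eventually.of_forall fun p => ?_)
  simp only [Pi.sub_apply, sub_sub_cancel]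

/-- The logarithmic energy of a function on the sphere. -/
def logEnergy (ν : Sph n → ℂ) : ℂ :=
  ∫ p : Sph n × Sph n, ((-Real.log (‖(p.1 : E n) - p.2‖ ^ 2) : ℝ) : ℂ) *
    (ν p.2 * (starRingEnd ℂ) (ν p.1)) ∂(sphereMeasure n).prod (sphereMeasure n)

theorem integral_mul_conj_prod {ν : C(Sph n, ℂ)} (h0 : ∫ ζ, ν ζ ∂sphereMeasure n = 0) :
    ∫ p : Sph n × Sph n, ν p.2 * (starRingEnd ℂ) (ν p.1)
      ∂(sphereMeasure n).prod (sphereMeasure n) = 0 := by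
  have h := integral_prod_mul (μ := sphereMeasure n) (ν := sphereMeasure n)
    (fun ζ => (starRingEnd ℂ) (ν ζ)) (fun ζ => ν ζ)
  rw [h0, mul_zero] at h
  rw [← h]
  exact integral_congr_ae (Eventually.of_forall fun p => mul_comm _ _)

/-- The additive constant `log 4` disappears because `ν` has mean zero. -/
theorem integral_theta_eq_logEnergy (hn : 1 < n) {ν : C(Sph n, ℂ)}
    (h0 : ∫ ζ, ν ζ ∂sphereMeasure n = 0) :
    ∫ r in Set.Ioo (0 : ℝ) 1, ∫ p : Sph n × Sph n,
      ((thetaKernel n r (‖(p.1 : E n) - p.2‖ ^ 2) : ℝ) : ℂ) *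
        (ν p.2 * (starRingEnd ℂ) (ν p.1)) ∂(sphereMeasure n).prod (sphereMeasure n) =
      logEnergy ν := by
  have hνc : Continuous fun p : Sph n × Sph n => ν p.2 * (starRingEnd ℂ) (ν p.1) :=
    (ν.continuous.comp continuous_snd).mul
      (Complex.continuous_conj.comp (ν.continuous.comp continuous_fst))
  obtain ⟨C, hC⟩ := isCompact_univ.exists_bound_of_continuousOn hνc.continuousOn
  have hνi := integrable_of_continuous_sph_prod hνc
  have hi : Integrable (fun q : ℝ × (Sph n × Sph n) =>
      ((thetaKernel n q.1 (‖(q.2.1 : E n) - q.2.2‖ ^ 2) : ℝ) : ℂ) *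
        (ν q.2.2 * (starRingEnd ℂ) (ν q.2.1)))
      ((volume.restrict (Set.Ioo (0 : ℝ) 1)).prod
        ((sphereMeasure n).prod (sphereMeasure n))) :=
    (integrable_thetaKernel hn).ofReal.mul_bdd (c := C)
      (hνc.comp continuous_snd).aestronglyMeasurable
      (Eventually.of_forall fun q => hC q.2 (Set.mem_univ _))
  rw [integral_integral_swap (f := fun r p => ((thetaKernel n r (‖((p : Sph n × Sph n).1 : E n) -
    p.2‖ ^ 2) : ℝ) : ℂ) * (ν p.2 * (starRingEnd ℂ) (ν p.1))) hi]
  have h1 : ∀ᵐ p ∂(sphereMeasure n).prod (sphereMeasure n),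
      ∫ r in Set.Ioo (0 : ℝ) 1, ((thetaKernel n r (‖(p.1 : E n) - p.2‖ ^ 2) : ℝ) : ℂ) *
        (ν p.2 * (starRingEnd ℂ) (ν p.1)) =
      ((-Real.log (‖(p.1 : E n) - p.2‖ ^ 2) : ℝ) : ℂ) * (ν p.2 * (starRingEnd ℂ) (ν p.1)) +
        ((Real.log 4 : ℝ) : ℂ) * (ν p.2 * (starRingEnd ℂ) (ν p.1)) := by
    filter_upwards [integral_thetaKernel_ae hn] with p hp
    rw [integral_mul_const, integral_complex_ofReal, hp]
    push_cast
    ring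
  rw [integral_congr_ae h1, integral_add, integral_const_mul, integral_mul_conj_prod h0, mul_zero,
    add_zero]
  · rfl
  · exact (integrable_log_norm_sub hn).neg.ofReal.mul_bdd (c := C) hνc.aestronglyMeasurable
      (Eventually.of_forall fun q => hC q (Set.mem_univ _))
  · exact hνi.const_mul _

theorem integral_theta_prod_eq {ν : C(Sph n, ℂ)} (h0 : ∫ ζ, ν ζ ∂sphereMeasure n = 0)
    {r : ℝ} (hr0 : 0 ≤ r) (hr : r < 1) :
    ∫ p : Sph n × Sph n, ((thetaKernel n r (‖(p.1 : E n) - p.2‖ ^ 2) : ℝ) : ℂ) *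
        (ν p.2 * (starRingEnd ℂ) (ν p.1)) ∂(sphereMeasure n).prod (sphereMeasure n) =
      (((1 - r) ^ (n - 2) * r⁻¹ : ℝ) : ℂ) * ∫ ζ : Sph n, (starRingEnd ℂ) (ν ζ) *
        poissonIntegral 1 ν (r • (ζ : E n)) ∂sphereMeasure n := by
  have hν : Integrable ν (sphereMeasure n) := integrable_of_continuous_sph ν.continuous
  have hν' : Integrable (fun ζ => (starRingEnd ℂ) (ν ζ)) (sphereMeasure n) :=
    integrable_of_continuous_sph (Complex.continuous_conj.comp ν.continuous)
  have hi := integrable_poissonKernel_mul 1 hr0 hr hν hν'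
  have e : ∫ ζ : Sph n, (starRingEnd ℂ) (ν ζ) * poissonIntegral 1 ν (r • (ζ : E n))
      ∂sphereMeasure n = ∫ p : Sph n × Sph n, (starRingEnd ℂ) (ν p.1) *
      (ν p.2 * ((poissonKernel 1 (r • (p.1 : E n)) p.2 : ℝ) : ℂ))
      ∂(sphereMeasure n).prod (sphereMeasure n) := by
    rw [integral_prod _ hi]
    refine integral_congr_ae (Eventually.of_forall fun ζ => ?_)
    simp only [integral_const_mul]
    rfl
  have hνi : Integrable (fun p : Sph n × Sph n => ν p.2 * (starRingEnd ℂ) (ν p.1))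
      ((sphereMeasure n).prod (sphereMeasure n)) :=
    integrable_of_continuous_sph_prod ((ν.continuous.comp continuous_snd).mul
      (Complex.continuous_conj.comp (ν.continuous.comp continuous_fst)))
  set c : ℂ := (((1 - r) ^ (n - 2) * r⁻¹ * ((1 - r ^ 2) * ((1 + r) ^ 2) ^ (-((n : ℝ) / 2))) : ℝ) : ℂ)
  rw [e, ← integral_const_mul, ← sub_zero (∫ p : Sph n × Sph n, (((1 - r) ^ (n - 2) * r⁻¹ : ℝ) : ℂ) *
    _ ∂_), ← mul_zero c, ← integral_mul_conj_prod h0, ← integral_const_mul,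
    ← integral_sub (hi.const_mul _) (hνi.const_mul _)]
  refine integral_congr_ae (Eventually.of_forall fun p => ?_)
  simp only [thetaKernel_eq, c]
  push_cast
  ring

/-- The logarithmic kernel is an average over `r` of Poisson kernels with weight `(1-r)^(n-2)/r`, up
to constants which mean zero removes. It therefore acts on degree `m` by the average of `r^m`, that
is by `(n-2)!/(m)_(n-1)`. The factor `1/r` and the missing degree `0` explain the index `m + 1`. -/
theorem hasSum_logEnergy (hn : 1 < n) {ν : C(Sph n, ℂ)} (h0 : ∫ ζ, ν ζ ∂sphereMeasure n = 0) :
    HasSum (fun m => (((n - 2).factorial / weight n (m + 1) *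
      ‖harmProj (m + 1) (contL2 ν)‖ ^ 2 : ℝ) : ℂ)) (logEnergy ν) := by
  set b : ℕ → ℝ := fun m => ‖harmProj (m + 1) (contL2 ν)‖ ^ 2 with hb
  set F : ℕ → ℝ → ℂ := fun m r => ((r ^ m * (1 - r) ^ (n - 2) * b m : ℝ) : ℂ) with hF
  have hFint : ∀ m, ∫ r in Set.Ioo (0 : ℝ) 1, r ^ m * (1 - r) ^ (n - 2) * b m =
      (n - 2).factorial / weight n (m + 1) * b m := by
    intro m
    rw [integral_mul_const, ← integral_Ioc_eq_integral_Ioo,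
      ← intervalIntegral.integral_of_le zero_le_one, integral_pow_mul_weight hn]
  have hFi : ∀ m, Integrable (F m) (volume.restrict (Set.Ioo (0 : ℝ) 1)) := fun m =>
    (Continuous.integrableOn_Icc (a := (0 : ℝ)) (b := 1) (f := F m) (by fun_prop)).mono_set
      Set.Ioo_subset_Icc_self
  have hFn : ∀ m, ∫ r in Set.Ioo (0 : ℝ) 1, ‖F m r‖ =
      (n - 2).factorial / weight n (m + 1) * b m := by
    intro m
    rw [← hFint]
    refine setIntegral_congr_fun measurableSet_Ioo fun r hr => ?_
    have h1 : 0 ≤ 1 - r := by linarith [hr.2]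
    have h2 : 0 ≤ r := hr.1.le
    simp only [hF, hb, Complex.norm_real]
    exact Real.norm_of_nonneg (by positivity)
  have hsb : Summable b :=
    (summable_nat_add_iff 1).2 (hasSum_norm_harmProj (by omega) (contL2 ν)).summable
  have hs : Summable fun m => ∫ r in Set.Ioo (0 : ℝ) 1, ‖F m r‖ := by
    simp only [hFn]
    refine Summable.of_nonneg_of_le (fun m => ?_) (fun m => ?_) (hsb.mul_left ((n - 2).factorial : ℝ))
    · have := weight_nonneg hn (m + 1)
      positivity
    · refine mul_le_mul_of_nonneg_right ?_ (sq_nonneg _)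
      exact div_le_self (by positivity) (one_le_weight_succ hn m)
  have key := hasSum_integral_of_summable_integral_norm hFi hs
  have e1 : ∀ m, ∫ r in Set.Ioo (0 : ℝ) 1, F m r =
      (((n - 2).factorial / weight n (m + 1) * b m : ℝ) : ℂ) := by
    intro m
    rw [← hFint, ← integral_complex_ofReal]
  have e2 : ∫ r in Set.Ioo (0 : ℝ) 1, ∑' m, F m r = logEnergy ν := by
    rw [← integral_theta_eq_logEnergy hn h0]
    refine setIntegral_congr_fun measurableSet_Ioo fun r hr => ?_
    simp only [integral_theta_prod_eq h0 hr.1.le hr.2]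
    have h1 := hasSum_pow_harmProj (by omega) hr.1.le hr.2 ν
    rw [← hasSum_nat_add_iff' 1] at h1
    simp only [Finset.range_one, Finset.sum_singleton, harmProj_zero_eq_zero h0, norm_zero] at h1
    have h2 := h1.mul_left (((1 - r) ^ (n - 2) * r⁻¹ : ℝ) : ℂ)
    simp only [ne_eq, OfNat.ofNat_ne_zero, not_false_eq_true, zero_pow, Complex.ofReal_zero,
      mul_zero, sub_zero] at h2
    rw [← h2.tsum_eq]
    refine tsum_congr fun m => ?_
    simp only [hF, hb]
    have hr' : (r : ℂ) ≠ 0 := Complex.ofReal_ne_zero.2 hr.1.ne'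
    push_cast
    field_simp
    ring
  rw [e2] at key
  simpa only [e1] using key

end Energy

/-! ### Boundary values of Moebius transformations -/

/-- The extension to the sphere of a Moebius transformation of the ball, with its conformal
factor. -/
structure BoundaryMap (n : ℕ) (φ : Equiv.Perm (Ball n)) where
  /-- the induced homeomorphism of the sphere -/
  toHomeo : Sph n ≃ₜ Sph n
  /-- the conformal factor -/
  factor : Sph n → ℝ
  continuous_factor : Continuous factor
  factor_pos : ∀ ζ, 0 < factor ζ
  dist_sq : ∀ ζ η, ‖(toHomeo ζ : E n) - toHomeo η‖ ^ 2 =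
    factor ζ * factor η * ‖(ζ : E n) - η‖ ^ 2
  kernel : ∀ (x : Ball n) ζ, (1 - ‖(φ x : E n)‖ ^ 2) / ‖(φ x : E n) - toHomeo ζ‖ ^ 2 * factor ζ =
    (1 - ‖(x : E n)‖ ^ 2) / ‖(x : E n) - ζ‖ ^ 2

namespace BoundaryMap

variable {n : ℕ} {φ φ' : Equiv.Perm (Ball n)}

/-- The boundary values of the inverse. -/
def symm (b : BoundaryMap n φ) : BoundaryMap n φ⁻¹ where
  toHomeo := b.toHomeo.symm
  factor ζ := (b.factor (b.toHomeo.symm ζ))⁻¹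
  continuous_factor := (b.continuous_factor.comp b.toHomeo.symm.continuous).inv₀
    fun ζ => (b.factor_pos _).ne'
  factor_pos ζ := inv_pos.2 (b.factor_pos _)
  dist_sq ζ η := by
    have h := b.dist_sq (b.toHomeo.symm ζ) (b.toHomeo.symm η)
    rw [Homeomorph.apply_symm_apply, Homeomorph.apply_symm_apply] at h
    have h1 := (b.factor_pos (b.toHomeo.symm ζ)).ne'
    have h2 := (b.factor_pos (b.toHomeo.symm η)).ne'
    rw [h]
    field_simp
  kernel x ζ := by
    have h := b.kernel (φ⁻¹ x) (b.toHomeo.symm ζ)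
    rw [Homeomorph.apply_symm_apply, show φ (φ⁻¹ x) = x from φ.apply_symm_apply x] at h
    have h1 := (b.factor_pos (b.toHomeo.symm ζ)).ne'
    rw [← h, mul_assoc, mul_inv_cancel₀ h1, mul_one]

/-- The boundary values of a product. -/
def mul (b : BoundaryMap n φ) (b' : BoundaryMap n φ') : BoundaryMap n (φ * φ') where
  toHomeo := b'.toHomeo.trans b.toHomeo
  factor ζ := b.factor (b'.toHomeo ζ) * b'.factor ζ
  continuous_factor := (b.continuous_factor.comp b'.toHomeo.continuous).mul b'.continuous_factor
  factor_pos ζ := mul_pos (b.factor_pos _) (b'.factor_pos _)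
  dist_sq ζ η := by
    rw [Homeomorph.trans_apply, Homeomorph.trans_apply, b.dist_sq, b'.dist_sq]
    ring
  kernel x ζ := by
    rw [Homeomorph.trans_apply, Equiv.Perm.mul_apply, ← mul_assoc, b.kernel, b'.kernel]

/-- The boundary values of an orthogonal transformation. -/
def ofOrthogonal (U : E n ≃ₗᵢ[ℝ] E n) : BoundaryMap n (orthogonal U) where
  toHomeo := sphOrthogonal U
  factor _ := 1
  continuous_factor := continuous_const
  factor_pos _ := one_pos
  dist_sq ζ η := by
    change ‖U (ζ : E n) - U η‖ ^ 2 = _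
    rw [← map_sub, U.norm_map]
    ring
  kernel x ζ := by
    change (1 - ‖U (x : E n)‖ ^ 2) / ‖U (x : E n) - U ζ‖ ^ 2 * 1 = _
    rw [← map_sub, U.norm_map, U.norm_map, mul_one]

/-- The boundary values of the identity. -/
def one : BoundaryMap n 1 where
  toHomeo := Homeomorph.refl _
  factor _ := 1
  continuous_factor := continuous_const
  factor_pos _ := one_pos
  dist_sq ζ η := by simp
  kernel x ζ := by simp

end BoundaryMap

section Moebius

variable {n : ℕ}

/-- The denominator `[x,a]²` of the Moebius maps. -/
def denom (a x : E n) : ℝ := 1 - 2 * inner ℝ x a + ‖x‖ ^ 2 * ‖a‖ ^ 2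

theorem norm_moebius_numerator_sq (a x : E n) :
    ‖‖x - a‖ ^ 2 • a + (1 - ‖a‖ ^ 2) • (a - x)‖ ^ 2 = denom a x * ‖x - a‖ ^ 2 := by
  rw [denom, norm_add_sq_real, norm_smul, norm_smul, mul_pow, mul_pow, inner_smul_left,
    inner_smul_right, inner_sub_right, real_inner_self_eq_norm_sq, real_inner_comm,
    Real.norm_eq_abs, Real.norm_eq_abs, sq_abs, sq_abs, norm_sub_sq_real, norm_sub_sq_real,
    real_inner_comm x a]
  simp only [conj_trivial]
  ring

theorem moebiusMap_eq {a x : E n} (hx : 0 < denom a x) :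
    moebiusMap a x = (denom a x)⁻¹ • (‖x - a‖ ^ 2 • a + (1 - ‖a‖ ^ 2) • (a - x)) := by
  rw [denom] at hx
  rw [moebiusMap, bracket, Real.sq_sqrt hx.le, denom]

theorem norm_moebiusMap_sq {a x : E n} (hx : 0 < denom a x) :
    ‖moebiusMap a x‖ ^ 2 = ‖x - a‖ ^ 2 / denom a x := by
  rw [moebiusMap_eq hx, norm_smul, mul_pow, norm_moebius_numerator_sq, Real.norm_eq_abs, sq_abs]
  field_simp

/-- Stated for arbitrary points with positive denominators, so that it serves two points of the
sphere (the conformal factor) as well as one point inside and one on the sphere (the kernel). -/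
theorem norm_moebiusMap_sub_sq {a x y : E n} (hx : 0 < denom a x) (hy : 0 < denom a y) :
    ‖moebiusMap a x - moebiusMap a y‖ ^ 2 =
      (1 - ‖a‖ ^ 2) ^ 2 * ‖x - y‖ ^ 2 / (denom a x * denom a y) := by
  rw [norm_sub_sq_real, norm_moebiusMap_sq hx, norm_moebiusMap_sq hy, moebiusMap_eq hx,
    moebiusMap_eq hy, inner_smul_left, inner_smul_right]
  have key : ‖x - a‖ ^ 2 * denom a y + ‖y - a‖ ^ 2 * denom a x -
      2 * inner ℝ (‖x - a‖ ^ 2 • a + (1 - ‖a‖ ^ 2) • (a - x))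
        (‖y - a‖ ^ 2 • a + (1 - ‖a‖ ^ 2) • (a - y)) = (1 - ‖a‖ ^ 2) ^ 2 * ‖x - y‖ ^ 2 := by
    simp only [inner_add_left, inner_add_right, inner_smul_left, inner_smul_right, inner_sub_left,
      inner_sub_right, conj_trivial, denom, norm_sub_sq_real, real_inner_self_eq_norm_sq,
      real_inner_comm a y, real_inner_comm a x]
    ring
  rw [← key]
  simp only [conj_trivial]
  field_simp
  ring

theorem denom_coe_sph (a : E n) (ζ : Sph n) : denom a (ζ : E n) = ‖(ζ : E n) - a‖ ^ 2 := by
  rw [denom, norm_sub_sq_real, norm_coe_sph]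
  ring

theorem denom_coe_sph_pos {a : E n} (ha : ‖a‖ < 1) (ζ : Sph n) : 0 < denom a (ζ : E n) := by
  rw [denom_coe_sph, norm_sub_rev]
  have := sub_ne_zero.2 (ne_of_norm_lt ha ζ)
  positivity

theorem continuousAt_moebiusMap {a x : E n} (hx : 0 < denom a x) :
    ContinuousAt (moebiusMap a) x := by
  have hc : Continuous fun y : E n => denom a y := by unfold denom; fun_prop
  have h1 : ContinuousAt
      (fun y => (denom a y)⁻¹ • (‖y - a‖ ^ 2 • a + (1 - ‖a‖ ^ 2) • (a - y))) x :=
    (hc.continuousAt.inv₀ hx.ne').smul (by fun_prop)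
  refine h1.congr ?_
  filter_upwards [hc.continuousAt.eventually (lt_mem_nhds hx)] with y hy
  exact (moebiusMap_eq hy).symm

theorem norm_moebiusMap_coe_sph {a : E n} (ha : ‖a‖ < 1) (ζ : Sph n) :
    ‖moebiusMap a (ζ : E n)‖ = 1 := by
  have h := norm_moebiusMap_sq (denom_coe_sph_pos ha ζ)
  have h2 := denom_coe_sph_pos ha ζ
  rw [← denom_coe_sph, div_self h2.ne'] at h
  nlinarith [norm_nonneg (moebiusMap a (ζ : E n))]

/-- The action of the Moebius map on the sphere. -/
def sphMoebius {a : E n} (ha : ‖a‖ < 1) (ζ : Sph n) : Sph n :=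
  ⟨moebiusMap a ζ, mem_sphere_zero_iff_norm.2 (norm_moebiusMap_coe_sph ha ζ)⟩

/-- The map is an involution inside the ball and continuous up to the sphere. -/
theorem sphMoebius_sphMoebius {a : E n} (ha : ‖a‖ < 1) (ζ : Sph n) :
    sphMoebius ha (sphMoebius ha ζ) = ζ := by
  refine Subtype.ext ?_
  change moebiusMap a (moebiusMap a ζ) = ζ
  have hc : ContinuousAt (fun x => moebiusMap a (moebiusMap a x)) (ζ : E n) :=
    ContinuousAt.comp (g := moebiusMap a) (f := moebiusMap a)
      (continuousAt_moebiusMap (denom_coe_sph_pos ha (sphMoebius ha ζ)))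
      (continuousAt_moebiusMap (denom_coe_sph_pos ha ζ))
  have hcl : (ζ : E n) ∈ closure (ball (0 : E n) 1) := by
    rw [closure_ball _ one_ne_zero]
    exact sphere_subset_closedBall ζ.2
  have : (𝓝[ball (0 : E n) 1] (ζ : E n)).NeBot := mem_closure_iff_nhdsWithin_neBot.1 hcl
  refine tendsto_nhds_unique (l := 𝓝[ball (0 : E n) 1] (ζ : E n))
    (f := fun x => moebiusMap a (moebiusMap a x)) (hc.tendsto.mono_left nhdsWithin_le_nhds) ?_
  refine (tendsto_id.mono_left nhdsWithin_le_nhds).congr' ?_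
  filter_upwards [eventually_mem_nhdsWithin] with x hx
  exact (moebiusMap_moebiusMap ha (mem_ball_zero_iff.1 hx)).symm

theorem continuous_sphMoebius {a : E n} (ha : ‖a‖ < 1) : Continuous (sphMoebius ha) := by
  refine Continuous.subtype_mk ?_ _
  rw [continuous_iff_continuousAt]
  intro ζ
  exact (continuousAt_moebiusMap (denom_coe_sph_pos ha ζ)).comp continuousAt_subtype_val

/-- The boundary values of the Moebius map. -/
def BoundaryMap.ofMoebius (a : Ball n) : BoundaryMap n (moebius a) where
  toHomeo :=
    { toFun := sphMoebius (mem_ball_zero_iff.1 a.2)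
      invFun := sphMoebius (mem_ball_zero_iff.1 a.2)
      left_inv := sphMoebius_sphMoebius _
      right_inv := sphMoebius_sphMoebius _
      continuous_toFun := continuous_sphMoebius _
      continuous_invFun := continuous_sphMoebius _ }
  factor ζ := (1 - ‖(a : E n)‖ ^ 2) / denom (a : E n) ζ
  continuous_factor := by
    refine Continuous.div continuous_const (by unfold denom; fun_prop) fun ζ => ?_
    exact (denom_coe_sph_pos (mem_ball_zero_iff.1 a.2) ζ).ne'
  factor_pos ζ := div_pos (one_sub_normSq_pos (mem_ball_zero_iff.1 a.2))
    (denom_coe_sph_pos (mem_ball_zero_iff.1 a.2) ζ)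
  dist_sq ζ η := by
    have h1 := denom_coe_sph_pos (mem_ball_zero_iff.1 a.2) ζ
    have h2 := denom_coe_sph_pos (mem_ball_zero_iff.1 a.2) η
    refine (norm_moebiusMap_sub_sq h1 h2).trans ?_
    field_simp
  kernel x ζ := by
    have ha := mem_ball_zero_iff.1 a.2
    have hx := mem_ball_zero_iff.1 x.2
    have h1 : 0 < denom (a : E n) x := bracket_arg_pos ha hx
    have h2 := denom_coe_sph_pos ha ζ
    have h3 := one_sub_normSq_pos ha
    have h4 : ‖(x : E n) - ζ‖ ≠ 0 := norm_ne_zero_iff.2 (sub_ne_zero.2 (ne_of_norm_lt hx ζ))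
    have e1 : 1 - ‖(moebius a x : E n)‖ ^ 2 =
        (1 - ‖(a : E n)‖ ^ 2) * (1 - ‖(x : E n)‖ ^ 2) / denom (a : E n) x :=
      one_sub_norm_moebiusMap_sq ha hx
    have e2 : ‖(moebius a x : E n) - sphMoebius ha ζ‖ ^ 2 =
      (1 - ‖(a : E n)‖ ^ 2) ^ 2 * ‖(x : E n) - ζ‖ ^ 2 / (denom (a : E n) x * denom (a : E n) ζ) :=
      norm_moebiusMap_sub_sq h1 h2
    change (1 - ‖(moebius a x : E n)‖ ^ 2) / ‖(moebius a x : E n) - sphMoebius ha ζ‖ ^ 2 *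
      ((1 - ‖(a : E n)‖ ^ 2) / denom (a : E n) ζ) = _
    rw [e1, e2]
    field_simp

theorem nonempty_boundaryMap {φ : Equiv.Perm (Ball n)} (hφ : φ ∈ moebiusGroup n) :
    Nonempty (BoundaryMap n φ) := by
  induction hφ using Subgroup.closure_induction with
  | mem φ h =>
    rcases h with ⟨a, rfl⟩ | ⟨U, rfl⟩
    · exact ⟨BoundaryMap.ofMoebius a⟩
    · exact ⟨BoundaryMap.ofOrthogonal U⟩
  | one => exact ⟨BoundaryMap.one⟩
  | mul φ ψ _ _ h1 h2 => exact ⟨h1.some.mul h2.some⟩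
  | inv φ _ h => exact ⟨h.some.symm⟩

end Moebius

/-! ### Change of variables on the sphere -/

/-- Being the `(n-1)`-st power of the quantity in `BoundaryMap.kernel`, the hyperbolic kernel is
multiplied by the Jacobian under a Moebius map; the Euclidean one is not. -/
theorem poissonKernel_hyp {n : ℕ} (hn : 0 < n) {x : E n} (hx : ‖x‖ < 1) (ζ : Sph n) :
    poissonKernel ((n : ℝ) - 1) x ζ = ((1 - ‖x‖ ^ 2) / ‖x - ζ‖ ^ 2) ^ (n - 1) := by
  have h1 := one_sub_normSq_pos hx
  have h2 : 0 < ‖x - ζ‖ ^ 2 := by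
    have := sub_ne_zero.2 (ne_of_norm_lt hx ζ)
    positivity
  have e : ((n : ℝ) - 1) = ((n - 1 : ℕ) : ℝ) := by
    rw [Nat.cast_sub hn]; simp
  rw [poissonKernel, show -(((n : ℝ) - 1 + (n - 1)) / 2) = -((n : ℝ) - 1) by ring,
    Real.rpow_neg h2.le, e, Real.rpow_natCast, Real.rpow_natCast, div_pow, div_eq_mul_inv]

namespace BoundaryMap

variable {n : ℕ} {φ : Equiv.Perm (Ball n)} (b : BoundaryMap n φ)

/-- The Jacobian of the boundary map. -/
def jacobian (ζ : Sph n) : NNReal := ⟨b.factor ζ ^ (n - 1), pow_nonneg (b.factor_pos ζ).le _⟩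

theorem coe_jacobian (ζ : Sph n) : (b.jacobian ζ : ℝ) = b.factor ζ ^ (n - 1) := rfl

theorem continuous_jacobian : Continuous b.jacobian :=
  (b.continuous_factor.pow (n - 1)).subtype_mk _

theorem continuous_jacobian_complex : Continuous fun ζ => ((b.jacobian ζ : ℝ) : ℂ) :=
  Complex.continuous_ofReal.comp (NNReal.continuous_coe.comp b.continuous_jacobian)

theorem poissonKernel_mul_jacobian (hn : 0 < n) (x : Ball n) (ζ : Sph n) :
    poissonKernel ((n : ℝ) - 1) (φ x : E n) (b.toHomeo ζ) * b.jacobian ζ =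
      poissonKernel ((n : ℝ) - 1) (x : E n) ζ := by
  rw [poissonKernel_hyp hn (mem_ball_zero_iff.1 (φ x).2), poissonKernel_hyp hn
    (mem_ball_zero_iff.1 x.2), coe_jacobian, ← mul_pow, b.kernel]

theorem integral_poissonKernel_mul_jacobian (hn : 2 < n) {x : E n} (hx : x ∈ ball (0 : E n) 1) :
    ∫ ζ, poissonKernel ((n : ℝ) - 1) x (b.toHomeo ζ) * b.jacobian ζ ∂sphereMeasure n = 1 := by
  have h := fun ζ => b.poissonKernel_mul_jacobian (by omega) (φ⁻¹ ⟨x, hx⟩) ζ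
  rw [show φ (φ⁻¹ ⟨x, hx⟩) = ⟨x, hx⟩ from φ.apply_symm_apply _] at h
  simp only [h]
  exact integral_poissonKernel (by omega) (isPoissonExponent_hyp hn) (φ⁻¹ ⟨x, hx⟩).2

theorem integral_jacobian_mul_poissonIntegral (hn : 2 < n) {r : ℝ} (hr0 : 0 ≤ r) (hr : r < 1)
    (h : C(Sph n, ℂ)) :
    ∫ ζ, ((b.jacobian ζ : ℝ) : ℂ) * poissonIntegral ((n : ℝ) - 1) h (r • (b.toHomeo ζ : E n))
      ∂sphereMeasure n = ∫ ζ, h ζ ∂sphereMeasure n := by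
  have hk : Continuous fun p : Sph n × Sph n =>
      ((poissonKernel ((n : ℝ) - 1) (r • (b.toHomeo p.1 : E n)) p.2 : ℝ) : ℂ) :=
    Continuous.comp (g := fun q : Sph n × Sph n =>
        ((poissonKernel ((n : ℝ) - 1) (r • (q.1 : E n)) q.2 : ℝ) : ℂ))
      (f := fun p : Sph n × Sph n => (b.toHomeo p.1, p.2))
      (continuous_poissonKernel_smul ((n : ℝ) - 1) hr0 hr)
      ((b.toHomeo.continuous.comp continuous_fst).prodMk continuous_snd)
  have hc : Continuous fun p : Sph n × Sph n => ((b.jacobian p.1 : ℝ) : ℂ) *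
      (h p.2 * ((poissonKernel ((n : ℝ) - 1) (r • (b.toHomeo p.1 : E n)) p.2 : ℝ) : ℂ)) :=
    (b.continuous_jacobian_complex.comp continuous_fst).mul
      ((h.continuous.comp continuous_snd).mul hk)
  have h1 := integral_integral_swap (f := fun ζ η : Sph n => ((b.jacobian ζ : ℝ) : ℂ) *
      (h η * ((poissonKernel ((n : ℝ) - 1) (r • (b.toHomeo ζ : E n)) η : ℝ) : ℂ)))
      (integrable_of_continuous_sph_prod hc)
  simp only [integral_const_mul] at h1
  simp only [poissonIntegral]
  refine h1.trans (integral_congr_ae (Eventually.of_forall fun η => ?_))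
  have h2 := b.integral_poissonKernel_mul_jacobian hn (smul_coe_mem_ball hr0 hr η)
  have h3 : ∫ ζ, ((b.jacobian ζ : ℝ) : ℂ) *
      (h η * ((poissonKernel ((n : ℝ) - 1) (r • (b.toHomeo ζ : E n)) η : ℝ) : ℂ))
      ∂sphereMeasure n = h η * ((∫ ζ, poissonKernel ((n : ℝ) - 1) (r • (η : E n)) (b.toHomeo ζ) *
        b.jacobian ζ ∂sphereMeasure n : ℝ) : ℂ) := by
    rw [← integral_complex_ofReal, ← integral_const_mul]
    refine integral_congr_ae (Eventually.of_forall fun ζ => ?_)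
    simp only [poissonKernel_smul_comm ((n : ℝ) - 1) r (b.toHomeo ζ) η]
    push_cast
    ring
  simp only [h3, h2, Complex.ofReal_one, mul_one]

end BoundaryMap

theorem exists_norm_bound {n : ℕ} (h : C(Sph n, ℂ)) : ∃ M, ∀ ζ, ‖h ζ‖ ≤ M :=
  ⟨‖h‖, h.norm_coe_le_norm⟩

theorem tendsto_poissonIntegral_radial {n : ℕ} (hn : 0 < n) {α : ℝ} (hα : IsPoissonExponent n α)
    (h : C(Sph n, ℂ)) (ζ : Sph n) :
    Tendsto (fun r : ℝ => poissonIntegral α h (r • (ζ : E n))) (𝓝[Set.Ico 0 1] 1) (𝓝 (h ζ)) := by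
  refine (tendsto_poissonIntegral hn hα h.continuous ζ).comp ?_
  refine tendsto_nhdsWithin_iff.2 ⟨?_, ?_⟩
  · have : Tendsto (fun r : ℝ => r • (ζ : E n)) (𝓝 1) (𝓝 ((1 : ℝ) • (ζ : E n))) :=
      (Continuous.tendsto (by fun_prop) _)
    rw [one_smul] at this
    exact this.mono_left nhdsWithin_le_nhds
  · filter_upwards [eventually_mem_nhdsWithin] with r hr using smul_coe_mem_ball hr.1 hr.2 ζ

instance neBot_nhdsWithin_Ico : (𝓝[Set.Ico (0 : ℝ) 1] 1).NeBot := by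
  rw [← mem_closure_iff_nhdsWithin_neBot, closure_Ico zero_ne_one]
  exact Set.right_mem_Icc.2 zero_le_one

namespace BoundaryMap

variable {n : ℕ} {φ : Equiv.Perm (Ball n)} (b : BoundaryMap n φ)

/-- The change of variables without differentiating the map: `h` is replaced by its dilated
hyperbolic Poisson integral. After Fubini, the inner integral is the mass of a Poisson kernel with
pole at a preimage, that is `1`. Then `r → 1` under the bound `M`. -/
theorem integral_jacobian_mul_comp (hn : 2 < n) (h : C(Sph n, ℂ)) :
    ∫ ζ, ((b.jacobian ζ : ℝ) : ℂ) * h (b.toHomeo ζ) ∂sphereMeasure n =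
      ∫ ζ, h ζ ∂sphereMeasure n := by
  have hα := isPoissonExponent_hyp hn
  obtain ⟨M, hM⟩ := exists_norm_bound h
  have h1 : Tendsto (fun r : ℝ => ∫ ζ, ((b.jacobian ζ : ℝ) : ℂ) *
      poissonIntegral ((n : ℝ) - 1) h (r • (b.toHomeo ζ : E n)) ∂sphereMeasure n)
      (𝓝[Set.Ico 0 1] 1)
      (𝓝 (∫ ζ, ((b.jacobian ζ : ℝ) : ℂ) * h (b.toHomeo ζ) ∂sphereMeasure n)) := by
    refine tendsto_integral_filter_of_dominated_convergence
      (fun ζ => ‖((b.jacobian ζ : ℝ) : ℂ)‖ * M) ?_ ?_ ?_ ?_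
    · filter_upwards [eventually_mem_nhdsWithin] with r hr
      exact (b.continuous_jacobian_complex.mul ((poissonMap ((n : ℝ) - 1) r hr.1 hr.2 h
        hα.2).continuous.comp b.toHomeo.continuous)).aestronglyMeasurable
    · filter_upwards [eventually_mem_nhdsWithin] with r hr
      refine Eventually.of_forall fun ζ => ?_
      rw [norm_mul]
      exact mul_le_mul_of_nonneg_left (norm_poissonIntegral_le (by omega) hα hM
        (smul_coe_mem_ball hr.1 hr.2 _)) (norm_nonneg _)
    · exact integrable_of_continuous_sph (b.continuous_jacobian_complex.norm.mul continuous_const)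
    · exact Eventually.of_forall fun ζ =>
        (tendsto_poissonIntegral_radial (by omega) hα h (b.toHomeo ζ)).const_mul _
  refine tendsto_nhds_unique h1 (tendsto_const_nhds.congr' ?_)
  filter_upwards [eventually_mem_nhdsWithin] with r hr
  exact (b.integral_jacobian_mul_poissonIntegral hn hr.1 hr.2 h).symm

/-- The surface measure with the Jacobian as density. -/
def jacobianMeasure : Measure (Sph n) := (sphereMeasure n).withDensity fun ζ => b.jacobian ζ

theorem measurable_jacobian : Measurable b.jacobian := b.continuous_jacobian.measurable

instance isFiniteMeasure_jacobianMeasure : IsFiniteMeasure b.jacobianMeasure := by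
  refine isFiniteMeasure_withDensity ?_
  have h := integrable_of_continuous_sph b.continuous_jacobian_complex
  have h2 := h.2.ne
  simpa [HasFiniteIntegral, enorm] using h2

theorem measurePreserving (hn : 2 < n) :
    MeasurePreserving b.toHomeo b.jacobianMeasure (sphereMeasure n) := by
  refine ⟨b.toHomeo.continuous.measurable, ?_⟩
  have := Measure.isFiniteMeasure_map b.jacobianMeasure b.toHomeo
  refine ext_of_forall_integral_eq_of_IsFiniteMeasure fun f => ?_
  rw [b.toHomeo.measurableEmbedding.integral_map, jacobianMeasure,
    integral_withDensity_eq_integral_smul b.measurable_jacobian]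
  have h := b.integral_jacobian_mul_comp hn
    ⟨fun ζ => ((f ζ : ℝ) : ℂ), Complex.continuous_ofReal.comp f.continuous⟩
  simp only [ContinuousMap.coe_mk, ← Complex.ofReal_mul] at h
  rw [integral_complex_ofReal, integral_complex_ofReal] at h
  exact Complex.ofReal_injective h

theorem integral_comp (hn : 2 < n) (f : Sph n → ℂ) :
    ∫ ζ, f ζ ∂sphereMeasure n = ∫ ζ, ((b.jacobian ζ : ℝ) : ℂ) * f (b.toHomeo ζ)
      ∂sphereMeasure n := by
  rw [← (b.measurePreserving hn).integral_comp b.toHomeo.measurableEmbedding, jacobianMeasure,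
    integral_withDensity_eq_integral_smul b.measurable_jacobian]
  rfl

theorem integral_comp_prod (hn : 2 < n) (f : Sph n × Sph n → ℂ) :
    ∫ p, f p ∂(sphereMeasure n).prod (sphereMeasure n) =
      ∫ p, (((b.jacobian p.1 : ℝ) : ℂ) * ((b.jacobian p.2 : ℝ) : ℂ)) *
        f (b.toHomeo p.1, b.toHomeo p.2) ∂(sphereMeasure n).prod (sphereMeasure n) := by
  have h1 := (b.measurePreserving hn).prod (b.measurePreserving hn)
  have h2 : b.jacobianMeasure.prod b.jacobianMeasure =
      ((sphereMeasure n).prod (sphereMeasure n)).withDensity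
        fun p => ((b.jacobian p.1 * b.jacobian p.2 : NNReal) : ENNReal) := by
    rw [jacobianMeasure, prod_withDensity (by exact b.measurable_jacobian.coe_nnreal_ennreal)
      (by exact b.measurable_jacobian.coe_nnreal_ennreal)]
    simp
  have h3 : Measurable fun p : Sph n × Sph n => b.jacobian p.1 * b.jacobian p.2 :=
    (b.measurable_jacobian.comp measurable_fst).mul (b.measurable_jacobian.comp measurable_snd)
  rw [← h1.integral_comp (b.toHomeo.prodCongr b.toHomeo).measurableEmbedding, h2,
    integral_withDensity_eq_integral_smul h3]
  refine integral_congr_ae (Eventually.of_forall fun p => ?_)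
  change ((b.jacobian p.1 * b.jacobian p.2 : NNReal) : ℝ) • f (b.toHomeo p.1, b.toHomeo p.2) = _
  rw [Complex.real_smul]
  push_cast
  rfl

/-- The Jacobian is continuous and positive on a compact space, hence bounded below. So composition
with the boundary map preserves `L²` and null sets. -/
theorem exists_sphereMeasure_le (hn : 0 < n) :
    ∃ c : ENNReal, c ≠ ⊤ ∧ sphereMeasure n ≤ c • b.jacobianMeasure := by
  have := isProbabilityMeasure_sphereMeasure hn
  have hne : (Set.univ : Set (Sph n)).Nonempty := by
    by_contra hcon
    rw [Set.not_nonempty_iff_eq_empty] at hcon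
    have h1 := measure_univ (μ := sphereMeasure n)
    rw [hcon, measure_empty] at h1
    exact zero_ne_one h1
  obtain ⟨ζ0, -, hmin⟩ := isCompact_univ.exists_isMinOn hne b.continuous_jacobian.continuousOn
  have hpos : 0 < b.jacobian ζ0 := pow_pos (b.factor_pos ζ0) _
  refine ⟨((b.jacobian ζ0)⁻¹ : NNReal), ENNReal.coe_ne_top, Measure.le_iff.2 fun s hs => ?_⟩
  rw [Measure.smul_apply, jacobianMeasure, withDensity_apply _ hs, smul_eq_mul]
  have h1 : (b.jacobian ζ0 : ENNReal) * sphereMeasure n s ≤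
      ∫⁻ ζ in s, b.jacobian ζ ∂sphereMeasure n := by
    rw [← setLIntegral_const]
    exact lintegral_mono fun ζ => ENNReal.coe_le_coe.2 (hmin (Set.mem_univ ζ))
  calc sphereMeasure n s = ((b.jacobian ζ0)⁻¹ : NNReal) *
        ((b.jacobian ζ0 : ENNReal) * sphereMeasure n s) := by
        rw [← mul_assoc, ← ENNReal.coe_mul, inv_mul_cancel₀ hpos.ne', ENNReal.coe_one, one_mul]
    _ ≤ _ := by gcongr

theorem memLp_comp (hn : 2 < n) {u : Sph n → ℂ} (hu : MemLp u 2 (sphereMeasure n)) :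
    MemLp (fun ζ => u (b.toHomeo ζ)) 2 (sphereMeasure n) := by
  obtain ⟨c, hc, hle⟩ := b.exists_sphereMeasure_le (by omega)
  exact (hu.comp_measurePreserving (b.measurePreserving hn)).of_measure_le_smul hc hle

theorem quasiMeasurePreserving (hn : 2 < n) :
    Measure.QuasiMeasurePreserving b.toHomeo (sphereMeasure n) (sphereMeasure n) := by
  obtain ⟨c, hc, hle⟩ := b.exists_sphereMeasure_le (by omega)
  exact (b.measurePreserving hn).quasiMeasurePreserving.mono_left
    (Measure.absolutelyContinuous_of_le_smul hle)

/-! ### Invariance of the logarithmic energy -/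

/-- The transformation of densities. -/
def density (μ : C(Sph n, ℂ)) : C(Sph n, ℂ) where
  toFun ζ := ((b.jacobian ζ : ℝ) : ℂ) * μ (b.toHomeo ζ)
  continuous_toFun :=
    b.continuous_jacobian_complex.mul (μ.continuous.comp b.toHomeo.continuous)

theorem density_apply (μ : C(Sph n, ℂ)) (ζ : Sph n) :
    b.density μ ζ = ((b.jacobian ζ : ℝ) : ℂ) * μ (b.toHomeo ζ) := rfl

theorem integral_density (hn : 2 < n) (μ : C(Sph n, ℂ)) :
    ∫ ζ, b.density μ ζ ∂sphereMeasure n = ∫ ζ, μ ζ ∂sphereMeasure n :=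
  (b.integral_comp hn _).symm

/-- By `dist_sq` the logarithm splits into `log |ζ-η|²`, `log j(ζ)` and `log j(η)`. Each of the last
two leaves one variable free, over which the density integrates to zero. -/
theorem logEnergy_density (hn : 2 < n) {μ : C(Sph n, ℂ)} (h0 : ∫ ζ, μ ζ ∂sphereMeasure n = 0) :
    logEnergy (b.density μ) = logEnergy μ := by
  set ν := b.density μ with hν
  have hν0 : ∫ ζ, ν ζ ∂sphereMeasure n = 0 := by rw [hν, b.integral_density hn, h0]
  have hνc : Continuous fun p : Sph n × Sph n => ν p.2 * (starRingEnd ℂ) (ν p.1) :=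
    (ν.continuous.comp continuous_snd).mul
      (Complex.continuous_conj.comp (ν.continuous.comp continuous_fst))
  have hlog : Continuous fun ζ => ((Real.log (b.factor ζ) : ℝ) : ℂ) :=
    Complex.continuous_ofReal.comp (b.continuous_factor.log fun ζ => (b.factor_pos ζ).ne')
  obtain ⟨C, hC⟩ := isCompact_univ.exists_bound_of_continuousOn hνc.continuousOn
  have i1 : Integrable (fun p : Sph n × Sph n => ((-Real.log (‖(p.1 : E n) - p.2‖ ^ 2) : ℝ) : ℂ) *
      (ν p.2 * (starRingEnd ℂ) (ν p.1))) ((sphereMeasure n).prod (sphereMeasure n)) :=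
    (integrable_log_norm_sub (by omega)).neg.ofReal.mul_bdd (c := C) hνc.aestronglyMeasurable
      (Eventually.of_forall fun q => hC q (Set.mem_univ _))
  have i2 : Integrable (fun p : Sph n × Sph n => (starRingEnd ℂ) (ν p.1) *
      (((Real.log (b.factor p.2) : ℝ) : ℂ) * ν p.2))
      ((sphereMeasure n).prod (sphereMeasure n)) :=
    integrable_of_continuous_sph_prod ((Complex.continuous_conj.comp
      (ν.continuous.comp continuous_fst)).mul ((hlog.mul ν.continuous).comp continuous_snd))
  have i3 : Integrable (fun p : Sph n × Sph n => (((Real.log (b.factor p.1) : ℝ) : ℂ) *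
      (starRingEnd ℂ) (ν p.1)) * ν p.2) ((sphereMeasure n).prod (sphereMeasure n)) :=
    integrable_of_continuous_sph_prod (((hlog.mul (Complex.continuous_conj.comp
      ν.continuous)).comp continuous_fst).mul (ν.continuous.comp continuous_snd))
  have z2 : ∫ p : Sph n × Sph n, (starRingEnd ℂ) (ν p.1) *
      (((Real.log (b.factor p.2) : ℝ) : ℂ) * ν p.2) ∂(sphereMeasure n).prod (sphereMeasure n) = 0 := by
    rw [integral_prod_mul (fun ζ => (starRingEnd ℂ) (ν ζ))
      (fun ζ => ((Real.log (b.factor ζ) : ℝ) : ℂ) * ν ζ), integral_conj, hν0, map_zero, zero_mul]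
  have z3 : ∫ p : Sph n × Sph n, (((Real.log (b.factor p.1) : ℝ) : ℂ) *
      (starRingEnd ℂ) (ν p.1)) * ν p.2 ∂(sphereMeasure n).prod (sphereMeasure n) = 0 := by
    rw [integral_prod_mul (fun ζ => ((Real.log (b.factor ζ) : ℝ) : ℂ) * (starRingEnd ℂ) (ν ζ)),
      hν0, mul_zero]
  have key : logEnergy μ = logEnergy ν - 0 - 0 := by
    have e1 := integral_sub i1 i2
    have e2 := integral_sub (i1.sub i2) i3
    simp only [Pi.sub_apply] at e2
    rw [e1, z2, z3] at e2
    refine Eq.trans ?_ e2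
    rw [logEnergy, b.integral_comp_prod hn]
    refine integral_congr_ae ?_
    filter_upwards [ae_ne_prod (by omega)] with p hp
    have h1 := norm_sub_sq_pos hp
    have h2 := b.factor_pos p.1
    have h3 := b.factor_pos p.2
    simp only [b.dist_sq, hν, density_apply, map_mul, Complex.conj_ofReal]
    rw [Real.log_mul (mul_pos h2 h3).ne' h1.ne', Real.log_mul h2.ne' h3.ne']
    push_cast
    ring
  rw [key, sub_zero, sub_zero]

end BoundaryMap

/-! ### Invariance of the Dirichlet norm of boundary values -/

theorem harmProj_of_mem {n : ℕ} {m : ℕ} {v : L2 n} (hv : v ∈ sphericalHarmonics n m) :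
    harmProj m v = v :=
  Submodule.starProjection_eq_self_iff.2 hv

theorem inner_sphericalHarmonics {n : ℕ} (hn : 0 < n) {k m : ℕ} (hkm : k ≠ m) {v w : L2 n}
    (hv : v ∈ sphericalHarmonics n k) (hw : w ∈ sphericalHarmonics n m) : inner ℂ v w = 0 :=
  orthogonalFamily_sphericalHarmonics hn hkm ⟨v, hv⟩ ⟨w, hw⟩

theorem harmProj_of_mem_of_ne {n : ℕ} (hn : 0 < n) {k m : ℕ} (hkm : k ≠ m) {v : L2 n}
    (hv : v ∈ sphericalHarmonics n k) : harmProj m v = 0 :=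
  (Submodule.starProjection_apply_eq_zero_iff _).2 ((Submodule.mem_orthogonal _ _).2
    fun _ hw => inner_sphericalHarmonics hn hkm.symm hw hv)

theorem contL2_one_mem {n : ℕ} : contL2 (1 : C(Sph n, ℂ)) ∈ sphericalHarmonics n 0 := by
  refine mem_sphericalHarmonics.2 ⟨1, ⟨MvPolynomial.isHomogeneous_one _ _, ?_⟩, ?_⟩
  · rw [← map_one MvPolynomial.C]
    simp
  · congr 1
    ext ζ
    simp [spherePoly_apply, evalPoly]

/-- A continuous representative of a linear combination of the components of `g`, with the weights
of the Dirichlet norm as coefficients. -/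
theorem exists_weighted_sum {n : ℕ} (hn : 2 < n) (g : L2 n) (M : ℕ) :
    ∃ μ : C(Sph n, ℂ), ∫ ζ, μ ζ ∂sphereMeasure n = 0 ∧
      (∀ m, harmProj m (contL2 μ) = if m < M then (weight n m : ℂ) • harmProj m g else 0) ∧
      inner ℂ (contL2 μ) g =
        ((∑ m ∈ Finset.range M, weight n m * ‖harmProj m g‖ ^ 2 : ℝ) : ℂ) := by
  have h1 := fun m => mem_sphericalHarmonics.1 (harmProj_mem m g)
  choose P hP hPg using h1
  set μ : C(Sph n, ℂ) := ∑ m ∈ Finset.range M, (weight n m : ℂ) • spherePoly n (P m) with hμ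
  have e : contL2 μ = ∑ m ∈ Finset.range M, (weight n m : ℂ) • harmProj m g := by
    refine (map_sum (ContinuousMap.toLp 2 (sphereMeasure n) ℂ) _ _).trans
      (Finset.sum_congr rfl fun m _ => ?_)
    exact (map_smul _ _ _).trans (congrArg _ (hPg m))
  refine ⟨μ, ?_, fun m => ?_, ?_⟩
  · have h2 : inner ℂ (contL2 1) (contL2 μ) = ∫ ζ, μ ζ ∂sphereMeasure n := by
      rw [inner_contL2]
      simp
    rw [← h2, e, inner_sum]
    refine Finset.sum_eq_zero fun m _ => ?_
    rw [inner_smul_right]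
    rcases eq_or_ne m 0 with rfl | hm
    -- The weight of degree `0` vanishes, which is why the combination has mean zero for every `g`.
    · rw [weight_zero (by omega), Complex.ofReal_zero, zero_mul]
    · rw [inner_sphericalHarmonics (by omega) hm.symm contL2_one_mem (harmProj_mem m g), mul_zero]
  · rw [e, map_sum]
    have h3 : ∀ k ∈ Finset.range M, harmProj m ((weight n k : ℂ) • harmProj k g) =
        if m = k then (weight n m : ℂ) • harmProj m g else 0 := by
      intro k _
      rw [map_smul]
      split_ifs with hk
      · rw [← hk, harmProj_of_mem (harmProj_mem m g)]
      · rw [harmProj_of_mem_of_ne (by omega) (Ne.symm hk) (harmProj_mem k g), smul_zero]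
    rw [Finset.sum_congr rfl h3, Finset.sum_ite_eq]
    simp only [Finset.mem_range]
  · rw [e, sum_inner, Complex.ofReal_sum]
    refine Finset.sum_congr rfl fun m _ => ?_
    have h4 : inner ℂ (harmProj m g) g = ((‖harmProj m g‖ ^ 2 : ℝ) : ℂ) := by
      rw [← inner_conj_symm, inner_harmProj, inner_conj_symm, inner_self_eq_norm_sq_to_K]
      push_cast
      rfl
    rw [inner_smul_left, h4, Complex.conj_ofReal]
    push_cast
    rfl

/-- The sum of the squared norms of the components of `μ` in the dual norm. -/
theorem hasSum_dual_norm {n : ℕ} (hn : 2 < n) {μ : C(Sph n, ℂ)}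
    (h0 : ∫ ζ, μ ζ ∂sphereMeasure n = 0) :
    HasSum (fun m => ‖harmProj m (contL2 μ)‖ ^ 2 / weight n m)
      ((logEnergy μ).re / (n - 2).factorial) := by
  have h1 := Complex.hasSum_re (hasSum_logEnergy (by omega : 1 < n) h0)
  simp only [Complex.ofReal_re] at h1
  have h2 := h1.div_const ((n - 2).factorial : ℝ)
  have h3 : ((n - 2).factorial : ℝ) ≠ 0 := Nat.cast_ne_zero.2 (Nat.factorial_ne_zero _)
  rw [← hasSum_nat_add_iff' 1]
  simp only [Finset.range_one, Finset.sum_singleton, weight_zero (by omega : 1 < n), div_zero,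
    sub_zero]
  refine (congrArg (fun F => HasSum F _) (funext fun m => ?_)).mpr h2
  have h4 : weight n (m + 1) ≠ 0 :=
    (zero_lt_one.trans_le (one_le_weight_succ (by omega : 1 < n) m)).ne'
  field_simp

namespace BoundaryMap

variable {n : ℕ} {φ : Equiv.Perm (Ball n)} (b : BoundaryMap n φ)

/-- Composition with the boundary map. -/
def pullback (hn : 2 < n) (u : L2 n) : L2 n := (b.memLp_comp hn (Lp.memLp u)).toLp

theorem coeFn_pullback (hn : 2 < n) (u : L2 n) :
    b.pullback hn u =ᵐ[sphereMeasure n] fun ζ => u (b.toHomeo ζ) :=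
  MemLp.coeFn_toLp _

theorem pullback_add (hn : 2 < n) (u v : L2 n) :
    b.pullback hn (u + v) = b.pullback hn u + b.pullback hn v := by
  refine Lp.ext ?_
  filter_upwards [b.coeFn_pullback hn (u + v), b.coeFn_pullback hn u, b.coeFn_pullback hn v,
    Lp.coeFn_add (b.pullback hn u) (b.pullback hn v),
    (b.quasiMeasurePreserving hn).ae (Lp.coeFn_add u v)] with ζ h1 h2 h3 h4 h5
  rw [h1, h4, Pi.add_apply, h2, h3, h5, Pi.add_apply]

theorem pullback_smul (hn : 2 < n) (c : ℂ) (u : L2 n) :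
    b.pullback hn (c • u) = c • b.pullback hn u := by
  refine Lp.ext ?_
  filter_upwards [b.coeFn_pullback hn (c • u), b.coeFn_pullback hn u,
    Lp.coeFn_smul c (b.pullback hn u),
    (b.quasiMeasurePreserving hn).ae (Lp.coeFn_smul c u)] with ζ h1 h2 h4 h5
  rw [h1, h4, Pi.smul_apply, h2, h5, Pi.smul_apply]

theorem symm_pullback_pullback (hn : 2 < n) (u : L2 n) :
    b.symm.pullback hn (b.pullback hn u) = u := by
  refine Lp.ext ?_
  filter_upwards [b.symm.coeFn_pullback hn (b.pullback hn u),
    (b.symm.quasiMeasurePreserving hn).ae (b.coeFn_pullback hn u)] with ζ h1 h2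
  rw [h1, h2]
  exact congrArg u (b.toHomeo.apply_symm_apply ζ)

/-- Composition with the boundary map is adjoint to transporting densities by the inverse map. -/
theorem inner_pullback (hn : 2 < n) (μ : C(Sph n, ℂ)) (u : L2 n) :
    inner ℂ (contL2 μ) (b.pullback hn u) = inner ℂ (contL2 (b.symm.density μ)) u := by
  have h1 : inner ℂ (contL2 μ) (b.pullback hn u) =
      ∫ ζ, u (b.toHomeo ζ) * (starRingEnd ℂ) (μ ζ) ∂sphereMeasure n := by
    rw [L2.inner_def]
    refine integral_congr_ae ?_
    filter_upwards [b.coeFn_pullback hn u, ContinuousMap.coeFn_toLp (p := 2) (𝕜 := ℂ)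
      (sphereMeasure n) μ] with ζ h1 h2
    rw [h1, h2]
    rfl
  have h2 : inner ℂ (contL2 (b.symm.density μ)) u =
      ∫ ζ, u ζ * (starRingEnd ℂ) (b.symm.density μ ζ) ∂sphereMeasure n := by
    rw [L2.inner_def]
    refine integral_congr_ae ?_
    filter_upwards [ContinuousMap.coeFn_toLp (p := 2) (𝕜 := ℂ)
      (sphereMeasure n) (b.symm.density μ)] with ζ h2
    rw [h2]
    rfl
  rw [h1, h2, b.symm.integral_comp hn]
  refine integral_congr_ae (Eventually.of_forall fun ζ => ?_)
  simp only [density_apply, map_mul, Complex.conj_ofReal]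
  rw [show b.toHomeo (b.symm.toHomeo ζ) = ζ from b.toHomeo.apply_symm_apply ζ]
  ring

/-- The truncated norm `N` of the pullback is attained by a test density `μ`: both the pairing of
`μ` with the pullback and the dual norm squared of `μ` equal `N`. Transported, `μ` becomes `ν` with
the same dual norm, since the energy is invariant, and its pairing with `u` is again `N`. Then `2xy
≤ x²/w + wy²` gives `N ≤ (N + ‖u‖²)/2`, that is `N ≤ ‖u‖²` in the Dirichlet norm. Truncation avoids
presupposing that the norm of the pullback is finite. -/
theorem sum_weight_pullback_le (hn : 2 < n) {u : L2 n}
    (hu : Summable fun m => weight n m * ‖harmProj m u‖ ^ 2) (M : ℕ) :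
    ∑ m ∈ Finset.range M, weight n m * ‖harmProj m (b.pullback hn u)‖ ^ 2 ≤
      ∑' m, weight n m * ‖harmProj m u‖ ^ 2 := by
  obtain ⟨μ, h0, hμ, hin⟩ := exists_weighted_sum hn (b.pullback hn u) M
  set N := ∑ m ∈ Finset.range M, weight n m * ‖harmProj m (b.pullback hn u)‖ ^ 2 with hN
  set ν := b.symm.density μ with hν
  have hν0 : ∫ ζ, ν ζ ∂sphereMeasure n = 0 := by rw [hν, b.symm.integral_density hn, h0]
  have h1 : HasSum (fun m => ‖harmProj m (contL2 μ)‖ ^ 2 / weight n m) N := by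
    rw [hN]
    have h2 : HasSum (fun m => ‖harmProj m (contL2 μ)‖ ^ 2 / weight n m)
        (∑ m ∈ Finset.range M, ‖harmProj m (contL2 μ)‖ ^ 2 / weight n m) :=
      hasSum_sum_of_ne_finset_zero fun m hm => by simp [hμ, Finset.mem_range.not.1 hm]
    have h4 : ∀ m ∈ Finset.range M, ‖harmProj m (contL2 μ)‖ ^ 2 / weight n m =
        weight n m * ‖harmProj m (b.pullback hn u)‖ ^ 2 := by
      intro m hm
      rw [hμ, if_pos (Finset.mem_range.1 hm), norm_smul, Complex.norm_real, Real.norm_eq_abs,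
        mul_pow, sq_abs]
      rcases eq_or_ne (weight n m) 0 with h | h
      · simp [h]
      · field_simp
    rwa [Finset.sum_congr rfl h4] at h2
  have h2 : HasSum (fun m => ‖harmProj m (contL2 ν)‖ ^ 2 / weight n m) N := by
    have h3 := hasSum_dual_norm hn hν0
    rw [hν, b.symm.logEnergy_density hn h0, ← hν] at h3
    rwa [h1.unique (hasSum_dual_norm hn h0)]
  have h3 : HasSum (fun m => (inner ℂ (harmProj m (contL2 ν)) (harmProj m u) : ℂ).re) N := by
    have h4 := Complex.hasSum_re (hasSum_inner_harmProj (by omega) (contL2 ν) u)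
    rwa [hν, ← b.inner_pullback hn, hin, Complex.ofReal_re] at h4
  have h5 := hasSum_le (fun m => ?_) h3 ((h2.add hu.hasSum).div_const 2)
  · linarith
  · have h6 : (inner ℂ (harmProj m (contL2 ν)) (harmProj m u) : ℂ).re ≤
        ‖harmProj m (contL2 ν)‖ * ‖harmProj m u‖ := re_inner_le_norm (𝕜 := ℂ) _ _
    refine h6.trans ?_
    -- In degree `0` the weight is zero and the quotient is `0` by convention; the pairing also
    -- vanishes there because `ν` has mean zero.
    rcases m with _ | m
    · rw [harmProj_zero_eq_zero hν0]
      simp [weight_zero (by omega : 1 < n)]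
    · have hw : 0 < weight n (m + 1) := by linarith [one_le_weight_succ (by omega : 1 < n) m]
      set x := ‖harmProj (m + 1) (contL2 ν)‖
      set y := ‖harmProj (m + 1) u‖
      set w := weight n (m + 1)
      have h7 : x ^ 2 / w + w * y ^ 2 - 2 * (x * y) = (x - w * y) ^ 2 / w := by
        field_simp
        ring
      have h8 : 0 ≤ (x - w * y) ^ 2 / w := by positivity
      linarith

theorem summable_pullback (hn : 2 < n) {u : L2 n}
    (hu : Summable fun m => weight n m * ‖harmProj m u‖ ^ 2) :
    Summable fun m => weight n m * ‖harmProj m (b.pullback hn u)‖ ^ 2 :=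
  summable_of_sum_range_le (fun m => mul_nonneg (weight_nonneg (by omega) m) (sq_nonneg _))
    (b.sum_weight_pullback_le hn hu)

theorem tsum_pullback_le (hn : 2 < n) {u : L2 n}
    (hu : Summable fun m => weight n m * ‖harmProj m u‖ ^ 2) :
    ∑' m, weight n m * ‖harmProj m (b.pullback hn u)‖ ^ 2 ≤
      ∑' m, weight n m * ‖harmProj m u‖ ^ 2 :=
  Real.tsum_le_of_sum_range_le
    (fun m => mul_nonneg (weight_nonneg (by omega) m) (sq_nonneg _))
    (b.sum_weight_pullback_le hn hu)

/-- The reverse inequality is the same estimate for the inverse map. -/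
theorem tsum_pullback (hn : 2 < n) {u : L2 n}
    (hu : Summable fun m => weight n m * ‖harmProj m u‖ ^ 2) :
    ∑' m, weight n m * ‖harmProj m (b.pullback hn u)‖ ^ 2 =
      ∑' m, weight n m * ‖harmProj m u‖ ^ 2 := by
  refine le_antisymm (b.tsum_pullback_le hn hu) ?_
  have h := b.symm.tsum_pullback_le hn (b.summable_pullback hn hu)
  rwa [b.symm_pullback_pullback] at h

end BoundaryMap

/-! ### Boundary values of functions in the Dirichlet space -/

/-- The Poisson kernel of the hyperbolic Laplacian with pole at `x`. -/
def hypKernel {n : ℕ} (x : Ball n) : C(Sph n, ℂ) where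
  toFun ζ := ((poissonKernel ((n : ℝ) - 1) (x : E n) ζ : ℝ) : ℂ)
  continuous_toFun := Complex.continuous_ofReal.comp (continuous_poissonKernel_snd _ x.2)

theorem inner_hypKernel_contL2 {n : ℕ} (x : Ball n) (h : C(Sph n, ℂ)) :
    inner ℂ (contL2 (hypKernel x)) (contL2 h) = poissonIntegral ((n : ℝ) - 1) h x := by
  rw [inner_contL2, poissonIntegral]
  refine integral_congr_ae (Eventually.of_forall fun ζ => ?_)
  exact congrArg (h ζ * ·) (Complex.conj_ofReal _)

theorem BoundaryMap.density_symm_hypKernel {n : ℕ} (hn : 2 < n) {φ : Equiv.Perm (Ball n)}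
    (b : BoundaryMap n φ) (x : Ball n) : b.symm.density (hypKernel x) = hypKernel (φ x) := by
  ext ζ
  have h := b.symm.poissonKernel_mul_jacobian (by omega) (φ x) ζ
  rw [show φ⁻¹ (φ x) = x from φ.symm_apply_apply x, mul_comm] at h
  rw [density_apply]
  change ((b.symm.jacobian ζ : ℝ) : ℂ) *
    ((poissonKernel ((n : ℝ) - 1) (x : E n) (b.symm.toHomeo ζ) : ℝ) : ℂ) =
    ((poissonKernel ((n : ℝ) - 1) (φ x : E n) ζ : ℝ) : ℂ)
  rw [← h, Complex.ofReal_mul]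

theorem BoundaryMap.inner_hypKernel_pullback {n : ℕ} (hn : 2 < n) {φ : Equiv.Perm (Ball n)}
    (b : BoundaryMap n φ) (x : Ball n) (u : L2 n) :
    inner ℂ (contL2 (hypKernel x)) (b.pullback hn u) = inner ℂ (contL2 (hypKernel (φ x))) u := by
  rw [b.inner_pullback, b.density_symm_hypKernel hn]

/-! ### Injectivity of the hyperbolic Poisson integral on `L²` -/

theorem inner_contL2_poissonMap {n : ℕ} (hn : 2 < n) {w : L2 n}
    (hw : ∀ x, inner ℂ (contL2 (hypKernel x)) w = 0) {r : ℝ} (hr0 : 0 ≤ r) (hr : r < 1)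
    (k : C(Sph n, ℂ)) :
    inner ℂ (contL2 (poissonMap ((n : ℝ) - 1) r hr0 hr k (isPoissonExponent_hyp hn).2)) w = 0 := by
  have := isProbabilityMeasure_sphereMeasure (by omega : 0 < n)
  have hwi : Integrable w (sphereMeasure n) := (Lp.memLp w).integrable (by norm_num)
  have h1 : inner ℂ (contL2 (poissonMap ((n : ℝ) - 1) r hr0 hr k (isPoissonExponent_hyp hn).2)) w =
      ∫ ζ, w ζ * poissonIntegral ((n : ℝ) - 1) (fun η => (starRingEnd ℂ) (k η)) (r • (ζ : E n))
        ∂sphereMeasure n := by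
    rw [L2.inner_def]
    refine integral_congr_ae ?_
    filter_upwards [ContinuousMap.coeFn_toLp (p := 2) (𝕜 := ℂ) (sphereMeasure n)
      (poissonMap ((n : ℝ) - 1) r hr0 hr k (isPoissonExponent_hyp hn).2)] with ζ h2
    rw [h2, ← conj_poissonIntegral]
    rfl
  have hk : Integrable (fun η => (starRingEnd ℂ) (k η)) (sphereMeasure n) :=
    integrable_of_continuous_sph (Complex.continuous_conj.comp k.continuous)
  rw [h1, integral_mul_poissonIntegral_comm _ hr0 hr hk hwi]
  refine (integral_congr_ae (Eventually.of_forall fun ζ => ?_)).trans (integral_zero' _ _)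
  have h3 : poissonIntegral ((n : ℝ) - 1) w (r • (ζ : E n)) =
      inner ℂ (contL2 (hypKernel ⟨_, smul_coe_mem_ball hr0 hr ζ⟩)) w := by
    rw [L2.inner_def, poissonIntegral]
    refine integral_congr_ae ?_
    filter_upwards [ContinuousMap.coeFn_toLp (p := 2) (𝕜 := ℂ) (sphereMeasure n)
      (hypKernel ⟨_, smul_coe_mem_ball hr0 hr ζ⟩)] with η h2
    rw [h2]
    exact congrArg (w η * ·) (Complex.conj_ofReal _).symm
  simp only [h3, hw, mul_zero, Pi.zero_apply]

/-- By symmetry, a `w` with vanishing Poisson integral is orthogonal to all dilated Poisson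
integrals of continuous functions `k`. These tend to `k` as `r → 1`, and continuous functions are
dense. Thus radial limits are needed only for continuous functions, not for `w`. -/
theorem eq_zero_of_inner_hypKernel {n : ℕ} (hn : 2 < n) {w : L2 n}
    (hw : ∀ x, inner ℂ (contL2 (hypKernel x)) w = 0) : w = 0 := by
  have := isProbabilityMeasure_sphereMeasure (by omega : 0 < n)
  have hα := isPoissonExponent_hyp hn
  have hwi : Integrable w (sphereMeasure n) := (Lp.memLp w).integrable (by norm_num)
  have hd : DenseRange (fun k : C(Sph n, ℂ) => contL2 k) :=
    ContinuousMap.toLp_denseRange ℂ (sphereMeasure n) ℂ (p := 2) (by simp)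
  refine hd.eq_zero_of_inner_left ℂ fun k => ?_
  rw [← inner_conj_symm, map_eq_zero]
  obtain ⟨M, hM⟩ := exists_norm_bound k
  have e : inner ℂ (contL2 k) w = ∫ ζ, w ζ * (starRingEnd ℂ) (k ζ) ∂sphereMeasure n := by
    rw [L2.inner_def]
    refine integral_congr_ae ?_
    filter_upwards [ContinuousMap.coeFn_toLp (p := 2) (𝕜 := ℂ) (sphereMeasure n) k] with ζ h2
    rw [h2]
    rfl
  have h1 : Tendsto (fun r : ℝ => ∫ ζ, w ζ * (starRingEnd ℂ)
      (poissonIntegral ((n : ℝ) - 1) k (r • (ζ : E n))) ∂sphereMeasure n)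
      (𝓝[Set.Ico 0 1] 1) (𝓝 (inner ℂ (contL2 k) w)) := by
    rw [e]
    refine tendsto_integral_filter_of_dominated_convergence (fun ζ => ‖w ζ‖ * M) ?_ ?_ ?_ ?_
    · filter_upwards [eventually_mem_nhdsWithin] with r hr
      exact hwi.1.mul (Complex.continuous_conj.comp (poissonMap ((n : ℝ) - 1) r hr.1 hr.2 k
        hα.2).continuous).aestronglyMeasurable
    · filter_upwards [eventually_mem_nhdsWithin] with r hr
      refine Eventually.of_forall fun ζ => ?_
      rw [norm_mul, RCLike.norm_conj]
      exact mul_le_mul_of_nonneg_left (norm_poissonIntegral_le (by omega) hα hM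
        (smul_coe_mem_ball hr.1 hr.2 _)) (norm_nonneg _)
    · exact hwi.norm.mul_const M
    · exact Eventually.of_forall fun ζ => ((Complex.continuous_conj.tendsto _).comp
        (tendsto_poissonIntegral_radial (by omega) hα k ζ)).const_mul _
  refine tendsto_nhds_unique h1 (tendsto_const_nhds.congr' ?_)
  filter_upwards [eventually_mem_nhdsWithin] with r hr
  rw [← inner_contL2_poissonMap hn hw hr.1 hr.2 k, L2.inner_def]
  refine integral_congr_ae ?_
  filter_upwards [ContinuousMap.coeFn_toLp (p := 2) (𝕜 := ℂ) (sphereMeasure n)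
    (poissonMap ((n : ℝ) - 1) r hr.1 hr.2 k hα.2)] with ζ h2
  rw [h2]
  rfl

/-- `u` has finite Dirichlet norm and its Poisson integral is `f`. -/
def IsBoundaryData {n : ℕ} (f : Ball n → ℂ) (u : L2 n) : Prop :=
  (∀ x, f x = inner ℂ (contL2 (hypKernel x)) u) ∧
    Summable fun m => weight n m * ‖harmProj m u‖ ^ 2

theorem IsBoundaryData.unique {n : ℕ} (hn : 2 < n) {f : Ball n → ℂ} {u v : L2 n}
    (hu : IsBoundaryData f u) (hv : IsBoundaryData f v) : u = v := by
  refine sub_eq_zero.1 (eq_zero_of_inner_hypKernel hn fun x => ?_)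
  rw [inner_sub_right, ← hu.1, ← hv.1, sub_self]

theorem IsBoundaryData.comp {n : ℕ} (hn : 2 < n) {f : Ball n → ℂ} {u : L2 n}
    (hu : IsBoundaryData f u) {φ : Equiv.Perm (Ball n)} (b : BoundaryMap n φ) :
    IsBoundaryData (f ∘ φ) (b.pullback hn u) :=
  ⟨fun x => by rw [b.inner_hypKernel_pullback, ← hu.1]; rfl, b.summable_pullback hn hu.2⟩

theorem IsSolidHarmonic.exists_boundary {n m : ℕ} {f : E n → ℂ} (hf : IsSolidHarmonic n m f) :
    ∃ h : C(Sph n, ℂ), contL2 h ∈ sphericalHarmonics n m ∧ ∀ ζ : Sph n, f ζ = h ζ := by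
  obtain ⟨P, hP, hfP⟩ := hf.2.2
  exact ⟨spherePoly n P, mem_sphericalHarmonics.2 ⟨P, hP, rfl⟩, fun ζ => hfP ζ ζ.2⟩

theorem norm_contL2_sq {n : ℕ} (h : C(Sph n, ℂ)) :
    ‖contL2 h‖ ^ 2 = ∫ ζ, ‖h ζ‖ ^ 2 ∂sphereMeasure n := by
  have h1 := inner_contL2 h h
  simp only [Complex.mul_conj, Complex.normSq_eq_norm_sq] at h1
  rw [integral_complex_ofReal, inner_self_eq_norm_sq_to_K] at h1
  exact Complex.ofReal_injective (by rw [← h1]; push_cast; rfl)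

/-- Since `K ≠ 0`, summability does not depend on its sign or size. The weights are at least `1`
from degree `1` on, so the boundary components are square summable and their orthogonal sum
converges in `L²`. Poisson's formula in each degree identifies `f` with the Poisson integral of that
sum. -/
theorem IsDirichletExpansion.exists_boundaryData {n : ℕ} (hn : 2 < n) {f : Ball n → ℂ}
    {F : ℕ → E n → ℂ} (hF : IsDirichletExpansion n f F) :
    ∃ u : L2 n, IsBoundaryData f u ∧
      ∀ m, ∃ h : C(Sph n, ℂ), contL2 h = harmProj m u ∧ ∀ ζ : Sph n, F m ζ = h ζ := by
  obtain ⟨K, hK, hIK⟩ := exists_Icirc_eq hn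
  choose h hh hFh using fun m => (hF.1 m).exists_boundary
  have hsq : ∀ m, sphereNormSq n (F m) = ‖contL2 (h m)‖ ^ 2 := by
    intro m
    rw [norm_contL2_sq, sphereNormSq]
    simp only [hFh]
  have hs : Summable fun m => weight n m * ‖contL2 (h m)‖ ^ 2 := by
    have h1 := hF.2.2
    simp only [hIK, hsq, mul_assoc] at h1
    exact (summable_mul_left_iff hK).1 h1
  have hs1 : Summable fun m => ‖contL2 (h m)‖ ^ 2 := by
    rw [← summable_nat_add_iff 1]
    refine Summable.of_nonneg_of_le (fun _ => sq_nonneg _) (fun m => ?_)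
      ((summable_nat_add_iff 1).2 hs)
    exact le_mul_of_one_le_left (sq_nonneg _) (one_le_weight_succ (by omega) m)
  have horth := orthogonalFamily_sphericalHarmonics (n := n) (by omega)
  have hs2 : Summable fun m => contL2 (h m) :=
    (horth.summable_iff_norm_sq_summable fun m => ⟨contL2 (h m), hh m⟩).2 hs1
  have hproj : ∀ m, harmProj m (∑' k, contL2 (h k)) = contL2 (h m) :=
    starProjection_eq_of_hasSum horth hh hs2.hasSum
  refine ⟨∑' k, contL2 (h k), ⟨fun x => ?_, ?_⟩, fun m => ⟨h m, (hproj m).symm, hFh m⟩⟩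
  · have h2 : HasSum (fun m => inner ℂ (contL2 (hypKernel x)) (contL2 (h m)))
        (inner ℂ (contL2 (hypKernel x)) (∑' k, contL2 (h k))) :=
      hs2.hasSum.mapL (innerSL ℂ (contL2 (hypKernel x)))
    refine (hF.2.1 x).unique ((congrArg (fun G => HasSum G _) (funext fun m => ?_)).mpr h2)
    rw [inner_hypKernel_contL2, (isHHarmonic_iff_solvesL.1 (hF.1 m).2.1).eq_poissonIntegral
      (by omega) (isPoissonExponent_hyp hn) (hF.1 m).1 x.2]
    simp only [hFh]
  · simpa only [hproj] using hs

theorem IsBoundaryData.mem_dirichletSpace {n : ℕ} (hn : 2 < n) {f : Ball n → ℂ} {u : L2 n}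
    (hu : IsBoundaryData f u) : f ∈ dirichletSpace n := by
  obtain ⟨K, hK, hIK⟩ := exists_Icirc_eq hn
  have hα := isPoissonExponent_hyp hn
  choose P hP hPu using fun m => mem_sphericalHarmonics.1 (harmProj_mem m u)
  refine ⟨fun m => poissonExtension ((n : ℝ) - 1) (spherePoly n (P m)), fun m => ⟨?_, ?_, ?_⟩,
    fun x => ?_, ?_⟩
  · exact continuousOn_poissonExtension (by omega) hα (spherePoly n (P m)).continuous
  · exact isHHarmonic_iff_solvesL.2 (solvesL_poissonExtension hα
      (integrable_of_continuous_sph (spherePoly n (P m)).continuous))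
  · exact ⟨P m, hP m, fun ζ hζ => poissonExtension_coe _ _ ⟨ζ, hζ⟩⟩
  · have h2 : HasSum (fun m => inner ℂ (contL2 (hypKernel x)) (harmProj m u))
        (inner ℂ (contL2 (hypKernel x)) u) :=
      (hasSum_harmProj (by omega) u).mapL (innerSL ℂ (contL2 (hypKernel x)))
    rw [hu.1]
    refine (congrArg (fun G => HasSum G _) (funext fun m => ?_)).mpr h2
    beta_reduce
    rw [poissonExtension_of_mem_ball _ _ x.2, ← hPu, inner_hypKernel_contL2]
  · have h3 : ∀ m, Icirc n m * sphereNormSq n (poissonExtension ((n : ℝ) - 1)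
        (spherePoly n (P m))) = K * (weight n m * ‖harmProj m u‖ ^ 2) := by
      intro m
      rw [hIK, ← hPu, norm_contL2_sq, sphereNormSq, mul_assoc]
      simp only [poissonExtension_coe]
      rfl
    simp only [h3]
    exact hu.2.mul_left K

/-! ### The semi-inner product on boundary values, and polarization -/

theorem exists_dirichletInner_eq {n : ℕ} (hn : 2 < n) : ∃ K : ℝ, ∀ f ∈ dirichletSpace n,
    ∀ g ∈ dirichletSpace n, ∀ u v : L2 n, IsBoundaryData f u → IsBoundaryData g v →
      dirichletInner n f g =
        K * ∑' m, (weight n m : ℂ) * inner ℂ (harmProj m v) (harmProj m u) := by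
  obtain ⟨K, hK, hIK⟩ := exists_Icirc_eq hn
  have hcomp : ∀ f ∈ dirichletSpace n, IsDirichletExpansion n f (component n f) := by
    intro f hf
    have hf' : ∃ F : ℕ → E n → ℂ, IsDirichletExpansion n f F := hf
    rw [component, dif_pos hf']
    exact hf'.choose_spec
  refine ⟨K, fun f hf g hg u v hu hv => ?_⟩
  obtain ⟨u', hu', hfu⟩ := (hcomp f hf).exists_boundaryData hn
  obtain ⟨v', hv', hgv⟩ := (hcomp g hg).exists_boundaryData hn
  -- Boundary data are unique, so the choice hidden in `component` does not affect the result.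
  obtain rfl := hu.unique hn hu'
  obtain rfl := hv.unique hn hv'
  rw [dirichletInner, ← tsum_mul_left]
  refine tsum_congr fun m => ?_
  obtain ⟨h, hh, hfh⟩ := hfu m
  obtain ⟨k, hk, hgk⟩ := hgv m
  -- The inner product of `L²` is conjugate linear in its first argument, `sphereInner` in its
  -- second; hence the order of `v` and `u`.
  rw [← hh, ← hk, inner_contL2, sphereInner, hIK, Complex.ofReal_mul, mul_assoc]
  simp only [hfh, hgk]
  rfl

/-- Polarization in each degree. As composition with a boundary map is linear, it reduces invariance
of the form to invariance of the norm of `v + c u`. -/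
theorem tsum_weight_inner_eq {n : ℕ} (hn : 2 < n) {u v : L2 n}
    (hu : Summable fun m => weight n m * ‖harmProj m u‖ ^ 2)
    (hv : Summable fun m => weight n m * ‖harmProj m v‖ ^ 2) :
    (∀ c : ℂ, Summable fun m => weight n m * ‖harmProj m (v + c • u)‖ ^ 2) ∧
    ∑' m, (weight n m : ℂ) * inner ℂ (harmProj m v) (harmProj m u) =
      (((∑' m, weight n m * ‖harmProj m (v + (1 : ℂ) • u)‖ ^ 2 : ℝ) : ℂ) -
        ((∑' m, weight n m * ‖harmProj m (v + (-1 : ℂ) • u)‖ ^ 2 : ℝ) : ℂ) +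
        (((∑' m, weight n m * ‖harmProj m (v + (-Complex.I) • u)‖ ^ 2 : ℝ) : ℂ) -
          ((∑' m, weight n m * ‖harmProj m (v + Complex.I • u)‖ ^ 2 : ℝ) : ℂ)) * Complex.I) / 4 := by
  have hs : ∀ c : ℂ, Summable fun m => weight n m * ‖harmProj m (v + c • u)‖ ^ 2 := by
    intro c
    refine Summable.of_nonneg_of_le
      (fun m => mul_nonneg (weight_nonneg (by omega) m) (sq_nonneg _)) (fun m => ?_)
      ((hv.mul_left 2).add (hu.mul_left (2 * ‖c‖ ^ 2)))
    have h1 : ‖harmProj m (v + c • u)‖ ≤ ‖harmProj m v‖ + ‖c‖ * ‖harmProj m u‖ := by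
      rw [map_add, map_smul, ← norm_smul]
      exact norm_add_le _ _
    have h2 : ‖harmProj m (v + c • u)‖ ^ 2 ≤
        2 * ‖harmProj m v‖ ^ 2 + 2 * ‖c‖ ^ 2 * ‖harmProj m u‖ ^ 2 := by
      nlinarith [pow_le_pow_left₀ (norm_nonneg _) h1 2,
        sq_nonneg (‖harmProj m v‖ - ‖c‖ * ‖harmProj m u‖)]
    linarith [mul_le_mul_of_nonneg_left h2 (weight_nonneg (by omega : 1 < n) m)]
  refine ⟨hs, ?_⟩
  have hc := fun c => Complex.hasSum_ofReal.2 (hs c).hasSum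
  refine (HasSum.tsum_eq ((congrArg (fun G => HasSum G _) (funext fun m => ?_)).mpr
    ((((hc 1).sub (hc (-1))).add (((hc (-Complex.I)).sub (hc Complex.I)).mul_right
      Complex.I)).div_const 4)))
  rw [inner_eq_sum_norm_sq_div_four]
  simp only [map_add, map_smul, one_smul, neg_smul, ← sub_eq_add_neg, map_sub,
    RCLike.I_to_complex]
  push_cast
  simp only [Complex.coe_algebraMap]
  ring

theorem BoundaryMap.tsum_weight_inner_pullback {n : ℕ} (hn : 2 < n) {φ : Equiv.Perm (Ball n)}
    (b : BoundaryMap n φ) {u v : L2 n}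
    (hu : Summable fun m => weight n m * ‖harmProj m u‖ ^ 2)
    (hv : Summable fun m => weight n m * ‖harmProj m v‖ ^ 2) :
    ∑' m, (weight n m : ℂ) * inner ℂ (harmProj m (b.pullback hn v))
        (harmProj m (b.pullback hn u)) =
      ∑' m, (weight n m : ℂ) * inner ℂ (harmProj m v) (harmProj m u) := by
  obtain ⟨hs, h1⟩ := tsum_weight_inner_eq hn hu hv
  rw [h1, (tsum_weight_inner_eq hn (b.summable_pullback hn hu) (b.summable_pullback hn hv)).2]
  simp only [← b.pullback_smul, ← b.pullback_add, b.tsum_pullback hn (hs _)]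

theorem mem_dirichletSpace_iff {n : ℕ} (hn : 2 < n) {f : Ball n → ℂ} :
    f ∈ dirichletSpace n ↔ ∃ u, IsBoundaryData f u := by
  refine ⟨fun ⟨F, hF⟩ => ?_, fun ⟨u, hu⟩ => hu.mem_dirichletSpace hn⟩
  obtain ⟨u, hu, -⟩ := hF.exists_boundaryData hn
  exact ⟨u, hu⟩

theorem dirichletInner_comp {n : ℕ} (hn : 2 < n) {f g : Ball n → ℂ} (hf : f ∈ dirichletSpace n)
    (hg : g ∈ dirichletSpace n) {φ : Equiv.Perm (Ball n)} (hφ : φ ∈ moebiusGroup n) :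
    f ∘ φ ∈ dirichletSpace n ∧ g ∘ φ ∈ dirichletSpace n ∧
      dirichletInner n (f ∘ φ) (g ∘ φ) = dirichletInner n f g := by
  obtain ⟨b⟩ := nonempty_boundaryMap hφ
  obtain ⟨u, hu⟩ := (mem_dirichletSpace_iff hn).1 hf
  obtain ⟨v, hv⟩ := (mem_dirichletSpace_iff hn).1 hg
  have hfφ := (hu.comp hn b).mem_dirichletSpace hn
  have hgφ := (hv.comp hn b).mem_dirichletSpace hn
  obtain ⟨K, hK⟩ := exists_dirichletInner_eq hn
  refine ⟨hfφ, hgφ, ?_⟩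
  rw [hK f hf g hg u v hu hv, hK _ hfφ _ hgφ _ _ (hu.comp hn b) (hv.comp hn b),
    b.tsum_weight_inner_pullback hn hu.2 hv.2]

end HHarm

end

theorem mainTheorem1 (n : ℕ) (hn : 2 < n) :
    (∀ m : ℕ, HHarm.IsResidueCoeff n m (HHarm.Icirc n m)) ∧
    ∀ f ∈ HHarm.dirichletSpace n, ∀ g ∈ HHarm.dirichletSpace n,
      ∀ φ ∈ HHarm.moebiusGroup n,
        f ∘ φ ∈ HHarm.dirichletSpace n ∧ g ∘ φ ∈ HHarm.dirichletSpace n ∧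
        HHarm.dirichletInner n (f ∘ φ) (g ∘ φ) = HHarm.dirichletInner n f g :=
  ⟨HHarm.isResidueCoeff_Icirc hn, fun _ hf _ hg _ hφ => HHarm.dirichletInner_comp hn hf hg hφ⟩
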